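/- **Theorem (Convergence of the energy).** Let $X^\omega\subset\mathbb R$ be a Poisson point process of intensity $1$ and fix $\alpha\in[0,1]$. For $\nu>0$ let the obstacles $z_j^\omega$ be the points of $[0,1]$ of the form $\alpha+x/\nu$ with $x\in X^\omega$; they are the points of a Poisson process of density $\nu$ on $[0,1]$, and one sample $\omega$ gives a configuration for every $\nu$ (the choice $\alpha=0$ corresponds to the window $[0,\nu]$, the choice $\alpha=1/2$ to the window $[-\nu/2,\nu/2]$). For $\gamma,\sigma>0$ let $$e_\omega(\gamma,\sigma,\nu)=\inf\Big\{\int_0^1|\psi'(z)|^2\,dz+\sigma\sum_j|\psi(z_j^\omega)|^2+\frac{\gamma}{2}\int_0^1|\psi(z)|^4\,dz\ :\ \psi\in H^1_0(0,1;\mathbb C),\ \int_0^1|\psi|^2=1\Big\}$$ be the Gross-Pitaevskii ground state energy. Let $e_\omega(\gamma,\infty,\nu)$ be the same infimum, without the sum, over those $\psi$ that also vanish at all the obstacles, and let $e_0(\gamma,\nu)=\mathbb E_\omega\big[e_\omega(\gamma,\infty,\nu)\big]$ be its average over $\omega$. Then for almost every $\omega$ the following holds: for all sequences of real parameters $\nu_n\to\infty$,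 $\sigma_n\to\infty$, $\gamma_n\to\infty$ with $$\gamma_n\gg\frac{\nu_n}{(\ln\nu_n)^2}\qquad\text{and}\qquad \sigma_n\gg\frac{\nu_n}{1+\ln\left(1+\nu_n^2/\gamma_n\right)}$$ (where $a_n\gg b_n$ means $b_n/a_n\to0$) one has $$\lim_{n\to\infty}\frac{e_\omega(\gamma_n,\sigma_n,\nu_n)}{e_0(\gamma_n,\nu_n)}=1 .$$ -/

import Mathlib

open MeasureTheory ProbabilityTheory Filter Topology Set Asymptotics
open scoped NNReal ENNReal

namespace DisorderedGP

/-- `Z` is a (homogeneous) Poisson point process on the real line of intensity `rate`: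
the numbers of points in Borel sets are random variables, the number of points in a Borel set `B`
of finite Lebesgue measure has the Poisson law of parameter `rate * |B|`, and the numbers of points
in finitely many pairwise disjoint Borel sets are independent. -/
structure IsPoissonProcess {Ω : Type*} [MeasurableSpace Ω] (P : Measure Ω)
    (Z : Ω → Set ℝ) (rate : ℝ≥0) : Prop where
  measurable_count : ∀ B : Set ℝ, MeasurableSet B → Measurable fun ω => (Z ω ∩ B).encard
  map_count : ∀ B : Set ℝ, MeasurableSet B → volume B < ⊤ →
    P.map (fun ω => (Z ω ∩ B).encard) =
      (poissonMeasure (rate * (volume B).toNNReal)).map (fun k : ℕ => (k : ℕ∞))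
  indep_count : ∀ (n : ℕ) (B : Fin n → Set ℝ), (∀ i, MeasurableSet (B i)) →
    (Pairwise fun i j => Disjoint (B i) (B j)) →
    iIndepFun (fun i ω => (Z ω ∩ B i).encard) P

/-- The configuration `X` on the line, seen in the window `[-αν, (1-α)ν]` of length `ν` which is
mapped affinely onto `[0,1]`: the point `x` of `X` becomes `z = α + x / ν`. -/
def rescale (X : Set ℝ) (α ν : ℝ) : Set ℝ := {z | ν * (z - α) ∈ X}

/-- Rescaling a Poisson process of intensity one gives a Poisson process of intensity `ν`. -/
theorem IsPoissonProcess.rescale {Ω : Type*} [MeasurableSpace Ω] {P : Measure Ω}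
    {Z : Ω → Set ℝ} (h : IsPoissonProcess P Z 1) (α : ℝ) {ν : ℝ≥0} (hν : 0 < ν) :
    IsPoissonProcess P (fun ω => DisorderedGP.rescale (Z ω) α ν) ν := by
  have hν' : (ν : ℝ) ≠ 0 := by exact_mod_cast hν.ne'
  have hmeas : ∀ B : Set ℝ, MeasurableSet B →
      MeasurableSet ((fun x : ℝ => α + (ν : ℝ)⁻¹ * x) ⁻¹' B) := fun B hB =>
    (measurable_const.add (measurable_const.mul measurable_id)) hB
  have hvol : ∀ B : Set ℝ,
      volume ((fun x : ℝ => α + (ν : ℝ)⁻¹ * x) ⁻¹' B) = ν * volume B := by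
    intro B
    have e : (fun x : ℝ => α + (ν : ℝ)⁻¹ * x) ⁻¹' B =
        (fun x : ℝ => (ν : ℝ)⁻¹ * x) ⁻¹' ((fun y : ℝ => α + y) ⁻¹' B) := rfl
    rw [e, Real.volume_preimage_mul_left (inv_ne_zero hν'), measure_preimage_add]
    simp
  have hcount : ∀ (ω : Ω) (B : Set ℝ), (DisorderedGP.rescale (Z ω) α ν ∩ B).encard =
      (Z ω ∩ (fun x : ℝ => α + (ν : ℝ)⁻¹ * x) ⁻¹' B).encard := by
    intro ω B
    have hinj : Function.Injective (fun z : ℝ => (ν : ℝ) * (z - α)) := by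
      intro a b hab
      simpa [hν'] using hab
    rw [← hinj.encard_image]
    congr 1
    ext x
    constructor
    · rintro ⟨z, ⟨hz, hzB⟩, rfl⟩
      refine ⟨hz, ?_⟩
      have : α + (ν : ℝ)⁻¹ * ((ν : ℝ) * (z - α)) = z := by field_simp; ring
      simpa only [mem_preimage, this] using hzB
    · rintro ⟨hx, hxB⟩
      have : (ν : ℝ) * (α + (ν : ℝ)⁻¹ * x - α) = x := by field_simp; ring
      refine ⟨α + (ν : ℝ)⁻¹ * x, ⟨?_, hxB⟩, this⟩
      simpa only [DisorderedGP.rescale, mem_ofPred_eq, this] using hx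
  refine ⟨fun B hB => ?_, fun B hB hfin => ?_, fun n B hB hd => ?_⟩
  · simpa only [hcount] using h.measurable_count _ (hmeas B hB)
  · have := h.map_count _ (hmeas B hB) (by rw [hvol]; exact ENNReal.mul_lt_top (by simp) hfin)
    simpa only [hcount, hvol, ENNReal.toNNReal_mul, ENNReal.toNNReal_coe, one_mul] using this
  · simpa only [hcount] using h.indep_count n _ (fun i => hmeas _ (hB i))
      (fun i j hij => (hd hij).preimage _)

/-- `ψ` belongs to the Sobolev space `H¹₀(0,1)` and `g` is its weak derivative. (In one dimension,
these are the functions which are absolutely continuous on `[0,1]`, vanish at `0` and `1`,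
and have a square integrable derivative.) -/
structure IsH10 (ψ g : ℝ → ℂ) : Prop where
  memLp : MemLp g 2 (volume.restrict (Icc 0 1))
  eq_integral : ∀ x ∈ Icc (0 : ℝ) 1, ψ x = ∫ t in (0 : ℝ)..x, g t
  right_eq_zero : ψ 1 = 0

/-- The Gross-Pitaevskii energy
`∫₀¹ |ψ'|² + σ ∑_{z ∈ S ∩ [0,1]} |ψ(z)|² + (γ/2) ∫₀¹ |ψ|⁴`
of a function `ψ` with derivative `g`, for point scatterers of strength `σ` located at the points
of `S`. Since `∞ * 0 = 0` and `∞ * a = ∞` for `a > 0`, in the case `σ = ∞` the energy is infinite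
unless `ψ` vanishes at all the scatterers, and the scatterers do not contribute if it does. -/
noncomputable def gpEnergy (S : Set ℝ) (σ : ℝ≥0∞) (γ : ℝ) (ψ g : ℝ → ℂ) : ℝ≥0∞ :=
  (∫⁻ x in Icc (0 : ℝ) 1, ‖g x‖ₑ ^ 2) + σ * (∑' z : ↥(S ∩ Icc (0 : ℝ) 1), ‖ψ z‖ₑ ^ 2) +
    ENNReal.ofReal (γ / 2) * ∫⁻ x in Icc (0 : ℝ) 1, ‖ψ x‖ₑ ^ 4

/-- The Gross-Pitaevskii ground state energy: the infimum of the energy over all `ψ ∈ H¹₀(0,1)`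
with `∫₀¹ |ψ|² = 1`. -/
noncomputable def groundEnergy (S : Set ℝ) (σ : ℝ≥0∞) (γ : ℝ) : ℝ≥0∞ :=
  ⨅ (ψ : ℝ → ℂ) (g : ℝ → ℂ) (_ : IsH10 ψ g)
    (_ : ∫⁻ x in Icc (0 : ℝ) 1, ‖ψ x‖ₑ ^ 2 = 1), gpEnergy S σ γ ψ g

/-- The random ground state energy `e_ω(γ,σ,ν)`, where `Z` is a Poisson process of intensity one
on the line, so that `rescale (Z ω) α ν` is one of intensity `ν`. -/
noncomputable def randomEnergy {Ω : Type*} (Z : Ω → Set ℝ) (α : ℝ) (γ : ℝ) (σ : ℝ≥0∞) (ν : ℝ)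
    (ω : Ω) : ℝ≥0∞ :=
  groundEnergy (rescale (Z ω) α ν) σ γ

/-- The deterministic energy `e₀(γ,ν)`: the expectation of `e_ω(γ,∞,ν)`. -/
noncomputable def averagedEnergy {Ω : Type*} [MeasurableSpace Ω] (P : Measure Ω)
    (Z : Ω → Set ℝ) (α : ℝ) (γ ν : ℝ) : ℝ≥0∞ :=
  ∫⁻ ω, randomEnergy Z α γ ⊤ ν ω ∂P

end DisorderedGP

open MeasureTheory ProbabilityTheory Filter Topology Set Asymptotics
open scoped NNReal ENNReal

namespace DisorderedGP

/-! The energy is self-averaging because it depends on the configuration essentially through the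
statistics of its long gaps, and these statistics are nearly deterministic. The core is a
comparison: if `X` and `X'` are both typical at scale `ν`, the hard-obstacle energy of `X'` is at
most `(1 - δ)⁻⁵` times the soft-obstacle energy of `X` (`IsTypical.groundEnergy_le`). No minimiser
or asymptotic formula for the energy is needed.

Deterministic half. The relevant length is `l / ν` with `l = 1 + log (1 + ν² / γ)`. For a trial
function `ψ` of the soft problem, `|ψ|` is lowered to zero at the ends of each gap of `X` by tents
of width `w`, a small multiple of `l / ν`. By Young's inequality this costs a factor `1 + δ` on the
kinetic energy plus a multiple of `w⁻¹ ∑ |ψ(z_j)|²`, which the obstacle energy pays for once `σ` is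
large compared with `ν / l`. Little mass lies within `w` of the gap ends, so gaps shorter than `2w`
can be dropped. The remaining pieces are contracted slightly and placed in distinct gaps of `X'`
(`groundEnergy_le_transplant`, `IsGapFamily.groundEnergy_le`). Hall's theorem provides the places as
soon as, for every length, `X` has no more gaps of that length than `X'` has gaps of a slightly
smaller length (`groundEnergy_rescale_le`).

Probabilistic half. Gaps are discretised into runs of empty cells of size `h`. A run of `n` empty
cells has probability `(1 - exp (-h)) exp (-n h)`, and distinct starting positions are not
positively correlated, so the variance of the number of runs is at most its mean. Shortening a run
by `n / n₀` cells multiplies the mean by `exp (h (n / n₀))`, which dominates the fluctuations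
bounded by Chebyshev's and Markov's inequalities. The failure probability is a negative power of the
scale. Borel-Cantelli along a geometric sequence of scales gives typicality almost surely, and
windows with some slack serve all intermediate `ν` (`ae_eventually_isTypical`).

Averaging. A fixed typical configuration is compared with all typical `ω'`. The atypical ones
contribute little to the expectation: a pigeonhole bound controls every energy by the squared number
of obstacles plus `γ` (`groundEnergy_le_card`), while a typical energy is at least of order `(ν /
log ν)²` and at least `γ / 2`. This gives `ae_randomEnergy_close` for each `δ`, and `δ` then runs
through a sequence tending to zero. -/

/-! ### Dominated increments: a substitute for derivatives that is stable under cutting, moving and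
gluing -/

/-- The increments of `f` are dominated by the integrals of `H`. -/
def DomBy {E : Type*} [NormedAddCommGroup E] (f : ℝ → E) (H : ℝ → ℝ≥0∞) : Prop :=
  ∀ s t, s ≤ t → ‖f t - f s‖ₑ ≤ ∫⁻ x in Ioc s t, H x

/-- Young's inequality, from `(e a - b)² ≥ 0`. A small `e` keeps the factor of the true kinetic
energy near one and puts the large factor on the cut-off term. -/
theorem ennreal_add_sq_le_eps (a b : ℝ≥0∞) {e : ℝ≥0} (he : e ≠ 0) :
    (a + b) ^ 2 ≤ (1 + e) * a ^ 2 + (1 + (e : ℝ≥0∞)⁻¹) * b ^ 2 := by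
  rcases eq_or_ne a ⊤ with rfl | ha
  · have : (1 + (e : ℝ≥0∞)) * ⊤ ^ 2 = ⊤ := by simp [ENNReal.mul_top]
    rw [this]; simp
  rcases eq_or_ne b ⊤ with rfl | hb
  · have : (1 + (e : ℝ≥0∞)⁻¹) * ⊤ ^ 2 = ⊤ := by simp [ENNReal.mul_top]
    rw [this]; simp
  lift a to ℝ≥0 using ha
  lift b to ℝ≥0 using hb
  rw [← ENNReal.coe_inv he]
  norm_cast
  rw [← NNReal.coe_le_coe]
  push_cast
  have he' : (0 : ℝ) < e := by positivity
  have : 0 ≤ (e : ℝ)⁻¹ * (e * a - b) ^ 2 := by positivity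
  have h2 : (e : ℝ)⁻¹ * (e * a - b) ^ 2 = e * a ^ 2 - 2 * a * b + (e : ℝ)⁻¹ * b ^ 2 := by
    field_simp; ring
  nlinarith

theorem ennreal_add_sq_le (a b : ℝ≥0∞) : (a + b) ^ 2 ≤ 2 * a ^ 2 + 2 * b ^ 2 := by
  have := ennreal_add_sq_le_eps a b (e := 1) one_ne_zero
  simpa [one_add_one_eq_two] using this

theorem lintegral_mul_sq_le {μ : Measure ℝ} {f g : ℝ → ℝ≥0∞} (hf : AEMeasurable f μ)
    (hg : AEMeasurable g μ) :
    (∫⁻ x, f x * g x ∂μ) ^ 2 ≤ (∫⁻ x, f x ^ 2 ∂μ) * ∫⁻ x, g x ^ 2 ∂μ := by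
  have h := ENNReal.lintegral_mul_le_Lp_mul_Lq μ Real.HolderConjugate.two_two hf hg
  simp only [Pi.mul_apply, ENNReal.rpow_ofNat] at h
  calc _ ≤ ((∫⁻ x, f x ^ 2 ∂μ) ^ ((1 : ℝ) / 2) * (∫⁻ x, g x ^ 2 ∂μ) ^ ((1 : ℝ) / 2)) ^ 2 := by
        gcongr
    _ = _ := by
        rw [mul_pow, ← ENNReal.rpow_natCast, ← ENNReal.rpow_natCast, ← ENNReal.rpow_mul,
          ← ENNReal.rpow_mul]
        norm_num

theorem setLIntegral_sq_le {s : Set ℝ} {f : ℝ → ℝ≥0∞}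
    (hf : AEMeasurable f (volume.restrict s)) :
    (∫⁻ x in s, f x) ^ 2 ≤ volume s * ∫⁻ x in s, f x ^ 2 := by
  have := lintegral_mul_sq_le (aemeasurable_const (b := (1 : ℝ≥0∞)) (μ := volume.restrict s)) hf
  simpa using this

theorem lintegral_comp_affine (f : ℝ → ℝ≥0∞) {c : ℝ} (hc : 0 < c) (d : ℝ) :
    ∫⁻ t, f (c * t + d) = (ENNReal.ofReal c)⁻¹ * ∫⁻ t, f t := by
  have h1 : ∫⁻ t, f (c * t + d) = ∫⁻ t, f (t + d) ∂(Measure.map (c * ·) volume) := by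
    exact ((Homeomorph.mulLeft₀ c hc.ne').measurableEmbedding.lintegral_map
      (μ := volume) (fun t => f (t + d))).symm
  rw [h1, Real.map_volume_mul_left hc.ne', lintegral_smul_measure, lintegral_add_right_eq_self,
    abs_of_pos (inv_pos.2 hc), ENNReal.ofReal_inv_of_pos hc, smul_eq_mul]

theorem setLIntegral_comp_affine (f : ℝ → ℝ≥0∞) {c : ℝ} (hc : 0 < c) (d s t : ℝ) :
    ∫⁻ x in Ioc s t, f (c * x + d) =
      (ENNReal.ofReal c)⁻¹ * ∫⁻ x in Ioc (c * s + d) (c * t + d), f x := by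
  rw [← lintegral_indicator measurableSet_Ioc, ← lintegral_indicator measurableSet_Ioc,
    ← lintegral_comp_affine _ hc d]
  congr 1
  ext x
  simp [indicator, hc]

theorem DomBy.comp_affine {E : Type*} [NormedAddCommGroup E] {f : ℝ → E} {H : ℝ → ℝ≥0∞}
    (hf : DomBy f H) {c : ℝ} (hc : 0 < c) (d : ℝ) :
    DomBy (fun t => f (c * t + d)) (fun t => ENNReal.ofReal c * H (c * t + d)) := by
  intro s t hst
  refine (hf (c * s + d) (c * t + d) (by nlinarith)).trans (le_of_eq ?_)
  rw [lintegral_const_mul' _ _ ENNReal.ofReal_ne_top, setLIntegral_comp_affine _ hc, ← mul_assoc,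
    ENNReal.mul_inv_cancel (by simpa) ENNReal.ofReal_ne_top, one_mul]

theorem DomBy.mono {E : Type*} [NormedAddCommGroup E] {f : ℝ → E} {H H' : ℝ → ℝ≥0∞}
    (hf : DomBy f H) (h : ∀ x, H x ≤ H' x) : DomBy f H' := fun s t hst =>
  (hf s t hst).trans (lintegral_mono h)

theorem DomBy.sum {E ι : Type*} [NormedAddCommGroup E] (u : Finset ι) {f : ι → ℝ → E}
    {H : ι → ℝ → ℝ≥0∞} (hf : ∀ i ∈ u, DomBy (f i) (H i)) (hH : ∀ i ∈ u, AEMeasurable (H i)) :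
    DomBy (fun t => ∑ i ∈ u, f i t) (fun t => ∑ i ∈ u, H i t) := by
  intro s t hst
  rw [lintegral_finsetSum' _ (fun i hi => (hH i hi).restrict), ← Finset.sum_sub_distrib]
  exact (enorm_sum_le _ _).trans (Finset.sum_le_sum fun i hi => hf i hi s t hst)

theorem DomBy.const_smul {f : ℝ → ℝ} {H : ℝ → ℝ≥0∞} (hf : DomBy f H) (c : ℝ) :
    DomBy (fun t => c * f t) (fun t => ‖c‖ₑ * H t) := by
  intro s t hst
  rw [lintegral_const_mul' _ _ enorm_ne_top, ← mul_sub, enorm_mul]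
  gcongr
  exact hf s t hst

/-- On `[0, 1]` square integrability makes `H` integrable, so it has an absolutely continuous
primitive. Since `f` oscillates no more than this primitive, it inherits continuity and absolute
continuity from it. -/
theorem DomBy.dist_le {E : Type*} [NormedAddCommGroup E] {f : ℝ → E} {H : ℝ → ℝ≥0∞}
    (hf : DomBy f H) (hH : AEMeasurable H) (hfin : ∫⁻ x in Icc (0 : ℝ) 1, H x ^ 2 ≠ ⊤) :
    IntervalIntegrable (fun x => (H x).toReal) volume 0 1 ∧
    ∀ a ∈ Icc (0 : ℝ) 1, ∀ b ∈ Icc (0 : ℝ) 1,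
      dist (f a) (f b) ≤ dist (∫ x in (0 : ℝ)..a, (H x).toReal) (∫ x in (0 : ℝ)..b, (H x).toReal)
    := by
  have h1 : ∫⁻ x in Icc (0 : ℝ) 1, H x ≠ ⊤ := by
    have := setLIntegral_sq_le (s := Icc (0 : ℝ) 1) hH.restrict
    intro h
    rw [h] at this
    simp at this
    exact hfin this
  have hint : IntegrableOn (fun x => (H x).toReal) (Icc 0 1) :=
    integrable_toReal_of_lintegral_ne_top hH.restrict h1
  have hii : ∀ a ∈ Icc (0 : ℝ) 1, ∀ b ∈ Icc (0 : ℝ) 1,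
      IntervalIntegrable (fun x => (H x).toReal) volume a b := by
    intro a ha b hb
    rw [intervalIntegrable_iff]
    refine hint.mono_set (uIoc_subset_uIcc.trans (uIcc_subset_Icc ha hb))
  have h0 : (0 : ℝ) ∈ Icc (0 : ℝ) 1 := by simp
  refine ⟨hii _ h0 _ (by simp), ?_⟩
  have key : ∀ a ∈ Icc (0 : ℝ) 1, ∀ b ∈ Icc (0 : ℝ) 1, a ≤ b →
      dist (f a) (f b) ≤
        dist (∫ x in (0 : ℝ)..a, (H x).toReal) (∫ x in (0 : ℝ)..b, (H x).toReal) := by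
    intro a ha b hb hab
    have h2 := hf a b hab
    have hsub : Ioc a b ⊆ Icc (0 : ℝ) 1 :=
      fun x hx => ⟨ha.1.trans hx.1.le, hx.2.trans hb.2⟩
    have h3 : ∫⁻ x in Ioc a b, H x ≠ ⊤ :=
      ne_top_of_le_ne_top h1 (lintegral_mono_set hsub)
    rw [dist_comm, dist_comm (∫ x in (0 : ℝ)..a, (H x).toReal), Real.dist_eq,
      intervalIntegral.integral_interval_sub_left (hii _ h0 _ hb) (hii _ h0 _ ha),
      intervalIntegral.integral_of_le hab, integral_toReal hH.restrict
        (ae_lt_top' hH.restrict h3), dist_eq_norm, ← toReal_enorm]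
    exact (ENNReal.toReal_mono h3 h2).trans (le_abs_self _)
  intro a ha b hb
  rcases le_total a b with h | h
  · exact key a ha b hb h
  · rw [dist_comm, dist_comm (∫ x in (0 : ℝ)..a, (H x).toReal)]
    exact key b hb a ha h

/-- This is the return from dominated increments to `H¹₀`. Being absolutely continuous, `f` is the
integral of its derivative; comparing its difference quotients with those of the primitive of `H` at
almost every point gives the pointwise bound on the derivative. -/
theorem exists_isH10 {f : ℝ → ℝ} {H : ℝ → ℝ≥0∞} (hf : DomBy f H) (hH : AEMeasurable H)
    (hfin : ∫⁻ x in Icc (0 : ℝ) 1, H x ^ 2 ≠ ⊤) (h0 : f 0 = 0) (h1 : f 1 = 0) :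
    ∃ g : ℝ → ℂ, IsH10 (fun x => (f x : ℂ)) g ∧
      ∀ᵐ x ∂(volume.restrict (Icc (0 : ℝ) 1)), ‖g x‖ₑ ≤ H x := by
  obtain ⟨hint, hd⟩ := hf.dist_le hH hfin
  set G : ℝ → ℝ := fun a => ∫ x in (0 : ℝ)..a, (H x).toReal with hG
  have hGac : AbsolutelyContinuousOnInterval G 0 1 :=
    hint.absolutelyContinuousOnInterval_intervalIntegral (by simp)
  have hfac : AbsolutelyContinuousOnInterval f 0 1 := by
    rw [absolutelyContinuousOnInterval_iff] at hGac ⊢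
    intro ε hε
    obtain ⟨δ, hδ, h⟩ := hGac ε hε
    refine ⟨δ, hδ, fun E hE hE' => lt_of_le_of_lt (Finset.sum_le_sum fun i hi => ?_) (h E hE hE')⟩
    have := hE.1 i hi
    rw [uIcc_of_le zero_le_one] at this
    exact hd _ this.1 _ this.2
  have hbound : ∀ᵐ x ∂(volume.restrict (Icc (0 : ℝ) 1)), ‖((deriv f x : ℝ) : ℂ)‖ₑ ≤ H x := by
    have hne : ∀ᵐ x : ℝ, x ≠ 0 ∧ x ≠ 1 := by
      have a0 : ∀ᵐ x : ℝ, x ≠ 0 := by simp [ae_iff, measure_singleton]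
      have a1 : ∀ᵐ x : ℝ, x ≠ 1 := by simp [ae_iff, measure_singleton]
      filter_upwards [a0, a1] with x h h' using ⟨h, h'⟩
    have hHtop : ∀ᵐ x ∂(volume.restrict (Icc (0 : ℝ) 1)), H x ^ 2 < ⊤ :=
      ae_lt_top' (hH.restrict.pow_const 2) hfin
    rw [ae_restrict_iff' measurableSet_Icc] at hHtop ⊢
    filter_upwards [hfac.ae_differentiableAt, hint.ae_hasDerivAt_integral, hne, hHtop]
      with x hx1 hx2 hx3 hx4 hx
    rw [uIcc_of_le zero_le_one] at hx1 hx2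
    have d1 := (hx1 hx).hasDerivAt
    have d2 := hx2 hx 0 (by simp)
    have t1 := (hasDerivAt_iff_tendsto_slope.1 d1).norm
    have t2 := (hasDerivAt_iff_tendsto_slope.1 d2).norm
    have hle : ‖deriv f x‖ ≤ ‖(H x).toReal‖ := by
      refine le_of_tendsto_of_tendsto t1 t2 ?_
      have : Icc (0 : ℝ) 1 ∈ 𝓝 x := Icc_mem_nhds (lt_of_le_of_ne hx.1 (Ne.symm hx3.1))
        (lt_of_le_of_ne hx.2 hx3.2)
      filter_upwards [mem_nhdsWithin_of_mem_nhds this] with y hy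
      simp only [slope, norm_smul, vsub_eq_sub]
      gcongr
      rw [← dist_eq_norm, ← dist_eq_norm]
      exact hd _ hy _ hx
    have hHx : H x ≠ ⊤ := by
      rintro h
      have := hx4 hx
      simp [h] at this
    rw [← ofReal_norm, Complex.norm_real]
    refine (ENNReal.ofReal_le_ofReal hle).trans ?_
    rw [Real.norm_of_nonneg ENNReal.toReal_nonneg, ENNReal.ofReal_toReal hHx]
  refine ⟨fun x => (deriv f x : ℝ), ⟨?_, ?_, by simp [h1]⟩, hbound⟩
  · refine ⟨(Complex.measurable_ofReal.comp (measurable_deriv f)).aestronglyMeasurable, ?_⟩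
    rw [eLpNorm_lt_top_iff_lintegral_rpow_enorm_lt_top (by simp) (by simp)]
    simp only [ENNReal.toReal_ofNat, ENNReal.rpow_ofNat]
    refine lt_of_le_of_lt (lintegral_mono_ae ?_) hfin.lt_top
    filter_upwards [hbound] with x hx
    gcongr
  · intro x hx
    have := (hfac.mono (c := 0) (d := x) (by
      rw [uIcc_of_le zero_le_one, uIcc_of_le hx.1]
      exact Icc_subset_Icc_right hx.2)).integral_deriv_eq_sub
    rw [h0, sub_zero] at this
    rw [intervalIntegral.integral_ofReal, this]

theorem DomBy.continuousOn {f : ℝ → ℝ} {H : ℝ → ℝ≥0∞} (hf : DomBy f H) (hH : AEMeasurable H)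
    (hfin : ∫⁻ x in Icc (0 : ℝ) 1, H x ^ 2 ≠ ⊤) : ContinuousOn f (Icc 0 1) := by
  obtain ⟨hint, hd⟩ := hf.dist_le hH hfin
  have hc : ContinuousOn (fun a => ∫ x in (0 : ℝ)..a, (H x).toReal) (Icc 0 1) := by
    have := intervalIntegral.continuousOn_primitive_interval (a := (0 : ℝ)) (b := 1)
      (μ := volume) (f := fun x => (H x).toReal)
      (by rw [intervalIntegrable_iff_integrableOn_Icc_of_le zero_le_one] at hint
          rwa [uIcc_of_le zero_le_one])
    rwa [uIcc_of_le zero_le_one] at this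
  rw [Metric.continuousOn_iff] at hc ⊢
  intro b hb ε hε
  obtain ⟨δ, hδ, h⟩ := hc b hb ε hε
  exact ⟨δ, hδ, fun a ha hab => (hd a ha b hb).trans_lt (h a ha hab)⟩

/-- A dominated function, suitably normalised, is a trial function for the energy with
hard obstacles. -/
theorem groundEnergy_le_of_domBy {S : Set ℝ} {γ : ℝ} {f : ℝ → ℝ} {H : ℝ → ℝ≥0∞}
    (hf : DomBy f H) (hH : AEMeasurable H) (h0 : f 0 = 0) (h1 : f 1 = 0)
    (hS : ∀ z ∈ S ∩ Icc 0 1, f z = 0) {m : ℝ≥0∞} (hm0 : m ≠ 0) (hmt : m ≠ ⊤)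
    (hm : m ≤ ∫⁻ x in Icc (0 : ℝ) 1, ‖f x‖ₑ ^ 2) :
    groundEnergy S ⊤ γ ≤ (∫⁻ x in Icc (0 : ℝ) 1, H x ^ 2) / m +
      ENNReal.ofReal (γ / 2) * ((∫⁻ x in Icc (0 : ℝ) 1, ‖f x‖ₑ ^ 4) / m ^ 2) := by
  by_cases hfin : ∫⁻ x in Icc (0 : ℝ) 1, H x ^ 2 = ⊤
  · rw [hfin, ENNReal.top_div_of_ne_top hmt]; simp
  set M := ∫⁻ x in Icc (0 : ℝ) 1, ‖f x‖ₑ ^ 2 with hM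
  have hcont := hf.continuousOn hH hfin
  have hMt : M ≠ ⊤ := by
    obtain ⟨C, hC⟩ := isCompact_Icc.exists_bound_of_continuousOn hcont
    refine ne_top_of_le_ne_top ?_ (setLIntegral_mono measurable_const
      (g := fun _ => (ENNReal.ofReal C) ^ 2) fun x hx => ?_)
    · simp
    · rw [← ofReal_norm]
      gcongr
      exact hC x hx
  have hM0 : M ≠ 0 := fun h => hm0 (le_antisymm (h ▸ hm) bot_le)
  -- The exact mass `M` normalises the function; the lower bound `m` replaces it only in the final
  -- estimate.
  set c : ℝ := (Real.sqrt M.toReal)⁻¹ with hc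
  have hMpos : 0 < M.toReal := ENNReal.toReal_pos hM0 hMt
  have hc2 : ‖c‖ₑ ^ 2 = M⁻¹ := by
    rw [← enorm_pow, hc, inv_pow, Real.sq_sqrt hMpos.le, Real.enorm_eq_ofReal (by positivity),
      ENNReal.ofReal_inv_of_pos hMpos, ENNReal.ofReal_toReal hMt]
  have hcf := hf.const_smul c
  have hKeq : ∫⁻ x in Icc (0 : ℝ) 1, (‖c‖ₑ * H x) ^ 2 =
      (∫⁻ x in Icc (0 : ℝ) 1, H x ^ 2) / M := by
    simp_rw [mul_pow]
    rw [lintegral_const_mul' _ _ (by simp), hc2, ENNReal.div_eq_inv_mul]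
  obtain ⟨g, hg, hgH⟩ := exists_isH10 hcf (hH.const_mul _) (by
    rw [hKeq]; exact ENNReal.div_ne_top hfin hM0) (by simp [h0]) (by simp [h1])
  have hnorm : ∀ x, ‖((c * f x : ℝ) : ℂ)‖ₑ = ‖c‖ₑ * ‖f x‖ₑ := by
    intro x
    rw [← enorm_mul, ← ofReal_norm, Complex.norm_real, ofReal_norm]
  unfold groundEnergy
  refine (iInf_le _ fun x => ((c * f x : ℝ) : ℂ)).trans ((iInf_le _ g).trans
    ((iInf_le _ hg).trans ((iInf_le _ ?_).trans ?_)))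
  · simp_rw [hnorm, mul_pow]
    rw [lintegral_const_mul' _ _ (by simp), hc2, ← hM, ENNReal.inv_mul_cancel hM0 hMt]
  · unfold gpEnergy
    have hsum : ∑' z : ↥(S ∩ Icc (0 : ℝ) 1), ‖((c * f z : ℝ) : ℂ)‖ₑ ^ 2 = 0 := by
      rw [ENNReal.tsum_eq_zero]
      intro z
      rw [hS z z.2]
      simp
    rw [hsum, mul_zero, add_zero]
    gcongr ?_ + ENNReal.ofReal (γ / 2) * ?_
    · calc ∫⁻ x in Icc (0 : ℝ) 1, ‖g x‖ₑ ^ 2 ≤ ∫⁻ x in Icc (0 : ℝ) 1, (‖c‖ₑ * H x) ^ 2 := by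
            refine lintegral_mono_ae ?_
            filter_upwards [hgH] with x hx
            gcongr
        _ ≤ _ := by rw [hKeq]; gcongr
    · simp_rw [hnorm, mul_pow]
      rw [lintegral_const_mul' _ _ (by simp), show ‖c‖ₑ ^ 4 = (‖c‖ₑ ^ 2) ^ 2 by ring, hc2,
        ← ENNReal.inv_pow, ← ENNReal.div_eq_inv_mul]
      gcongr

/-- An element of `H¹₀`, extended by zero, has dominated increments. -/
theorem IsH10.domBy {ψ g : ℝ → ℂ} (h : IsH10 ψ g) :
    DomBy ((Icc (0 : ℝ) 1).indicator ψ) ((Icc (0 : ℝ) 1).indicator fun x => ‖g x‖ₑ) := by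
  have hz : ψ 0 = 0 := by simpa using h.eq_integral 0 (by simp)
  -- Because `ψ` vanishes at both ends, extending it by zero is the same as composing it with the
  -- clamp onto `[0, 1]`.
  set p : ℝ → ℝ := fun t => max 0 (min t 1) with hp
  have hpm : ∀ t, p t ∈ Icc (0 : ℝ) 1 := fun t => ⟨le_max_left _ _, by simp [p]⟩
  have hψ : ∀ t, (Icc (0 : ℝ) 1).indicator ψ t = ψ (p t) := by
    intro t
    by_cases ht : t ∈ Icc (0 : ℝ) 1
    · rw [indicator_of_mem ht]
      congr 1
      simp only [p, min_eq_left ht.2, max_eq_right ht.1]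
    · rw [indicator_of_notMem ht]
      rcases lt_or_ge t 0 with h0 | h0
      · rw [show p t = 0 by simp only [p]; rw [max_eq_left]; exact (min_le_left _ _).trans h0.le, hz]
      · have : 1 < t := by
          by_contra h2
          exact ht ⟨h0, not_lt.1 h2⟩
        rw [show p t = 1 by simp [p, min_eq_right this.le], h.right_eq_zero]
  have hgi : IntegrableOn g (Icc 0 1) := h.memLp.integrable (by norm_num)
  intro s t hst
  have hpst : p s ≤ p t := by simp only [p]; gcongr
  have hii : ∀ a ∈ Icc (0 : ℝ) 1, IntervalIntegrable g volume 0 a := by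
    intro a ha
    rw [intervalIntegrable_iff]
    exact hgi.mono_set (uIoc_subset_uIcc.trans (uIcc_subset_Icc (by simp) ha))
  rw [hψ, hψ, h.eq_integral _ (hpm t), h.eq_integral _ (hpm s),
    intervalIntegral.integral_interval_sub_left (hii _ (hpm t)) (hii _ (hpm s)),
    intervalIntegral.integral_of_le hpst]
  refine (enorm_integral_le_lintegral_enorm _).trans ?_
  rw [← lintegral_indicator measurableSet_Ioc, ← lintegral_indicator measurableSet_Ioc]
  refine lintegral_mono fun x => ?_
  by_cases hx : x ∈ Ioc (p s) (p t)
  · have hx1 : x ∈ Icc (0 : ℝ) 1 := ⟨(hpm s).1.trans hx.1.le, hx.2.trans (hpm t).2⟩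
    have hx2 : x ∈ Ioc s t := by
      constructor
      · by_contra hc
        push Not at hc
        have : x ≤ p s := by simp only [p]; rw [min_def]; split_ifs <;> simp [hc, hx1.2]
        exact absurd hx.1 (not_lt.2 this)
      · by_contra hc
        push Not at hc
        have : p t < x := by
          have h1 : 0 < x := (hpm s).1.trans_lt hx.1
          simp only [p]
          exact max_lt h1 ((min_le_left _ _).trans_lt hc)
        exact absurd hx.2 (not_le.2 this)
    rw [indicator_of_mem hx, indicator_of_mem hx2, indicator_of_mem hx1]
  · rw [indicator_of_notMem hx]; exact bot_le

/-! ### Tent trial functions and crude upper bounds -/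

/-- At most one term is nonzero. Applied pointwise to pieces with disjoint supports, it lets squares
and fourth powers pass through the sum without cross terms. -/
theorem map_sum_of_disjoint {ι M N : Type*} [AddCommMonoid M] [AddCommMonoid N] (u : Finset ι)
    (f : ι → M) (φ : M → N) (hφ : φ 0 = 0)
    (h : ∀ i ∈ u, ∀ j ∈ u, i ≠ j → f i = 0 ∨ f j = 0) :
    φ (∑ i ∈ u, f i) = ∑ i ∈ u, φ (f i) := by
  by_cases hz : ∀ i ∈ u, f i = 0
  · rw [Finset.sum_eq_zero hz, hφ, Finset.sum_eq_zero]
    intro i hi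
    rw [hz i hi, hφ]
  · push Not at hz
    obtain ⟨i, hi, hfi⟩ := hz
    have h0 : ∀ j ∈ u, j ≠ i → f j = 0 := fun j hj hji => (h j hj i hi hji).resolve_right hfi
    rw [Finset.sum_eq_single_of_mem i hi h0,
      Finset.sum_eq_single_of_mem i hi fun j hj hji => by rw [h0 j hj hji, hφ]]

theorem domBy_clamp {a b : ℝ} (hab : a ≤ b) :
    DomBy (fun t : ℝ => max a (min t b)) ((Ioo a b).indicator fun _ => 1) := by
  intro s t hst
  set p : ℝ → ℝ := fun t => max a (min t b) with hp
  have hpst : p s ≤ p t := by simp only [p]; gcongr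
  have hsub : Ioo (p s) (p t) ⊆ Ioo a b ∩ Ioc s t := by
    intro x hx
    have h1 : a < x := (le_max_left a (min s b)).trans_lt hx.1
    have h2 : x < b := hx.2.trans_le (max_le hab (min_le_right _ _))
    refine ⟨⟨h1, h2⟩, ?_, ?_⟩
    · by_contra hc
      push Not at hc
      have : x ≤ p s := le_max_of_le_right (le_min hc h2.le)
      exact absurd hx.1 (not_lt.2 this)
    · by_contra hc
      push Not at hc
      have : p t ≤ x := max_le h1.le ((min_le_left _ _).trans hc.le)
      exact absurd hx.2 (not_lt.2 this)
  rw [lintegral_indicator measurableSet_Ioo, setLIntegral_const, one_mul,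
    Measure.restrict_apply measurableSet_Ioo]
  refine le_trans ?_ (measure_mono hsub)
  rw [Real.volume_Ioo, Real.enorm_eq_ofReal (sub_nonneg.2 hpst)]

theorem DomBy.lipschitz {E F : Type*} [NormedAddCommGroup E] [NormedAddCommGroup F] {f : ℝ → E}
    {H : ℝ → ℝ≥0∞} (hf : DomBy f H) {K : ℝ≥0} {φ : E → F} (hφ : LipschitzWith K φ) :
    DomBy (fun t => φ (f t)) (fun t => K * H t) := by
  intro s t hst
  rw [lintegral_const_mul' _ _ ENNReal.coe_ne_top, ← edist_eq_enorm_sub]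
  refine (hφ _ _).trans ?_
  rw [edist_eq_enorm_sub]
  gcongr
  exact hf s t hst

/-- The tent of height one and half-width `r` around `c`. -/
noncomputable def tent (c r : ℝ) (t : ℝ) : ℝ := max 0 (1 - |t - c| / r)

theorem tent_nonneg (c r t : ℝ) : 0 ≤ tent c r t := le_max_left _ _

theorem tent_self (c r : ℝ) : tent c r c = 1 := by simp [tent]

theorem tent_le_one {c r : ℝ} (hr : 0 < r) (t : ℝ) : tent c r t ≤ 1 :=
  max_le zero_le_one (by have : 0 ≤ |t - c| / r := by positivity
                         linarith)

theorem tent_eq_zero {c r : ℝ} (hr : 0 < r) {t : ℝ} (h : r ≤ |t - c|) : tent c r t = 0 :=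
  max_eq_left (by have : 1 ≤ |t - c| / r := by rwa [one_le_div hr]
                  linarith)

theorem tent_eq_zero_of_notMem {c r : ℝ} (hr : 0 < r) {t : ℝ} (h : t ∉ Ioo (c - r) (c + r)) :
    tent c r t = 0 := by
  apply tent_eq_zero hr
  by_contra hc
  push Not at hc
  rw [abs_lt] at hc
  exact h ⟨by linarith, by linarith⟩

theorem half_le_tent {c r : ℝ} (hr : 0 < r) {t : ℝ} (h : |t - c| ≤ r / 2) :
    1 / 2 ≤ tent c r t :=
  le_max_of_le_right (by have : |t - c| / r ≤ 1 / 2 := by rw [div_le_iff₀ hr]; linarith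
                         linarith)

theorem domBy_tent {c r : ℝ} (hr : 0 < r) :
    DomBy (tent c r) ((Ioo (c - r) (c + r)).indicator fun _ => (ENNReal.ofReal r)⁻¹) := by
  have hl : LipschitzWith (Real.toNNReal r)⁻¹ (fun u : ℝ => 1 - |u - c| / r) := by
    refine LipschitzWith.of_dist_le_mul fun x y => ?_
    rw [Real.dist_eq, Real.dist_eq, NNReal.coe_inv, Real.coe_toNNReal _ hr.le]
    have e : (1 - |x - c| / r) - (1 - |y - c| / r) = r⁻¹ * (|y - c| - |x - c|) := by
      field_simp; ring
    rw [e, abs_mul, abs_of_pos (inv_pos.2 hr)]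
    refine mul_le_mul_of_nonneg_left ?_ (inv_pos.2 hr).le
    refine (abs_abs_sub_abs_le (y - c) (x - c)).trans ?_
    rw [sub_sub_sub_cancel_right, abs_sub_comm]
  have h := (domBy_clamp (a := c - r) (b := c + r) (by linarith)).lipschitz hl
  have e1 : (fun t => 1 - |max (c - r) (min t (c + r)) - c| / r) = tent c r := by
    ext t
    by_cases ht : t ∈ Ioo (c - r) (c + r)
    · rw [min_eq_left ht.2.le, max_eq_right ht.1.le, tent, max_eq_right]
      have : |t - c| / r ≤ 1 := by
        rw [div_le_one hr, abs_le]
        exact ⟨by linarith [ht.1], by linarith [ht.2]⟩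
      linarith
    · rw [tent_eq_zero_of_notMem hr ht]
      have hne := hr.ne'
      rcases le_or_gt t (c - r) with h1 | h1
      · rw [max_eq_left ((min_le_left _ _).trans h1)]
        simp [abs_of_pos hr, hne]
      · have h2 : c + r ≤ t := by
          by_contra hc
          exact ht ⟨h1, not_le.1 hc⟩
        rw [min_eq_right h2, max_eq_right (by linarith)]
        simp [abs_of_pos hr, hne]
  rw [e1] at h
  refine h.mono fun x => le_of_eq ?_
  rw [ENNReal.coe_inv (by simpa using hr)]
  by_cases hx : x ∈ Ioo (c - r) (c + r)
  · rw [indicator_of_mem hx, indicator_of_mem hx, mul_one]; rfl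
  · rw [indicator_of_notMem hx, indicator_of_notMem hx, mul_zero]

/-- The trial function is a sum of unit tents. With `M` tents its mass is at least `M r / 4`, its
kinetic energy at most `2 M / r` and its quartic integral at most `2 M r`. The kinetic quotient is
therefore independent of `M`, whereas the interaction decreases when the mass is spread over many
tents. -/
theorem groundEnergy_le_tents {ι : Type*} {S : Set ℝ} {γ r : ℝ} (hr : 0 < r) (u : Finset ι)
    (hu : u.Nonempty) (c : ι → ℝ) (hc0 : ∀ i ∈ u, 0 ≤ c i - r) (hc1 : ∀ i ∈ u, c i + r ≤ 1)
    (hdisj : ∀ i ∈ u, ∀ j ∈ u, i ≠ j →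
      Disjoint (Ioo (c i - r) (c i + r)) (Ioo (c j - r) (c j + r)))
    (hS : ∀ i ∈ u, Disjoint S (Ioo (c i - r) (c i + r))) :
    groundEnergy S ⊤ γ ≤ ENNReal.ofReal (8 / r ^ 2) +
      ENNReal.ofReal (γ / 2) * ENNReal.ofReal (32 / (u.card * r)) := by
  set I : ι → Set ℝ := fun i => Ioo (c i - r) (c i + r) with hI
  have hmI : ∀ i, MeasurableSet (I i) := fun i => measurableSet_Ioo
  set f : ι → ℝ → ℝ := fun i => tent (c i) r with hf
  set H : ι → ℝ → ℝ≥0∞ := fun i => (I i).indicator fun _ => (ENNReal.ofReal r)⁻¹ with hH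
  have hHm : ∀ i ∈ u, AEMeasurable (H i) := fun i _ =>
    (measurable_const.indicator (hmI i)).aemeasurable
  have hdom := DomBy.sum u (f := f) (H := H) (fun i _ => domBy_tent hr) hHm
  have hHtot : AEMeasurable fun t => ∑ i ∈ u, H i t :=
    Finset.aemeasurable_fun_sum u hHm
  have hzero : ∀ t, (∀ i ∈ u, t ∉ I i) → ∑ i ∈ u, f i t = 0 := fun t ht =>
    Finset.sum_eq_zero fun i hi => tent_eq_zero_of_notMem hr (ht i hi)
  have hd : ∀ t, ∀ i ∈ u, ∀ j ∈ u, i ≠ j → t ∉ I i ∨ t ∉ I j := by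
    intro t i hi j hj hij
    by_contra hc
    push Not at hc
    exact (disjoint_left.1 (hdisj i hi j hj hij)) hc.1 hc.2
  have hM : (0 : ℝ) < u.card := by exact_mod_cast hu.card_pos
  have key : ∀ k : ℕ, k ≠ 0 → ∀ t, ‖∑ i ∈ u, f i t‖ₑ ^ k = ∑ i ∈ u, ‖f i t‖ₑ ^ k := by
    intro k hk t
    refine map_sum_of_disjoint u (fun i => f i t) (fun a => ‖a‖ₑ ^ k) (by simp [hk]) ?_
    intro i hi j hj hij
    exact (hd t i hi j hj hij).imp (tent_eq_zero_of_notMem hr) (tent_eq_zero_of_notMem hr)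
  have hfm : ∀ i ∈ u, ∀ k : ℕ, Measurable fun t => ‖f i t‖ₑ ^ k := by
    intro i _ k
    have : Measurable (f i) := by
      simp only [f]
      unfold tent
      fun_prop
    exact this.enorm.pow_const k
  have hmass : ENNReal.ofReal (u.card * r / 4) ≤
      ∫⁻ x in Icc (0 : ℝ) 1, ‖∑ i ∈ u, f i x‖ₑ ^ 2 := by
    simp_rw [key 2 two_ne_zero]
    rw [lintegral_finsetSum _ fun i hi => hfm i hi 2]
    have : ∀ i ∈ u, ENNReal.ofReal (r / 4) ≤ ∫⁻ x in Icc (0 : ℝ) 1, ‖f i x‖ₑ ^ 2 := by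
      intro i hi
      calc ENNReal.ofReal (r / 4)
          = ∫⁻ x in Icc (c i - r / 2) (c i + r / 2), ENNReal.ofReal (1 / 4) := by
            rw [setLIntegral_const, Real.volume_Icc, ← ENNReal.ofReal_mul (by norm_num)]
            congr 1; ring
        _ ≤ ∫⁻ x in Icc (c i - r / 2) (c i + r / 2), ‖f i x‖ₑ ^ 2 := by
            refine setLIntegral_mono (hfm i hi 2) fun x hx => ?_
            have h1 : 1 / 2 ≤ f i x := half_le_tent hr (by
              rw [abs_le]; exact ⟨by linarith [hx.1], by linarith [hx.2]⟩)
            rw [← enorm_pow, Real.enorm_eq_ofReal (by positivity)]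
            apply ENNReal.ofReal_le_ofReal
            nlinarith
        _ ≤ _ := lintegral_mono_set (Icc_subset_Icc (by linarith [hc0 i hi])
            (by linarith [hc1 i hi]))
    refine le_trans (le_of_eq ?_) (Finset.sum_le_sum this)
    rw [Finset.sum_const, ← ENNReal.ofReal_nsmul, nsmul_eq_mul]
    congr 1; ring
  have hvol : ∀ i, volume (I i) = ENNReal.ofReal (2 * r) := by
    intro i
    rw [hI, Real.volume_Ioo]
    congr 1; ring
  have hkin : ∫⁻ x in Icc (0 : ℝ) 1, (∑ i ∈ u, H i x) ^ 2 ≤ ENNReal.ofReal (u.card * (2 / r)) := by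
    have e : ∀ x, (∑ i ∈ u, H i x) ^ 2 = ∑ i ∈ u, (H i x) ^ 2 := by
      intro x
      refine map_sum_of_disjoint u (fun i => H i x) (fun a => a ^ 2) (by simp) ?_
      intro i hi j hj hij
      exact (hd x i hi j hj hij).imp (fun h => indicator_of_notMem h _)
        (fun h => indicator_of_notMem h _)
    simp_rw [e]
    rw [lintegral_finsetSum _ fun i hi => (measurable_const.indicator (hmI i)).pow_const 2]
    have : ∀ i ∈ u, ∫⁻ x in Icc (0 : ℝ) 1, (H i x) ^ 2 ≤ ENNReal.ofReal (2 / r) := by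
      intro i hi
      calc ∫⁻ x in Icc (0 : ℝ) 1, (H i x) ^ 2 ≤ ∫⁻ x, (H i x) ^ 2 := setLIntegral_le_lintegral _ _
        _ = ∫⁻ x, (I i).indicator (fun _ => ENNReal.ofReal (r⁻¹ ^ 2)) x := by
            congr 1
            ext x
            by_cases hx : x ∈ I i
            · simp only [H, indicator_of_mem hx]
              rw [← ENNReal.ofReal_inv_of_pos hr, ENNReal.ofReal_pow (by positivity)]
            · simp [H, indicator_of_notMem hx]
        _ = ENNReal.ofReal (2 / r) := by
            rw [lintegral_indicator (hmI i), setLIntegral_const, hvol,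
              ← ENNReal.ofReal_mul (by positivity)]
            congr 1; field_simp
    refine (Finset.sum_le_sum this).trans (le_of_eq ?_)
    rw [Finset.sum_const, ← ENNReal.ofReal_nsmul, nsmul_eq_mul]
  have hquart : ∫⁻ x in Icc (0 : ℝ) 1, ‖∑ i ∈ u, f i x‖ₑ ^ 4 ≤
      ENNReal.ofReal (u.card * (2 * r)) := by
    simp_rw [key 4 four_ne_zero]
    rw [lintegral_finsetSum _ fun i hi => hfm i hi 4]
    have : ∀ i ∈ u, ∫⁻ x in Icc (0 : ℝ) 1, ‖f i x‖ₑ ^ 4 ≤ ENNReal.ofReal (2 * r) := by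
      intro i hi
      calc ∫⁻ x in Icc (0 : ℝ) 1, ‖f i x‖ₑ ^ 4 ≤ ∫⁻ x, ‖f i x‖ₑ ^ 4 :=
            setLIntegral_le_lintegral _ _
        _ ≤ ∫⁻ x, (I i).indicator (fun _ => 1) x := by
            refine lintegral_mono fun x => ?_
            by_cases hx : x ∈ I i
            · rw [indicator_of_mem hx]
              refine pow_le_one₀ (zero_le) ?_
              rw [Real.enorm_eq_ofReal (tent_nonneg _ _ _)]
              exact ENNReal.ofReal_le_one.2 (tent_le_one hr x)
            · simp [f, tent_eq_zero_of_notMem hr hx]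
        _ = ENNReal.ofReal (2 * r) := by
            rw [lintegral_indicator (hmI i), setLIntegral_const, hvol, one_mul]
    refine (Finset.sum_le_sum this).trans (le_of_eq ?_)
    rw [Finset.sum_const, ← ENNReal.ofReal_nsmul, nsmul_eq_mul]
  have hm0 : 0 < u.card * r / 4 := by positivity
  refine (groundEnergy_le_of_domBy hdom hHtot ?_ ?_ ?_ (m := ENNReal.ofReal (u.card * r / 4))
    (by simpa using hm0) ENNReal.ofReal_ne_top hmass).trans ?_
  · exact hzero _ fun i hi h => by linarith [hc0 i hi, h.1]
  · exact hzero _ fun i hi h => by linarith [hc1 i hi, h.2]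
  · exact fun z hz => hzero _ fun i hi h => disjoint_left.1 (hS i hi) hz.1 h
  · gcongr ?_ + ENNReal.ofReal (γ / 2) * ?_
    · refine (ENNReal.div_le_div_right hkin _).trans (le_of_eq ?_)
      rw [← ENNReal.ofReal_div_of_pos hm0]
      congr 1; field_simp; norm_num
    · refine (ENNReal.div_le_div_right hquart _).trans (le_of_eq ?_)
      rw [← ENNReal.ofReal_pow hm0.le, ← ENNReal.ofReal_div_of_pos (by positivity)]
      congr 1; field_simp; norm_num

/-- Pigeonhole: among `2 (N + 1)` equal subintervals of `[0, 1]`, at most `N` are hit by the `N`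
obstacles, so at least `N + 1` can carry a tent. This bound needs no typicality and is used for the
exceptional configurations in the average. -/
theorem groundEnergy_le_card (S : Set ℝ) {γ : ℝ} (hγ : 0 ≤ γ) :
    groundEnergy S ⊤ γ ≤ 128 * (((S ∩ Icc 0 1).encard : ℝ≥0∞) + 1) ^ 2 +
      ENNReal.ofReal (64 * γ) := by
  classical
  by_cases hfin : (S ∩ Icc (0 : ℝ) 1).Finite
  swap
  · rw [(Set.not_finite.1 hfin).encard_eq]; simp
  set N := hfin.toFinset.card with hN
  have hcard : (S ∩ Icc (0 : ℝ) 1).encard = N := hfin.encard_eq_coe_toFinset_card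
  set m : ℕ := 2 * (N + 1) with hm
  have hmpos : (0 : ℝ) < m := by positivity
  set r : ℝ := 1 / (2 * m) with hr
  have hrpos : 0 < r := by positivity
  set c : ℕ → ℝ := fun i => (2 * i + 1) * r with hc
  have hmr : 2 * m * r = 1 := by rw [hr]; field_simp
  set u : Finset ℕ := (Finset.range m).filter fun i => Disjoint S (Ioo (c i - r) (c i + r)) with hu
  have hdis : ∀ i j : ℕ, i ≠ j → Disjoint (Ioo (c i - r) (c i + r)) (Ioo (c j - r) (c j + r)) := by
    have : ∀ i j : ℕ, i < j → Disjoint (Ioo (c i - r) (c i + r)) (Ioo (c j - r) (c j + r)) := by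
      intro i j hij
      rw [disjoint_left]
      intro x hx hx'
      have h1 : (i : ℝ) + 1 ≤ j := by exact_mod_cast hij
      have h2 : x < (2 * i + 1) * r + r := hx.2
      have h3 : (2 * j + 1) * r - r < x := hx'.1
      nlinarith
    intro i j hij
    rcases lt_or_gt_of_ne hij with h | h
    · exact this i j h
    · exact (this j i h).symm
  have hI01 : ∀ i ∈ Finset.range m, 0 ≤ c i - r ∧ c i + r ≤ 1 := by
    intro i hi
    have h1 : (i : ℝ) + 1 ≤ m := by exact_mod_cast Finset.mem_range.1 hi
    have h0 : (0 : ℝ) ≤ i := by positivity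
    simp only [c]
    constructor <;> nlinarith
  have hbad : ((Finset.range m).filter fun i => ¬ Disjoint S (Ioo (c i - r) (c i + r))).card ≤ N := by
    have hex : ∀ i ∈ (Finset.range m).filter fun i => ¬ Disjoint S (Ioo (c i - r) (c i + r)),
        ∃ x, x ∈ S ∧ x ∈ Ioo (c i - r) (c i + r) := by
      intro i hi
      exact Set.not_disjoint_iff.1 (Finset.mem_filter.1 hi).2
    choose! p hpS hpI using hex
    refine Finset.card_le_card_of_injOn p (fun i hi => ?_) (fun i hi j hj hij => ?_)
    · have h1 := hI01 i (Finset.mem_filter.1 hi).1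
      have h2 := hpI i hi
      simp only [Finset.mem_coe, Set.Finite.mem_toFinset]
      exact ⟨hpS i hi, by linarith [h2.1], by linarith [h2.2]⟩
    · by_contra hne
      exact disjoint_left.1 (hdis i j hne) (hpI i hi) (hij ▸ hpI j hj)
  have hucard : N + 1 ≤ u.card := by
    have := Finset.card_filter_add_card_filter_not (s := Finset.range m)
      (fun i => Disjoint S (Ioo (c i - r) (c i + r)))
    rw [Finset.card_range] at this
    have h2 : u.card + N ≥ m := by
      rw [← this]
      exact Nat.add_le_add_left hbad _
    omega
  have h := groundEnergy_le_tents (S := S) (γ := γ) hrpos u (Finset.card_pos.1 (by omega)) c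
    (fun i hi => (hI01 i (Finset.mem_filter.1 hi).1).1)
    (fun i hi => (hI01 i (Finset.mem_filter.1 hi).1).2)
    (fun i _ j _ hij => hdis i j hij) (fun i hi => (Finset.mem_filter.1 hi).2)
  refine h.trans ?_
  have hmN : (m : ℝ) = 2 * (N + 1) := by simp [hm]
  gcongr ?_ + ?_
  · rw [hcard]
    have : 8 / r ^ 2 = 128 * ((N : ℝ) + 1) ^ 2 := by
      rw [hr, hmN]; field_simp; norm_num
    rw [this, ENNReal.ofReal_mul (by norm_num), ENNReal.ofReal_pow (by positivity),
      ENNReal.ofReal_add (by positivity) zero_le_one]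
    simp
  · rw [← ENNReal.ofReal_mul (by positivity)]
    apply ENNReal.ofReal_le_ofReal
    have h1 : ((N : ℝ) + 1) ≤ u.card := by exact_mod_cast hucard
    have h0 : (0 : ℝ) < u.card := by
      have : (0 : ℝ) ≤ N := by positivity
      linarith
    have h2 : (32 : ℝ) / (u.card * r) ≤ 128 := by
      rw [div_le_iff₀ (by positivity)]
      have : ((N : ℝ) + 1) * r ≤ u.card * r := by gcongr
      have h3 : ((N : ℝ) + 1) * r = 1 / 4 := by
        have := hmr; rw [hmN] at this; linarith
      linarith
    nlinarith

/-! ### Cutting a function off at the ends of gaps and moving the pieces -/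

theorem Ioo_clamp_subset (a b s t : ℝ) :
    Ioo (max a (min s b)) (max a (min t b)) ⊆ Ioo a b ∩ Ioc s t := by
  intro x hx
  have h1 : a < x := (le_max_left a (min s b)).trans_lt hx.1
  have h2 : x < b := by
    by_contra hc
    push Not at hc
    have : max a (min t b) ≤ x := max_le h1.le ((min_le_right _ _).trans hc)
    exact absurd hx.2 (not_lt.2 this)
  refine ⟨⟨h1, h2⟩, ?_, ?_⟩
  · by_contra hc
    push Not at hc
    exact absurd hx.1 (not_lt.2 (le_max_of_le_right (le_min hc h2.le)))
  · by_contra hc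
    push Not at hc
    exact absurd hx.2 (not_lt.2 (max_le h1.le ((min_le_left _ _).trans hc.le)))

/-- When `f` vanishes at both end points, restricting it to the interval amounts to composing it
with the clamp onto `[a, b]`, which creates no jump. -/
theorem DomBy.indicator_Ioo {f : ℝ → ℝ} {H : ℝ → ℝ≥0∞} (hf : DomBy f H) {a b : ℝ} (hab : a ≤ b)
    (ha : f a = 0) (hb : f b = 0) :
    DomBy ((Ioo a b).indicator f) ((Ioo a b).indicator H) := by
  have hp : ∀ t, (Ioo a b).indicator f t = f (max a (min t b)) := by
    intro t
    by_cases ht : t ∈ Ioo a b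
    · rw [indicator_of_mem ht, min_eq_left ht.2.le, max_eq_right ht.1.le]
    · rw [indicator_of_notMem ht]
      rcases le_or_gt t a with h1 | h1
      · rw [max_eq_left ((min_le_left _ _).trans h1), ha]
      · have h2 : b ≤ t := by
          by_contra hc
          exact ht ⟨h1, not_le.1 hc⟩
        rw [min_eq_right h2, max_eq_right hab, hb]
  intro s t hst
  rw [hp, hp]
  refine (hf _ _ (by gcongr)).trans ?_
  rw [← setLIntegral_congr Ioo_ae_eq_Ioc, ← lintegral_indicator measurableSet_Ioo,
    ← lintegral_indicator measurableSet_Ioc]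
  refine lintegral_mono fun x => ?_
  by_cases hx : x ∈ Ioo (max a (min s b)) (max a (min t b))
  · have := Ioo_clamp_subset a b s t hx
    rw [indicator_of_mem hx, indicator_of_mem this.2, indicator_of_mem this.1]
  · rw [indicator_of_notMem hx]; exact bot_le

theorem DomBy.add {E : Type*} [NormedAddCommGroup E] {f g : ℝ → E} {H G : ℝ → ℝ≥0∞}
    (hf : DomBy f H) (hg : DomBy g G) (hH : AEMeasurable H) :
    DomBy (fun t => f t + g t) (fun t => H t + G t) := by
  intro s t hst
  rw [lintegral_add_left' hH.restrict, add_sub_add_comm]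
  exact (enorm_add_le _ _).trans (add_le_add (hf s t hst) (hg s t hst))

theorem DomBy.sub {E : Type*} [NormedAddCommGroup E] {f g : ℝ → E} {H G : ℝ → ℝ≥0∞}
    (hf : DomBy f H) (hg : DomBy g G) (hH : AEMeasurable H) :
    DomBy (fun t => f t - g t) (fun t => H t + G t) := by
  intro s t hst
  rw [lintegral_add_left' hH.restrict, sub_sub_sub_comm]
  exact (enorm_sub_le).trans (add_le_add (hf s t hst) (hg s t hst))

/-- The modulus of `ψ` on the interval `(x, y)`, lowered near the end points so that it vanishes
there. -/
noncomputable def truncation (ψ : ℝ → ℂ) (w x y : ℝ) : ℝ → ℝ :=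
  (Ioo x y).indicator fun t => max 0 (‖ψ t‖ - (‖ψ x‖ * tent x w t + ‖ψ y‖ * tent y w t))

/-- The slope of the correction made in `truncation`. -/
noncomputable def truncationSlope (ψ : ℝ → ℂ) (w x y : ℝ) (t : ℝ) : ℝ≥0∞ :=
  ‖ψ x‖ₑ * (Ioo (x - w) (x + w)).indicator (fun _ => (ENNReal.ofReal w)⁻¹) t +
    ‖ψ y‖ₑ * (Ioo (y - w) (y + w)).indicator (fun _ => (ENNReal.ofReal w)⁻¹) t

theorem measurable_truncationSlope (ψ : ℝ → ℂ) (w x y : ℝ) :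
    Measurable (truncationSlope ψ w x y) :=
  ((measurable_const.indicator measurableSet_Ioo).const_mul _).add
    ((measurable_const.indicator measurableSet_Ioo).const_mul _)

theorem truncation_eq_zero {ψ : ℝ → ℂ} {w x y t : ℝ} (ht : t ∉ Ioo x y) :
    truncation ψ w x y t = 0 := indicator_of_notMem ht _

theorem truncation_nonneg (ψ : ℝ → ℂ) (w x y t : ℝ) : 0 ≤ truncation ψ w x y t :=
  indicator_nonneg (fun _ _ => le_max_left _ _) _

theorem truncation_le (ψ : ℝ → ℂ) (w x y t : ℝ) : truncation ψ w x y t ≤ ‖ψ t‖ := by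
  by_cases ht : t ∈ Ioo x y
  · rw [truncation, indicator_of_mem ht]
    refine max_le (norm_nonneg _) (sub_le_self _ ?_)
    have := tent_nonneg x w t
    have := tent_nonneg y w t
    positivity
  · rw [truncation_eq_zero ht]; positivity

theorem truncation_eq {ψ : ℝ → ℂ} {w x y t : ℝ} (hw : 0 < w) (ht : t ∈ Icc (x + w) (y - w)) :
    truncation ψ w x y t = ‖ψ t‖ := by
  have h : t ∈ Ioo x y := ⟨by linarith [ht.1], by linarith [ht.2]⟩
  rw [truncation, indicator_of_mem h, tent_eq_zero hw, tent_eq_zero hw]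
  · simp
  · rw [le_abs]; right; linarith [ht.2]
  · rw [le_abs]; left; linarith [ht.1]

/-- At an end point the tent centred there already subtracts the full modulus of `ψ`, and the other
tent is nonnegative, so the positive part vanishes. This remains true if the two tents overlap. -/
theorem domBy_truncation {ψ : ℝ → ℂ} {H : ℝ → ℝ≥0∞} (hψ : DomBy ψ H) (hH : AEMeasurable H)
    {w x y : ℝ} (hw : 0 < w) (hxy : x ≤ y) :
    DomBy (truncation ψ w x y)
      ((Ioo x y).indicator fun t => H t + truncationSlope ψ w x y t) := by
  refine DomBy.indicator_Ioo ?_ hxy ?_ ?_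
  · have h1 := hψ.lipschitz lipschitzWith_one_norm
    have h2 := ((domBy_tent (c := x) hw).const_smul ‖ψ x‖).add
      ((domBy_tent (c := y) hw).const_smul ‖ψ y‖)
      ((measurable_const.indicator measurableSet_Ioo).const_mul _).aemeasurable
    have h3 := (h1.sub h2 (hH.const_mul _)).lipschitz
      ((LipschitzWith.id (α := ℝ)).const_max 0)
    refine h3.mono fun t => le_of_eq ?_
    simp [truncationSlope]
  · have := tent_nonneg y w x
    rw [tent_self]
    apply max_eq_left
    have : 0 ≤ ‖ψ y‖ * tent y w x := by positivity
    linarith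
  · have := tent_nonneg x w y
    rw [tent_self]
    apply max_eq_left
    have : 0 ≤ ‖ψ x‖ * tent x w y := by positivity
    linarith

theorem lintegral_truncationSlope_sq_le (ψ : ℝ → ℂ) {w : ℝ} (hw : 0 < w) (x y : ℝ) :
    ∫⁻ t, truncationSlope ψ w x y t ^ 2 ≤
      4 * (ENNReal.ofReal w)⁻¹ * (‖ψ x‖ₑ ^ 2 + ‖ψ y‖ₑ ^ 2) := by
  have hw' : ENNReal.ofReal w ≠ 0 := by simpa using hw
  have key : ∀ z : ℝ, ∫⁻ t, (‖ψ z‖ₑ * (Ioo (z - w) (z + w)).indicator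
      (fun _ => (ENNReal.ofReal w)⁻¹) t) ^ 2 = ‖ψ z‖ₑ ^ 2 * (2 * (ENNReal.ofReal w)⁻¹) := by
    intro z
    simp_rw [mul_pow]
    rw [lintegral_const_mul' _ _ (by simp)]
    congr 1
    have : ∀ t, ((Ioo (z - w) (z + w)).indicator (fun _ => (ENNReal.ofReal w)⁻¹) t) ^ 2 =
        (Ioo (z - w) (z + w)).indicator (fun _ => (ENNReal.ofReal w)⁻¹ ^ 2) t := by
      intro t
      by_cases ht : t ∈ Ioo (z - w) (z + w)
      · simp [indicator_of_mem ht]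
      · simp [indicator_of_notMem ht]
    simp_rw [this]
    rw [lintegral_indicator measurableSet_Ioo, setLIntegral_const, Real.volume_Ioo,
      show z + w - (z - w) = 2 * w by ring, ENNReal.ofReal_mul zero_le_two,
      ENNReal.ofReal_ofNat, sq, mul_assoc, mul_left_comm, mul_comm (2 : ℝ≥0∞), ← mul_assoc _ _ (2 : ℝ≥0∞), ← mul_assoc _ _ (2 : ℝ≥0∞),
      ENNReal.inv_mul_cancel hw' ENNReal.ofReal_ne_top, mul_one, mul_comm]
  calc ∫⁻ t, truncationSlope ψ w x y t ^ 2
      ≤ ∫⁻ t, (2 * (‖ψ x‖ₑ * (Ioo (x - w) (x + w)).indicator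
          (fun _ => (ENNReal.ofReal w)⁻¹) t) ^ 2 + 2 * (‖ψ y‖ₑ *
          (Ioo (y - w) (y + w)).indicator (fun _ => (ENNReal.ofReal w)⁻¹) t) ^ 2) :=
        lintegral_mono fun t => ennreal_add_sq_le _ _
    _ = 2 * (‖ψ x‖ₑ ^ 2 * (2 * (ENNReal.ofReal w)⁻¹)) +
          2 * (‖ψ y‖ₑ ^ 2 * (2 * (ENNReal.ofReal w)⁻¹)) := by
        rw [lintegral_add_left, lintegral_const_mul' _ _ (by simp),
          lintegral_const_mul' _ _ (by simp), key, key]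
        exact (((measurable_const.indicator measurableSet_Ioo).const_mul _).pow_const 2).const_mul _
    _ = _ := by ring

theorem sum_lintegral_le_of_disjoint {ι : Type*} (u : Finset ι) (I : ι → Set ℝ)
    (hI : ∀ i ∈ u, MeasurableSet (I i))
    (hdisj : ∀ i ∈ u, ∀ j ∈ u, i ≠ j → Disjoint (I i) (I j)) (f : ℝ → ℝ≥0∞) :
    ∑ i ∈ u, ∫⁻ t in I i, f t ≤ ∫⁻ t, f t := by
  rw [← lintegral_biUnion_finset (fun i hi j hj hij => hdisj i hi j hj hij) hI]
  exact setLIntegral_le_lintegral _ _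

/-- Pieces of a function on disjoint intervals, cut off near the ends of the intervals, are moved
to disjoint intervals (shortened by a factor `ρ`) which contain no obstacle. -/
theorem groundEnergy_le_transplant {ι : Type*} {S : Set ℝ} {γ : ℝ} {ψ : ℝ → ℂ} {H : ℝ → ℝ≥0∞}
    (hψ : DomBy ψ H) (hH : AEMeasurable H) (hψm : Measurable ψ) (u : Finset ι) (x y p : ι → ℝ)
    {w ρ : ℝ} (hw : 0 < w) (hρ : 0 < ρ) (hρ1 : ρ ≤ 1)
    (hxy : ∀ i ∈ u, x i ≤ y i)
    (hdisj : ∀ i ∈ u, ∀ j ∈ u, i ≠ j → Disjoint (Ioo (x i) (y i)) (Ioo (x j) (y j)))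
    (hp0 : ∀ i ∈ u, 0 ≤ p i) (hp1 : ∀ i ∈ u, p i + ρ * (y i - x i) ≤ 1)
    (hpdisj : ∀ i ∈ u, ∀ j ∈ u, i ≠ j → Disjoint (Ioo (p i) (p i + ρ * (y i - x i)))
      (Ioo (p j) (p j + ρ * (y j - x j))))
    (hpS : ∀ i ∈ u, Disjoint S (Ioo (p i) (p i + ρ * (y i - x i))))
    {e : ℝ≥0} (he : e ≠ 0) {m : ℝ≥0∞} (hm0 : m ≠ 0) (hm1 : m ≤ 1)
    (hm : m ≤ ∑ i ∈ u, ∫⁻ t in Icc (x i + w) (y i - w), ‖ψ t‖ₑ ^ 2) :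
    groundEnergy S ⊤ γ ≤ (ENNReal.ofReal ρ ^ 2 * m ^ 2)⁻¹ *
      ((1 + e) * (∫⁻ t, H t ^ 2) + (1 + (e : ℝ≥0∞)⁻¹) * (4 * (ENNReal.ofReal w)⁻¹ *
        ∑ i ∈ u, (‖ψ (x i)‖ₑ ^ 2 + ‖ψ (y i)‖ₑ ^ 2)) +
        ENNReal.ofReal (γ / 2) * ∫⁻ t, ‖ψ t‖ₑ ^ 4) := by
  -- The affine map `t ↦ c t + d i` carries the target interval `J i`, of length `ρ (y i - x i)`,
  -- onto the `i`-th source gap. Under this contraction mass and quartic integral scale by `ρ`, and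
  -- kinetic energy by `ρ⁻¹`.
  set c : ℝ := ρ⁻¹ with hc
  have hcpos : 0 < c := inv_pos.2 hρ
  have hcρ : c * ρ = 1 := inv_mul_cancel₀ hρ.ne'
  set d : ι → ℝ := fun i => x i - c * p i with hd
  set J : ι → Set ℝ := fun i => Ioo (p i) (p i + ρ * (y i - x i)) with hJ
  set v : ι → ℝ → ℝ := fun i => truncation ψ w (x i) (y i) with hv
  set G : ι → ℝ → ℝ≥0∞ := fun i =>
    (Ioo (x i) (y i)).indicator fun t => H t + truncationSlope ψ w (x i) (y i) t with hG
  have hmemJ : ∀ i t, c * t + d i ∈ Ioo (x i) (y i) ↔ t ∈ J i := by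
    intro i t
    simp only [d, J, mem_Ioo]
    have e1 : c * t + (x i - c * p i) = x i + c * (t - p i) := by ring
    rw [e1]
    constructor
    · rintro ⟨h1, h2⟩
      have h3 : 0 < c * (t - p i) := by linarith
      have h4 : 0 < t - p i := (mul_pos_iff_of_pos_left hcpos).1 h3
      have h5 : ρ * (c * (t - p i)) < ρ * (y i - x i) := by gcongr; linarith
      have h6 : ρ * (c * (t - p i)) = t - p i := by rw [← mul_assoc, mul_comm ρ, hcρ, one_mul]
      exact ⟨by linarith, by linarith⟩
    · rintro ⟨h1, h2⟩
      have h4 : 0 < t - p i := by linarith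
      have h3 : 0 < c * (t - p i) := by positivity
      have h5 : c * (t - p i) < c * (ρ * (y i - x i)) := by gcongr; linarith
      have h6 : c * (ρ * (y i - x i)) = y i - x i := by rw [← mul_assoc, hcρ, one_mul]
      exact ⟨by linarith, by linarith⟩
  set f : ι → ℝ → ℝ := fun i t => v i (c * t + d i) with hf
  set K : ι → ℝ → ℝ≥0∞ := fun i t => ENNReal.ofReal c * G i (c * t + d i) with hK
  have hGm : ∀ i, AEMeasurable (G i) := fun i =>
    (hH.add (measurable_truncationSlope ψ w _ _).aemeasurable).indicator measurableSet_Ioo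
  have hqmp : ∀ i, Measure.QuasiMeasurePreserving (fun t : ℝ => c * t + d i) := by
    intro i
    have h1 : Measure.QuasiMeasurePreserving (fun t : ℝ => c * t) := by
      refine ⟨by fun_prop, ?_⟩
      rw [Real.map_volume_mul_left hcpos.ne']
      exact Measure.smul_absolutelyContinuous
    exact (measurePreserving_add_right volume (d i)).quasiMeasurePreserving.comp h1
  have hKm : ∀ i ∈ u, AEMeasurable (K i) := fun i _ =>
    ((hGm i).comp_quasiMeasurePreserving (hqmp i)).const_mul _
  have hdom : DomBy (fun t => ∑ i ∈ u, f i t) (fun t => ∑ i ∈ u, K i t) :=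
    DomBy.sum u (fun i hi => (domBy_truncation hψ hH hw (hxy i hi)).comp_affine hcpos (d i)) hKm
  have hd2 : ∀ t, ∀ i ∈ u, ∀ j ∈ u, i ≠ j → t ∉ J i ∨ t ∉ J j := by
    intro t i hi j hj hij
    by_contra hcc
    push Not at hcc
    exact (disjoint_left.1 (hpdisj i hi j hj hij)) hcc.1 hcc.2
  have hf0 : ∀ i t, t ∉ J i → f i t = 0 := fun i t ht =>
    truncation_eq_zero (fun h => ht ((hmemJ i t).1 h))
  have hK0 : ∀ i t, t ∉ J i → K i t = 0 := fun i t ht => by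
    simp only [K, G]
    rw [indicator_of_notMem (fun h => ht ((hmemJ i t).1 h)), mul_zero]
  have hzero : ∀ t, (∀ i ∈ u, t ∉ J i) → ∑ i ∈ u, f i t = 0 := fun t ht =>
    Finset.sum_eq_zero fun i hi => hf0 i t (ht i hi)
  have hvm : ∀ i, Measurable (v i) := by
    intro i
    refine Measurable.indicator ?_ measurableSet_Ioo
    have h1 : ∀ z, Measurable (tent z w) := fun z => by unfold tent; fun_prop
    have := h1 (x i)
    have := h1 (y i)
    fun_prop
  have hfm : ∀ i ∈ u, ∀ k : ℕ, Measurable fun t => ‖f i t‖ₑ ^ k := fun i _ k =>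
    ((hvm i).comp (by fun_prop)).enorm.pow_const k
  have key : ∀ k : ℕ, k ≠ 0 → ∀ t, ‖∑ i ∈ u, f i t‖ₑ ^ k = ∑ i ∈ u, ‖f i t‖ₑ ^ k := by
    intro k hk t
    refine map_sum_of_disjoint u (fun i => f i t) (fun a => ‖a‖ₑ ^ k) (by simp [hk]) ?_
    exact fun i hi j hj hij => (hd2 t i hi j hj hij).imp (hf0 i t) (hf0 j t)
  set r := ENNReal.ofReal ρ with hr
  have hr0 : r ≠ 0 := by simpa [r] using hρ
  have hrt : r ≠ ⊤ := ENNReal.ofReal_ne_top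
  have hcr : ENNReal.ofReal c = r⁻¹ := ENNReal.ofReal_inv_of_pos hρ
  have hmass : r * m ≤ ∫⁻ t in Icc (0 : ℝ) 1, ‖∑ i ∈ u, f i t‖ₑ ^ 2 := by
    simp_rw [key 2 two_ne_zero]
    rw [lintegral_finsetSum _ fun i hi => hfm i hi 2]
    refine (mul_le_mul_right hm r).trans ?_
    rw [Finset.mul_sum]
    refine Finset.sum_le_sum fun i hi => ?_
    have h1 : ∫⁻ t in Icc (0 : ℝ) 1, ‖f i t‖ₑ ^ 2 = ∫⁻ t, ‖f i t‖ₑ ^ 2 := by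
      rw [← lintegral_indicator measurableSet_Icc]
      congr 1
      ext t
      by_cases ht : t ∈ Icc (0 : ℝ) 1
      · rw [indicator_of_mem ht]
      · rw [indicator_of_notMem ht, hf0 i t, enorm_zero]
        · simp
        · exact fun h => ht ⟨by linarith [hp0 i hi, h.1], by linarith [hp1 i hi, h.2]⟩
    rw [h1]
    have h2 : ∫⁻ t, ‖f i t‖ₑ ^ 2 = r * ∫⁻ t, ‖v i t‖ₑ ^ 2 := by
      have := lintegral_comp_affine (fun t => ‖v i t‖ₑ ^ 2) hcpos (d i)
      rw [hcr, inv_inv] at this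
      exact this
    rw [h2]
    gcongr r * ?_
    rw [← lintegral_indicator measurableSet_Icc]
    refine lintegral_mono fun t => ?_
    by_cases ht : t ∈ Icc (x i + w) (y i - w)
    · rw [indicator_of_mem ht]
      simp only [v]
      rw [truncation_eq hw ht, enorm_norm]
    · rw [indicator_of_notMem ht]; exact bot_le
  have hkin : ∫⁻ t in Icc (0 : ℝ) 1, (∑ i ∈ u, K i t) ^ 2 ≤ r⁻¹ *
      ((1 + e) * (∫⁻ t, H t ^ 2) + (1 + (e : ℝ≥0∞)⁻¹) * (4 * (ENNReal.ofReal w)⁻¹ *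
        ∑ i ∈ u, (‖ψ (x i)‖ₑ ^ 2 + ‖ψ (y i)‖ₑ ^ 2))) := by
    refine (setLIntegral_le_lintegral _ _).trans ?_
    have e1 : ∀ t, (∑ i ∈ u, K i t) ^ 2 = ∑ i ∈ u, (K i t) ^ 2 := by
      intro t
      refine map_sum_of_disjoint u (fun i => K i t) (fun a => a ^ 2) (by simp) ?_
      exact fun i hi j hj hij => (hd2 t i hi j hj hij).imp (hK0 i t) (hK0 j t)
    simp_rw [e1]
    rw [lintegral_finsetSum' _ fun i hi => (hKm i hi).pow_const 2]
    have h2 : ∀ i ∈ u, ∫⁻ t, (K i t) ^ 2 ≤ r⁻¹ *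
        ((1 + e) * (∫⁻ t in Ioo (x i) (y i), H t ^ 2) + (1 + (e : ℝ≥0∞)⁻¹) *
          (4 * (ENNReal.ofReal w)⁻¹ * (‖ψ (x i)‖ₑ ^ 2 + ‖ψ (y i)‖ₑ ^ 2))) := by
      intro i hi
      simp only [K, mul_pow]
      rw [lintegral_const_mul' _ _ (by simp), lintegral_comp_affine (fun t => G i t ^ 2) hcpos, hcr,
        inv_inv, ← mul_assoc, sq r⁻¹, mul_assoc r⁻¹, ENNReal.inv_mul_cancel hr0 hrt, mul_one]
      gcongr r⁻¹ * ?_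
      calc ∫⁻ t, G i t ^ 2
          = ∫⁻ t in Ioo (x i) (y i), (H t + truncationSlope ψ w (x i) (y i) t) ^ 2 := by
            rw [← lintegral_indicator measurableSet_Ioo]
            congr 1
            ext t
            by_cases ht : t ∈ Ioo (x i) (y i)
            · simp only [G, indicator_of_mem ht]
            · simp [G, indicator_of_notMem ht]
        _ ≤ ∫⁻ t in Ioo (x i) (y i), ((1 + e) * H t ^ 2 +
              (1 + (e : ℝ≥0∞)⁻¹) * truncationSlope ψ w (x i) (y i) t ^ 2) :=
            lintegral_mono fun t => ennreal_add_sq_le_eps _ _ he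
        _ = (1 + e) * (∫⁻ t in Ioo (x i) (y i), H t ^ 2) + (1 + (e : ℝ≥0∞)⁻¹) *
              ∫⁻ t in Ioo (x i) (y i), truncationSlope ψ w (x i) (y i) t ^ 2 := by
            rw [lintegral_add_left' ((hH.restrict.pow_const 2).const_mul _),
              lintegral_const_mul' _ _ (by simp), lintegral_const_mul' _ _ (by simp [he])]
        _ ≤ _ := by
            gcongr
            exact (setLIntegral_le_lintegral _ _).trans (lintegral_truncationSlope_sq_le ψ hw _ _)
    refine (Finset.sum_le_sum h2).trans ?_
    rw [← Finset.mul_sum, Finset.sum_add_distrib, ← Finset.mul_sum, ← Finset.mul_sum,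
      ← Finset.mul_sum]
    gcongr
    exact sum_lintegral_le_of_disjoint u _ (fun i _ => measurableSet_Ioo) hdisj _
  have hquart : ∫⁻ t in Icc (0 : ℝ) 1, ‖∑ i ∈ u, f i t‖ₑ ^ 4 ≤ r * ∫⁻ t, ‖ψ t‖ₑ ^ 4 := by
    refine (setLIntegral_le_lintegral _ _).trans ?_
    simp_rw [key 4 four_ne_zero]
    rw [lintegral_finsetSum _ fun i hi => hfm i hi 4]
    have h2 : ∀ i ∈ u, ∫⁻ t, ‖f i t‖ₑ ^ 4 ≤ r * ∫⁻ t in Ioo (x i) (y i), ‖ψ t‖ₑ ^ 4 := by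
      intro i hi
      have := lintegral_comp_affine (fun t => ‖v i t‖ₑ ^ 4) hcpos (d i)
      rw [hcr, inv_inv] at this
      refine this.le.trans ?_
      gcongr r * ?_
      rw [← lintegral_indicator measurableSet_Ioo]
      refine lintegral_mono fun t => ?_
      by_cases ht : t ∈ Ioo (x i) (y i)
      · rw [indicator_of_mem ht]
        gcongr
        rw [← enorm_norm (ψ t), Real.enorm_eq_ofReal (truncation_nonneg _ _ _ _ _),
          Real.enorm_eq_ofReal (norm_nonneg _)]
        exact ENNReal.ofReal_le_ofReal (truncation_le _ _ _ _ _)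
      · simp [v, truncation_eq_zero ht]
    refine (Finset.sum_le_sum h2).trans ?_
    rw [← Finset.mul_sum]
    gcongr
    exact sum_lintegral_le_of_disjoint u _ (fun i _ => measurableSet_Ioo) hdisj _
  have hmt : m ≠ ⊤ := ne_top_of_le_ne_top ENNReal.one_ne_top hm1
  have hr1 : r ≤ 1 := ENNReal.ofReal_le_one.2 hρ1
  refine (groundEnergy_le_of_domBy hdom (Finset.aemeasurable_fun_sum u hKm) ?_ ?_ ?_
    (mul_ne_zero hr0 hm0) (ENNReal.mul_ne_top hrt hmt) hmass).trans ?_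
  · exact hzero _ fun i hi h => by linarith [hp0 i hi, h.1]
  · exact hzero _ fun i hi h => by linarith [hp1 i hi, h.2]
  · exact fun z hz => hzero _ fun i hi h => disjoint_left.1 (hpS i hi) hz.1 h
  -- Normalisation by the mass `r * m` gives the factor `r⁻² m⁻¹` for the kinetic part and `r⁻¹ m⁻²`
  -- for the interaction. Since `r` and `m` are at most one, both are bounded by the common factor
  -- `r⁻² m⁻²`.
  · set X := (1 + (e : ℝ≥0∞)) * (∫⁻ t, H t ^ 2) + (1 + (e : ℝ≥0∞)⁻¹) *
      (4 * (ENNReal.ofReal w)⁻¹ * ∑ i ∈ u, (‖ψ (x i)‖ₑ ^ 2 + ‖ψ (y i)‖ₑ ^ 2)) with hX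
    rw [mul_add]
    refine add_le_add ?_ ?_
    · refine (ENNReal.div_le_div_right hkin _).trans ?_
      rw [ENNReal.div_eq_inv_mul, ← mul_assoc, ← ENNReal.mul_inv (Or.inr hrt) (Or.inr hr0)]
      refine mul_le_mul_left (ENNReal.inv_le_inv.2 ?_) _
      calc r ^ 2 * m ^ 2 = r * m * r * m := by ring
        _ ≤ r * m * r * 1 := by gcongr
        _ = _ := mul_one _
    · rw [mul_left_comm]
      gcongr ENNReal.ofReal (γ / 2) * ?_
      refine (ENNReal.div_le_div_right hquart _).trans ?_
      rw [ENNReal.div_eq_inv_mul, ← mul_assoc, ← mul_pow]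
      gcongr ?_ * _
      calc ((r * m) ^ 2)⁻¹ * r ≤ ((r * m) ^ 2)⁻¹ * 1 := by gcongr
        _ = _ := mul_one _

/-! ### Mass close to the ends of an interval -/

/-- Within distance `w` of the end point, Cauchy-Schwarz bounds the squared increment of `ψ` by `w`
times the kinetic energy; integrating over a length `w` gives the second power. The minimum with `y`
keeps the estimate inside the interval, so that kinetic energies of different gaps can be added. -/
theorem DomBy.setLIntegral_near_le {ψ : ℝ → ℂ} {H : ℝ → ℝ≥0∞} (hψ : DomBy ψ H)
    (hH : AEMeasurable H) (w x y : ℝ) :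
    ∫⁻ t in Icc x (min y (x + w)), ‖ψ t‖ₑ ^ 2 ≤
      2 * ENNReal.ofReal w * ‖ψ x‖ₑ ^ 2 +
        2 * ENNReal.ofReal w ^ 2 * ∫⁻ t in Ioo x y, H t ^ 2 := by
  set A := ∫⁻ t in Ioo x y, H t ^ 2 with hA
  have key : ∀ t ∈ Icc x (min y (x + w)), ‖ψ t‖ₑ ^ 2 ≤
      2 * ‖ψ x‖ₑ ^ 2 + 2 * (ENNReal.ofReal w * A) := by
    intro t ht
    have h1 : ‖ψ t‖ₑ ≤ ‖ψ x‖ₑ + ∫⁻ s in Ioc x t, H s := by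
      calc ‖ψ t‖ₑ = ‖ψ x + (ψ t - ψ x)‖ₑ := by rw [add_sub_cancel]
        _ ≤ ‖ψ x‖ₑ + ‖ψ t - ψ x‖ₑ := enorm_add_le _ _
        _ ≤ _ := by gcongr; exact hψ x t ht.1
    have h2 : (∫⁻ s in Ioc x t, H s) ^ 2 ≤ ENNReal.ofReal w * A := by
      refine (setLIntegral_sq_le hH.restrict).trans ?_
      gcongr
      · rw [Real.volume_Ioc]
        apply ENNReal.ofReal_le_ofReal
        linarith [ht.2.trans (min_le_right _ _)]
      · rw [hA, setLIntegral_congr Ioo_ae_eq_Ioc]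
        exact lintegral_mono_set (Ioc_subset_Ioc_right (ht.2.trans (min_le_left _ _)))
    calc ‖ψ t‖ₑ ^ 2 ≤ (‖ψ x‖ₑ + ∫⁻ s in Ioc x t, H s) ^ 2 := by gcongr
      _ ≤ 2 * ‖ψ x‖ₑ ^ 2 + 2 * (∫⁻ s in Ioc x t, H s) ^ 2 := ennreal_add_sq_le _ _
      _ ≤ _ := by gcongr
  refine (setLIntegral_mono measurable_const key).trans ?_
  rw [setLIntegral_const, Real.volume_Icc]
  calc _ ≤ (2 * ‖ψ x‖ₑ ^ 2 + 2 * (ENNReal.ofReal w * A)) * ENNReal.ofReal w := by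
        gcongr
        linarith [min_le_right y (x + w)]
    _ = _ := by ring

theorem setLIntegral_neg (f : ℝ → ℝ≥0∞) {s : Set ℝ} (hs : MeasurableSet s) :
    ∫⁻ t in (fun t => -t) ⁻¹' s, f (-t) = ∫⁻ t in s, f t := by
  rw [← lintegral_indicator hs, ← lintegral_indicator (measurable_neg hs)]
  exact lintegral_neg_eq_self (s.indicator f)

theorem setLIntegral_biUnion_finset_le {ι : Type*} (u : Finset ι) (I : ι → Set ℝ)
    (f : ℝ → ℝ≥0∞) : ∫⁻ t in ⋃ i ∈ u, I i, f t ≤ ∑ i ∈ u, ∫⁻ t in I i, f t := by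
  classical
  induction u using Finset.induction_on with
  | empty => simp
  | insert i u hi ih =>
    rw [Finset.set_biUnion_insert, Finset.sum_insert hi]
    exact (lintegral_union_le _ _ _).trans (by gcongr)

theorem DomBy.reflect {ψ : ℝ → ℂ} {H : ℝ → ℝ≥0∞} (hψ : DomBy ψ H) :
    DomBy (fun t => ψ (-t)) (fun t => H (-t)) := by
  intro s t hst
  have h := hψ (-t) (-s) (by linarith)
  rw [enorm_sub_rev]
  refine h.trans (le_of_eq ?_)
  rw [← setLIntegral_neg _ measurableSet_Ioc, ← setLIntegral_congr Ioo_ae_eq_Ioc,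
    setLIntegral_congr Ioo_ae_eq_Ico]
  congr 2
  ext z
  simp only [mem_preimage, mem_Ioc, mem_Ico]
  constructor
  · rintro ⟨_, _⟩; exact ⟨by linarith, by linarith⟩
  · rintro ⟨_, _⟩; exact ⟨by linarith, by linarith⟩

theorem DomBy.setLIntegral_near_le' {ψ : ℝ → ℂ} {H : ℝ → ℝ≥0∞} (hψ : DomBy ψ H)
    (hH : AEMeasurable H) (w x y : ℝ) :
    ∫⁻ t in Icc (max x (y - w)) y, ‖ψ t‖ₑ ^ 2 ≤
      2 * ENNReal.ofReal w * ‖ψ y‖ₑ ^ 2 +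
        2 * ENNReal.ofReal w ^ 2 * ∫⁻ t in Ioo x y, H t ^ 2 := by
  have h := hψ.reflect.setLIntegral_near_le
    (hH.comp_quasiMeasurePreserving (Measure.measurePreserving_neg volume).quasiMeasurePreserving)
    w (-y) (-x)
  rw [neg_neg] at h
  have e1 := setLIntegral_neg (fun t => ‖ψ t‖ₑ ^ 2) (measurableSet_Icc (a := max x (y - w)) (b := y))
  have e2 := setLIntegral_neg (fun t => H t ^ 2) (measurableSet_Ioo (a := x) (b := y))
  have s1 : (fun t : ℝ => -t) ⁻¹' Icc (max x (y - w)) y = Icc (-y) (min (-x) (-y + w)) := by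
    ext t
    simp only [mem_preimage, mem_Icc, max_le_iff, le_min_iff]
    constructor
    · rintro ⟨⟨_, _⟩, _⟩; exact ⟨by linarith, by linarith, by linarith⟩
    · rintro ⟨_, _, _⟩; exact ⟨⟨by linarith, by linarith⟩, by linarith⟩
  have s2 : (fun t : ℝ => -t) ⁻¹' Ioo x y = Ioo (-y) (-x) := by
    ext t
    simp only [mem_preimage, mem_Ioo]
    constructor
    · rintro ⟨_, _⟩; exact ⟨by linarith, by linarith⟩
    · rintro ⟨_, _⟩; exact ⟨by linarith, by linarith⟩
  rw [s1] at e1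
  rw [s2] at e2
  rw [← e1, ← e2]
  exact h

theorem Icc_subset_near_far (x y w : ℝ) :
    Icc x y ⊆ Icc (x + w) (y - w) ∪ (Icc x (min y (x + w)) ∪ Icc (max x (y - w)) y) := by
  intro t ht
  by_cases h1 : t ≤ x + w
  · exact Or.inr (Or.inl ⟨ht.1, le_min ht.2 h1⟩)
  · by_cases h2 : y - w ≤ t
    · exact Or.inr (Or.inr ⟨max_le ht.1 h2, ht.2⟩)
    · exact Or.inl ⟨(not_le.1 h1).le, (not_le.1 h2).le⟩

/-! ### Gap families and the comparison of soft with hard obstacles -/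

/-- A family of intervals which are bounded by obstacles (or lie at the ends of the sample) and
which cover `[0, 1]`. -/
structure IsGapFamily {ι : Type*} (S : Set ℝ) (u : Finset ι) (x y : ι → ℝ) : Prop where
  le : ∀ i ∈ u, x i ≤ y i
  disjoint : ∀ i ∈ u, ∀ j ∈ u, i ≠ j → Disjoint (Ioo (x i) (y i)) (Ioo (x j) (y j))
  cover : Icc (0 : ℝ) 1 ⊆ ⋃ i ∈ u, Icc (x i) (y i)
  injOn_left : InjOn x u
  injOn_right : InjOn y u
  left_mem : ∀ i ∈ u, x i ∈ S ∨ x i ∉ Ioo (0 : ℝ) 1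
  right_mem : ∀ i ∈ u, y i ∈ S ∨ y i ∉ Ioo (0 : ℝ) 1

/-- Each obstacle is counted at most once by injectivity, and end points outside the open sample
contribute nothing. Boundary terms at gap ends are thus controlled by the obstacle energy. -/
theorem sum_le_tsum_obstacles {ι : Type*} {S : Set ℝ} {u : Finset ι} {x : ι → ℝ}
    (hinj : InjOn x u) (hx : ∀ i ∈ u, x i ∈ S ∨ x i ∉ Ioo (0 : ℝ) 1) (F : ℝ → ℝ≥0∞)
    (hF : ∀ t, t ∉ Ioo (0 : ℝ) 1 → F t = 0) :
    ∑ i ∈ u, F (x i) ≤ ∑' z : ↥(S ∩ Icc (0 : ℝ) 1), F z := by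
  classical
  set u' := u.filter fun i => x i ∈ S ∩ Icc (0 : ℝ) 1 with hu'
  have h1 : ∑ i ∈ u, F (x i) = ∑ i ∈ u', F (x i) := by
    rw [hu', Finset.sum_filter_of_ne]
    intro i hi hne
    have h2 : x i ∈ Ioo (0 : ℝ) 1 := by
      by_contra hc
      exact hne (hF _ hc)
    exact ⟨(hx i hi).resolve_right (fun h => h h2), Ioo_subset_Icc_self h2⟩
  rw [h1]
  have h2 : ∑ i ∈ u', F (x i) = ∑ z ∈ u'.image x, F z := by
    rw [Finset.sum_image]
    exact fun i hi j hj h => hinj (Finset.mem_filter.1 hi).1 (Finset.mem_filter.1 hj).1 h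
  rw [h2, tsum_subtype (S ∩ Icc (0 : ℝ) 1) F]
  refine le_trans (le_of_eq ?_) (ENNReal.sum_le_tsum (u'.image x))
  refine Finset.sum_congr rfl fun z hz => ?_
  rw [indicator_of_mem]
  obtain ⟨i, hi, rfl⟩ := Finset.mem_image.1 hz
  exact (Finset.mem_filter.1 hi).2

/-- Most of the mass is away from the ends of the gaps if the kinetic energy is small. -/
theorem IsGapFamily.mass_le_far_add {ι : Type*} {S : Set ℝ} {u : Finset ι} {x y : ι → ℝ}
    (hg : IsGapFamily S u x y) {ψ : ℝ → ℂ} {H : ℝ → ℝ≥0∞} (hψ : DomBy ψ H)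
    (hH : AEMeasurable H) (hψ0 : ∀ t, t ∉ Ioo (0 : ℝ) 1 → ψ t = 0) (w : ℝ) :
    ∫⁻ t in Icc (0 : ℝ) 1, ‖ψ t‖ₑ ^ 2 ≤
      (∑ i ∈ u, ∫⁻ t in Icc (x i + w) (y i - w), ‖ψ t‖ₑ ^ 2) +
      (4 * ENNReal.ofReal w * ∑' z : ↥(S ∩ Icc (0 : ℝ) 1), ‖ψ z‖ₑ ^ 2 +
        4 * ENNReal.ofReal w ^ 2 * ∫⁻ t, H t ^ 2) := by
  have h1 : ∫⁻ t in Icc (0 : ℝ) 1, ‖ψ t‖ₑ ^ 2 ≤ ∑ i ∈ u, ∫⁻ t in Icc (x i) (y i), ‖ψ t‖ₑ ^ 2 :=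
    (lintegral_mono_set hg.cover).trans (setLIntegral_biUnion_finset_le _ _ _)
  have h2 : ∀ i ∈ u, ∫⁻ t in Icc (x i) (y i), ‖ψ t‖ₑ ^ 2 ≤
      (∫⁻ t in Icc (x i + w) (y i - w), ‖ψ t‖ₑ ^ 2) +
        (2 * ENNReal.ofReal w * (‖ψ (x i)‖ₑ ^ 2 + ‖ψ (y i)‖ₑ ^ 2) +
          4 * ENNReal.ofReal w ^ 2 * ∫⁻ t in Ioo (x i) (y i), H t ^ 2) := by
    intro i _
    refine (lintegral_mono_set (Icc_subset_near_far _ _ w)).trans ?_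
    refine (lintegral_union_le _ _ _).trans ?_
    gcongr
    refine (lintegral_union_le _ _ _).trans ?_
    refine (add_le_add (hψ.setLIntegral_near_le hH w _ _)
      (hψ.setLIntegral_near_le' hH w _ _)).trans (le_of_eq ?_)
    ring
  refine h1.trans ((Finset.sum_le_sum h2).trans ?_)
  rw [Finset.sum_add_distrib, Finset.sum_add_distrib, ← Finset.mul_sum, ← Finset.mul_sum,
    Finset.sum_add_distrib]
  have hF : ∀ t, t ∉ Ioo (0 : ℝ) 1 → ‖ψ t‖ₑ ^ 2 = 0 := fun t ht => by simp [hψ0 t ht]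
  have hl := sum_le_tsum_obstacles hg.injOn_left hg.left_mem _ hF
  have hr := sum_le_tsum_obstacles hg.injOn_right hg.right_mem _ hF
  refine add_le_add le_rfl (add_le_add ?_ (mul_le_mul_right ?_ _))
  · calc _ ≤ 2 * ENNReal.ofReal w * ((∑' z : ↥(S ∩ Icc (0 : ℝ) 1), ‖ψ z‖ₑ ^ 2) +
          ∑' z : ↥(S ∩ Icc (0 : ℝ) 1), ‖ψ z‖ₑ ^ 2) := by gcongr
      _ = _ := by ring
  · exact sum_lintegral_le_of_disjoint u _ (fun i _ => measurableSet_Ioo) hg.disjoint _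

/-- Most of the mass is away from the ends of the gaps if the interaction energy is bounded. -/
theorem IsGapFamily.mass_le_far_add' {ι : Type*} {S : Set ℝ} {u : Finset ι} {x y : ι → ℝ}
    (hg : IsGapFamily S u x y) {ψ : ℝ → ℂ} (hψm : Measurable ψ) (w : ℝ) :
    ∃ n : ℝ≥0∞, n ^ 2 ≤ 2 * ENNReal.ofReal w * u.card * (∫⁻ t, ‖ψ t‖ₑ ^ 4) ∧
      ∫⁻ t in Icc (0 : ℝ) 1, ‖ψ t‖ₑ ^ 2 ≤
      (∑ i ∈ u, ∫⁻ t in Icc (x i + w) (y i - w), ‖ψ t‖ₑ ^ 2) + n := by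
  set N : Set ℝ := ⋃ i ∈ u, (Icc (x i) (min (y i) (x i + w)) ∪ Icc (max (x i) (y i - w)) (y i))
    with hN
  have hvol : volume N ≤ 2 * ENNReal.ofReal w * u.card := by
    refine (measure_biUnion_finset_le _ _).trans ?_
    refine (Finset.sum_le_card_nsmul u _ (2 * ENNReal.ofReal w) fun i _ => ?_).trans ?_
    · refine (measure_union_le _ _).trans ?_
      rw [Real.volume_Icc, Real.volume_Icc, two_mul]
      gcongr
      · linarith [min_le_right (y i) (x i + w)]
      · linarith [le_max_right (x i) (y i - w)]
    · rw [nsmul_eq_mul, mul_comm]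
  refine ⟨∫⁻ t in N, ‖ψ t‖ₑ ^ 2, ?_, ?_⟩
  · refine (setLIntegral_sq_le (hψm.enorm.pow_const 2).aemeasurable).trans ?_
    refine mul_le_mul' hvol ((setLIntegral_le_lintegral _ _).trans (le_of_eq ?_))
    congr 1; ext t; ring
  · have hsub : Icc (0 : ℝ) 1 ⊆ (⋃ i ∈ u, Icc (x i + w) (y i - w)) ∪ N := by
      intro t ht
      obtain ⟨i, hi, hti⟩ := mem_iUnion₂.1 (hg.cover ht)
      rcases Icc_subset_near_far _ _ w hti with h | h
      · exact Or.inl (mem_iUnion₂.2 ⟨i, hi, h⟩)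
      · exact Or.inr (mem_iUnion₂.2 ⟨i, hi, h⟩)
    refine (lintegral_mono_set hsub).trans ((lintegral_union_le _ _ _).trans ?_)
    gcongr
    exact setLIntegral_biUnion_finset_le _ _ _

theorem IsH10.zero {ψ g : ℝ → ℂ} (h : IsH10 ψ g) : ψ 0 = 0 := by
  simpa using h.eq_integral 0 (by simp)

theorem IsH10.continuousOn {ψ g : ℝ → ℂ} (h : IsH10 ψ g) : ContinuousOn ψ (Icc 0 1) := by
  have hgi : IntegrableOn g (Icc 0 1) := h.memLp.integrable (by norm_num)
  have := intervalIntegral.continuousOn_primitive_interval (a := (0 : ℝ)) (b := 1)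
    (μ := volume) (f := g) (by rwa [uIcc_of_le zero_le_one])
  rw [uIcc_of_le zero_le_one] at this
  exact this.congr fun x hx => h.eq_integral x hx

theorem IsH10.measurable_indicator {ψ g : ℝ → ℂ} (h : IsH10 ψ g) :
    Measurable ((Icc (0 : ℝ) 1).indicator ψ) := by
  classical
  rw [← Set.piecewise_eq_indicator]
  exact h.continuousOn.measurable_piecewise continuousOn_const measurableSet_Icc

theorem lintegral_indicator_enorm_pow (φ : ℝ → ℂ) {k : ℕ} (hk : k ≠ 0) :
    ∫⁻ t, ‖(Icc (0 : ℝ) 1).indicator φ t‖ₑ ^ k = ∫⁻ t in Icc (0 : ℝ) 1, ‖φ t‖ₑ ^ k := by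
  rw [← lintegral_indicator measurableSet_Icc]
  congr 1
  ext t
  by_cases ht : t ∈ Icc (0 : ℝ) 1
  · simp [indicator_of_mem ht]
  · simp [indicator_of_notMem ht, hk]

theorem setLIntegral_indicator_enorm_pow (φ : ℝ → ℂ) (k : ℕ) :
    ∫⁻ t in Icc (0 : ℝ) 1, ‖(Icc (0 : ℝ) 1).indicator φ t‖ₑ ^ k =
      ∫⁻ t in Icc (0 : ℝ) 1, ‖φ t‖ₑ ^ k :=
  setLIntegral_congr_fun measurableSet_Icc fun t ht => by simp [indicator_of_mem ht]

theorem lintegral_indicator_enorm_sq' (φ : ℝ → ℂ) :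
    ∫⁻ t, ((Icc (0 : ℝ) 1).indicator (fun t => ‖φ t‖ₑ) t) ^ 2 =
      ∫⁻ t in Icc (0 : ℝ) 1, ‖φ t‖ₑ ^ 2 := by
  rw [← lintegral_indicator_enorm_pow φ two_ne_zero]
  congr 1
  ext t
  by_cases ht : t ∈ Icc (0 : ℝ) 1
  · simp [indicator_of_mem ht]
  · simp [indicator_of_notMem ht]

theorem IsH10.indicator_eq_zero {ψ g : ℝ → ℂ} (h : IsH10 ψ g) {t : ℝ} (ht : t ∉ Ioo (0 : ℝ) 1) :
    (Icc (0 : ℝ) 1).indicator ψ t = 0 := by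
  by_cases h' : t ∈ Icc (0 : ℝ) 1
  · rw [indicator_of_mem h']
    rcases eq_or_lt_of_le h'.1 with h0 | h0
    · rw [← h0, h.zero]
    · rcases eq_or_lt_of_le h'.2 with h1 | h1
      · rw [h1, h.right_eq_zero]
      · exact absurd ⟨h0, h1⟩ ht
  · exact indicator_of_notMem h' _

theorem IsH10.aemeasurable_indicator {ψ g : ℝ → ℂ} (h : IsH10 ψ g) :
    AEMeasurable ((Icc (0 : ℝ) 1).indicator fun x => ‖g x‖ₑ) :=
  (aemeasurable_indicator_iff measurableSet_Icc).2 h.memLp.1.enorm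

/-- Comparison of a configuration `S` having soft obstacles with a configuration `S'` having hard
obstacles, if all sufficiently long gaps of `S` fit, when shortened by a factor `ρ`, into disjoint
gaps of `S'`. -/
theorem IsGapFamily.groundEnergy_le {ι : Type*} {S S' : Set ℝ} {u : Finset ι} {x y p : ι → ℝ}
    (hg : IsGapFamily S u x y) {γ w ρ : ℝ} {σ : ℝ≥0∞} (hγ : 0 < γ)
    (hw : 0 < w) (hρ : 0 < ρ) (hρ1 : ρ ≤ 1)
    (hp0 : ∀ i ∈ u, 2 * w ≤ y i - x i → 0 ≤ p i)
    (hp1 : ∀ i ∈ u, 2 * w ≤ y i - x i → p i + ρ * (y i - x i) ≤ 1)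
    (hpdisj : ∀ i ∈ u, ∀ j ∈ u, 2 * w ≤ y i - x i → 2 * w ≤ y j - x j → i ≠ j →
      Disjoint (Ioo (p i) (p i + ρ * (y i - x i))) (Ioo (p j) (p j + ρ * (y j - x j))))
    (hpS : ∀ i ∈ u, 2 * w ≤ y i - x i → Disjoint S' (Ioo (p i) (p i + ρ * (y i - x i))))
    {e : ℝ≥0} (he : e ≠ 0) {m μ : ℝ≥0∞} (hm0 : m ≠ 0) (hm : m + μ ≤ 1)
    (hσ : (1 + (e : ℝ≥0∞)⁻¹) * (8 * (ENNReal.ofReal w)⁻¹) ≤ σ)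
    (hμ : 4 * ENNReal.ofReal w ^ 2 * groundEnergy S' ⊤ γ ≤ μ ∨
      4 * ENNReal.ofReal w * u.card * (groundEnergy S' ⊤ γ / ENNReal.ofReal γ) ≤ μ ^ 2) :
    groundEnergy S' ⊤ γ ≤ (ENNReal.ofReal ρ ^ 2 * m ^ 2)⁻¹ * (1 + e) * groundEnergy S σ γ := by
  classical
  have hm1 : m ≤ 1 := le_self_add.trans hm
  have hmt : m ≠ ⊤ := ne_top_of_le_ne_top ENNReal.one_ne_top hm1
  have hμ1 : μ ≤ 1 := le_add_self.trans hm
  have hμt : μ ≠ ⊤ := ne_top_of_le_ne_top ENNReal.one_ne_top hμ1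
  have hr1 : ENNReal.ofReal ρ ≤ 1 := ENNReal.ofReal_le_one.2 hρ1
  have hC1 : 1 ≤ (ENNReal.ofReal ρ ^ 2 * m ^ 2)⁻¹ * (1 + e) := by
    refine one_le_mul (ENNReal.one_le_inv.2 ?_) le_self_add
    exact mul_le_one' (pow_le_one₀ zero_le hr1) (pow_le_one₀ zero_le hm1)
  have hC0 : (ENNReal.ofReal ρ ^ 2 * m ^ 2)⁻¹ * (1 + e) ≠ 0 := fun h => by simp [h] at hC1
  have hCt : (ENNReal.ofReal ρ ^ 2 * m ^ 2)⁻¹ * (1 + e) ≠ ⊤ := by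
    refine ENNReal.mul_ne_top (ENNReal.inv_ne_top.2 (mul_ne_zero (pow_ne_zero _ ?_)
      (pow_ne_zero _ hm0))) (by simp)
    simpa using hρ
  conv_rhs => rw [groundEnergy]
  rw [ENNReal.mul_iInf_of_ne hC0 hCt]
  refine le_iInf fun ψ => ?_
  rw [ENNReal.mul_iInf_of_ne hC0 hCt]
  refine le_iInf fun g => ?_
  rw [ENNReal.mul_iInf_of_ne hC0 hCt]
  refine le_iInf fun hψ => ?_
  rw [ENNReal.mul_iInf_of_ne hC0 hCt]
  refine le_iInf fun hnorm => ?_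
  -- The claimed factor is at least one, so only trial functions with energy below the hard-obstacle
  -- energy of `S'` matter. For these, an upper bound on that energy becomes an a priori bound on
  -- `ψ`.
  rcases le_or_gt (groundEnergy S' ⊤ γ) (gpEnergy S σ γ ψ g) with hle | hlt
  · refine hle.trans ?_
    rw [← one_mul (gpEnergy S σ γ ψ g), ← mul_assoc, mul_one]
    gcongr
  set φ := (Icc (0 : ℝ) 1).indicator ψ with hφ
  set H := (Icc (0 : ℝ) 1).indicator fun x => ‖g x‖ₑ with hH
  set A := ∫⁻ x in Icc (0 : ℝ) 1, ‖g x‖ₑ ^ 2 with hA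
  set B := ∑' z : ↥(S ∩ Icc (0 : ℝ) 1), ‖ψ z‖ₑ ^ 2 with hB
  set Q := ∫⁻ x in Icc (0 : ℝ) 1, ‖ψ x‖ₑ ^ 4 with hQ
  have hE : gpEnergy S σ γ ψ g = A + σ * B + ENNReal.ofReal (γ / 2) * Q := rfl
  have hA' : ∫⁻ t, H t ^ 2 = A := lintegral_indicator_enorm_sq' g
  have hQ' : ∫⁻ t, ‖φ t‖ₑ ^ 4 = Q := lintegral_indicator_enorm_pow ψ four_ne_zero
  have hB' : ∑' z : ↥(S ∩ Icc (0 : ℝ) 1), ‖φ z‖ₑ ^ 2 = B := by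
    refine tsum_congr fun z => ?_
    rw [hφ, indicator_of_mem z.2.2]
  have hdom : DomBy φ H := hψ.domBy
  have hφ0 : ∀ t, t ∉ Ioo (0 : ℝ) 1 → φ t = 0 := fun t ht => hψ.indicator_eq_zero ht
  have hn : ∫⁻ t in Icc (0 : ℝ) 1, ‖φ t‖ₑ ^ 2 = 1 := by
    rw [hφ, setLIntegral_indicator_enorm_pow, hnorm]
  -- A gap shorter than `2 * w` has no point at distance `w` from both ends, so dropping it loses
  -- none of the far mass.
  set u' := u.filter fun i => 2 * w ≤ y i - x i with hu'
  have hfar : ∑ i ∈ u, ∫⁻ t in Icc (x i + w) (y i - w), ‖φ t‖ₑ ^ 2 =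
      ∑ i ∈ u', ∫⁻ t in Icc (x i + w) (y i - w), ‖φ t‖ₑ ^ 2 := by
    symm
    rw [hu', Finset.sum_filter_of_ne]
    intro i hi hne
    by_contra hc
    apply hne
    rw [Icc_eq_empty (by linarith)]
    simp
  have hw0 : ENNReal.ofReal w ≠ 0 := by simpa using hw
  have hfarm : m ≤ ∑ i ∈ u', ∫⁻ t in Icc (x i + w) (y i - w), ‖φ t‖ₑ ^ 2 := by
    rw [← hfar]
    suffices h : ∃ n ≤ μ, 1 ≤ (∑ i ∈ u, ∫⁻ t in Icc (x i + w) (y i - w), ‖φ t‖ₑ ^ 2) + n by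
      obtain ⟨n, hn1, hn2⟩ := h
      refine (ENNReal.add_le_add_iff_right hμt).1 (hm.trans (hn2.trans ?_))
      gcongr
    rcases hμ with hμ | hμ
    -- Since `σ w ≥ 1`, the boundary sum and the kinetic energy together are at most `4 w²` times
    -- the total energy.
    · refine ⟨_, ?_, hn.ge.trans (hg.mass_le_far_add hdom hψ.aemeasurable_indicator hφ0 w)⟩
      refine le_trans ?_ hμ
      rw [hB', hA']
      have hσ1 : 1 ≤ σ * ENNReal.ofReal w := by
        calc (1 : ℝ≥0∞) ≤ (1 + (e : ℝ≥0∞)⁻¹) * 8 := by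
              exact one_le_mul le_self_add (by norm_num)
          _ = (1 + (e : ℝ≥0∞)⁻¹) * (8 * (ENNReal.ofReal w)⁻¹) * ENNReal.ofReal w := by
              rw [mul_assoc, mul_assoc 8, ENNReal.inv_mul_cancel hw0 ENNReal.ofReal_ne_top, mul_one]
          _ ≤ _ := by gcongr
      calc 4 * ENNReal.ofReal w * B + 4 * ENNReal.ofReal w ^ 2 * A
          ≤ 4 * ENNReal.ofReal w * ((σ * ENNReal.ofReal w) * B) +
              4 * ENNReal.ofReal w ^ 2 * A := by
            gcongr
            calc B = 1 * B := (one_mul _).symm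
              _ ≤ _ := by gcongr
        _ = 4 * ENNReal.ofReal w ^ 2 * (A + σ * B) := by ring
        _ ≤ 4 * ENNReal.ofReal w ^ 2 * gpEnergy S σ γ ψ g := by
            rw [hE]; exact mul_le_mul_right le_self_add _
        _ ≤ _ := by gcongr
    -- Strong interaction: the quartic integral is at most twice the energy divided by `γ`, so
    -- little mass fits into the small total length near the gap ends.
    · obtain ⟨n, hn1, hn2⟩ := hg.mass_le_far_add' hψ.measurable_indicator w
      refine ⟨n, ?_, hn.ge.trans hn2⟩
      refine (ENNReal.pow_le_pow_left_iff two_ne_zero).1 (le_trans ?_ hμ)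
      refine hn1.trans ?_
      rw [hQ']
      have hγ0 : ENNReal.ofReal γ ≠ 0 := by simpa using hγ
      have hQle : Q ≤ 2 * (groundEnergy S' ⊤ γ / ENNReal.ofReal γ) := by
        rw [← mul_div_assoc, ENNReal.le_div_iff_mul_le (Or.inl hγ0)
          (Or.inl ENNReal.ofReal_ne_top)]
        calc Q * ENNReal.ofReal γ = 2 * (ENNReal.ofReal (γ / 2) * Q) := by
              rw [← mul_assoc, ← ENNReal.ofReal_ofNat, ← ENNReal.ofReal_mul (by norm_num),
                mul_div_cancel₀ _ two_ne_zero, mul_comm]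
          _ ≤ 2 * gpEnergy S σ γ ψ g := by rw [hE]; gcongr; exact le_add_self
          _ ≤ _ := by gcongr
      calc _ ≤ 2 * ENNReal.ofReal w * u.card * (2 * (groundEnergy S' ⊤ γ / ENNReal.ofReal γ)) := by
            gcongr
        _ = _ := by ring
  have hmemu : ∀ i ∈ u', i ∈ u ∧ 2 * w ≤ y i - x i := fun i hi => Finset.mem_filter.1 hi
  have hfin := groundEnergy_le_transplant (S := S') (γ := γ) hdom hψ.aemeasurable_indicator
    hψ.measurable_indicator u' x y p hw hρ hρ1 (fun i hi => hg.le i (hmemu i hi).1)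
    (fun i hi j hj => hg.disjoint i (hmemu i hi).1 j (hmemu j hj).1)
    (fun i hi => hp0 i (hmemu i hi).1 (hmemu i hi).2)
    (fun i hi => hp1 i (hmemu i hi).1 (hmemu i hi).2)
    (fun i hi j hj => hpdisj i (hmemu i hi).1 j (hmemu j hj).1 (hmemu i hi).2 (hmemu j hj).2)
    (fun i hi => hpS i (hmemu i hi).1 (hmemu i hi).2) he hm0 hm1 hfarm
  refine hfin.trans ?_
  rw [hE, hA', hQ']
  refine le_trans (mul_le_mul_right ?_ _) (le_of_eq (mul_assoc _ _ _).symm)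
  have hF : ∀ t, t ∉ Ioo (0 : ℝ) 1 → ‖φ t‖ₑ ^ 2 = 0 := fun t ht => by simp [hφ0 t ht]
  have hBsum : ∑ i ∈ u', (‖φ (x i)‖ₑ ^ 2 + ‖φ (y i)‖ₑ ^ 2) ≤ 2 * B := by
    rw [Finset.sum_add_distrib, two_mul, ← hB']
    refine add_le_add ?_ ?_
    · exact (Finset.sum_le_sum_of_subset (Finset.filter_subset _ _)).trans
        (sum_le_tsum_obstacles hg.injOn_left hg.left_mem _ hF)
    · exact (Finset.sum_le_sum_of_subset (Finset.filter_subset _ _)).trans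
        (sum_le_tsum_obstacles hg.injOn_right hg.right_mem _ hF)
  rw [mul_add, mul_add]
  refine add_le_add (add_le_add le_rfl ?_) ?_
  -- The hypothesis `hσ` enters here: an obstacle ends at most two gaps, once on the left and once
  -- on the right, and its energy covers both cut-offs.
  · calc _ ≤ (1 + (e : ℝ≥0∞)⁻¹) * (4 * (ENNReal.ofReal w)⁻¹ * (2 * B)) := by gcongr
      _ = (1 + (e : ℝ≥0∞)⁻¹) * (8 * (ENNReal.ofReal w)⁻¹) * B := by ring
      _ ≤ σ * B := by gcongr
      _ ≤ (1 + e) * (σ * B) := by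
          conv_lhs => rw [← one_mul (σ * B)]
          gcongr; exact le_self_add
  · conv_lhs => rw [← one_mul (ENNReal.ofReal (γ / 2) * Q)]
    gcongr; exact le_self_add

/-- If all gaps are short, the kinetic energy is large. -/
theorem IsGapFamily.le_groundEnergy {ι : Type*} {S : Set ℝ} {u : Finset ι} {x y : ι → ℝ}
    (hg : IsGapFamily S u x y) {γ w : ℝ} (hw : 0 < w) (hlen : ∀ i ∈ u, y i - x i < 2 * w) :
    (4 * ENNReal.ofReal w ^ 2)⁻¹ ≤ groundEnergy S ⊤ γ := by
  refine le_iInf fun ψ => le_iInf fun g => le_iInf fun hψ => le_iInf fun hnorm => ?_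
  unfold gpEnergy
  set A := ∫⁻ x in Icc (0 : ℝ) 1, ‖g x‖ₑ ^ 2 with hA
  set B := ∑' z : ↥(S ∩ Icc (0 : ℝ) 1), ‖ψ z‖ₑ ^ 2 with hB
  by_cases hB0 : B = 0
  swap
  · rw [ENNReal.top_mul hB0]; simp
  refine le_trans ?_ (le_self_add.trans le_self_add)
  have h := hg.mass_le_far_add hψ.domBy hψ.aemeasurable_indicator
    (fun t ht => hψ.indicator_eq_zero ht) w
  have hB' : ∑' z : ↥(S ∩ Icc (0 : ℝ) 1), ‖(Icc (0 : ℝ) 1).indicator ψ z‖ₑ ^ 2 = B := by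
    refine tsum_congr fun z => ?_
    rw [indicator_of_mem z.2.2]
  rw [setLIntegral_indicator_enorm_pow, hnorm, lintegral_indicator_enorm_sq', hB', hB0, mul_zero,
    zero_add, Finset.sum_eq_zero, zero_add, ← hA] at h
  · rw [ENNReal.inv_le_iff_le_mul]
    · exact h
    · intro _; simpa using hw
    · intro h1; simp [h1] at h
      have : (ENNReal.ofReal w) ^ 2 ≠ ⊤ := by simp
      exact absurd h1 (ENNReal.mul_ne_top (by simp) this)
  · intro i hi
    rw [Icc_eq_empty (by linarith [hlen i hi])]
    simp

/-- Cauchy-Schwarz on the unit interval: unit mass forces the quartic integral to be at least one.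
-/
theorem ofReal_half_le_groundEnergy (S : Set ℝ) (γ : ℝ) (σ : ℝ≥0∞) :
    ENNReal.ofReal (γ / 2) ≤ groundEnergy S σ γ := by
  refine le_iInf fun ψ => le_iInf fun g => le_iInf fun hψ => le_iInf fun hnorm => ?_
  refine le_trans ?_ le_add_self
  have h := setLIntegral_sq_le (s := Icc (0 : ℝ) 1) (f := fun x => ‖ψ x‖ₑ ^ 2)
    ((hψ.continuousOn.aestronglyMeasurable measurableSet_Icc).enorm.pow_const 2)
  rw [hnorm, Real.volume_Icc] at h
  simp only [one_pow, sub_zero, ENNReal.ofReal_one, one_mul, ← pow_mul] at h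
  calc ENNReal.ofReal (γ / 2) = ENNReal.ofReal (γ / 2) * 1 := (mul_one _).symm
    _ ≤ _ := by gcongr

theorem groundEnergy_mono (S : Set ℝ) (γ : ℝ) {σ σ' : ℝ≥0∞} (h : σ ≤ σ') :
    groundEnergy S σ γ ≤ groundEnergy S σ' γ := by
  unfold groundEnergy gpEnergy
  gcongr

/-! ### Discretised gaps: runs of empty cells -/

/-- The cell `[jh, (j+1)h)` contains a point of `X`, and the next `n` cells do not. -/
def IsRun (X : Set ℝ) (h : ℝ) (n : ℕ) (j : ℤ) : Prop :=
  (X ∩ Ico (j * h) ((j + 1) * h)).Nonempty ∧ X ∩ Ico ((j + 1) * h) ((j + 1 + n) * h) = ∅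

open Classical in
/-- The positions in `T` at which a run of at least `n` empty cells starts. -/
noncomputable def runs (X : Set ℝ) (h : ℝ) (T : Finset ℤ) (n : ℕ) : Finset ℤ :=
  T.filter (IsRun X h n)

theorem mem_runs {X : Set ℝ} {h : ℝ} {T : Finset ℤ} {n : ℕ} {j : ℤ} :
    j ∈ runs X h T n ↔ j ∈ T ∧ IsRun X h n j := by
  classical
  simp [runs]

theorem IsRun.mono {X : Set ℝ} {h : ℝ} (hh : 0 ≤ h) {m n : ℕ} (hmn : m ≤ n) {j : ℤ}
    (hr : IsRun X h n j) : IsRun X h m j := by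
  refine ⟨hr.1, subset_empty_iff.1 (subset_trans ?_ hr.2.subset)⟩
  have : (m : ℝ) ≤ n := by exact_mod_cast hmn
  gcongr

theorem runs_anti {X : Set ℝ} {h : ℝ} (hh : 0 ≤ h) {T : Finset ℤ} {m n : ℕ} (hmn : m ≤ n) :
    runs X h T n ⊆ runs X h T m := fun _ hj =>
  mem_runs.2 ⟨(mem_runs.1 hj).1, (mem_runs.1 hj).2.mono hh hmn⟩

/-- A run starts at an occupied cell, which cannot be one of the empty cells of an earlier run. This
makes different runs disjoint, both as places for trial functions and as independent events. -/
theorem IsRun.le_of_lt {X : Set ℝ} {h : ℝ} (hh : 0 ≤ h) {m n : ℕ} {j k : ℤ}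
    (hj : IsRun X h m j) (hk : IsRun X h n k) (hjk : j < k) : j + 1 + m ≤ k := by
  by_contra hc
  push Not at hc
  obtain ⟨p, hpX, hp⟩ := hk.1
  have h1 : (j : ℝ) + 1 ≤ k := by exact_mod_cast hjk
  have h2 : (k : ℝ) + 1 ≤ j + 1 + m := by exact_mod_cast hc
  have : p ∈ X ∩ Ico ((j + 1) * h) ((j + 1 + m) * h) :=
    ⟨hpX, (by nlinarith [hp.1] : ((j : ℝ) + 1) * h ≤ p), by nlinarith [hp.2]⟩
  rw [hj.2] at this
  exact this

open Classical in
/-- A point of `X` in the cell `[jh, (j+1)h)`, if there is one. -/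
noncomputable def pick (X : Set ℝ) (h : ℝ) (j : ℤ) : ℝ :=
  if hj : (X ∩ Ico (j * h) ((j + 1) * h)).Nonempty then hj.some else 0

theorem pick_mem {X : Set ℝ} {h : ℝ} {j : ℤ} (hj : (X ∩ Ico (j * h) ((j + 1) * h)).Nonempty) :
    pick X h j ∈ X ∩ Ico (j * h) ((j + 1) * h) := by
  rw [pick, dif_pos hj]
  exact hj.some_mem

open Classical in
/-- The point picked in the next nonempty cell after the cell with number `j`, or the right end
`b * h` if there is none. -/
noncomputable def nextPick (X : Set ℝ) (h : ℝ) (a b j : ℤ) : ℝ :=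
  if hj : ((runs X h (Finset.Ico a b) 0).filter (j < ·)).Nonempty then
    pick X h (((runs X h (Finset.Ico a b) 0).filter (j < ·)).min' hj) else b * h

section Gaps

variable {X : Set ℝ} {h : ℝ} {a b : ℤ}

theorem pick_mem_of_runs {T : Finset ℤ} {n : ℕ} {j : ℤ} (hj : j ∈ runs X h T n) :
    pick X h j ∈ X ∩ Ico (j * h) ((j + 1) * h) := pick_mem (mem_runs.1 hj).2.1

theorem pick_lt_pick (hh : 0 ≤ h) {T : Finset ℤ} {m n : ℕ} {i j : ℤ} (hi : i ∈ runs X h T m)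
    (hj : j ∈ runs X h T n) (hij : i < j) : pick X h i < pick X h j := by
  have h1 := (pick_mem_of_runs hi).2.2
  have h2 := (pick_mem_of_runs hj).2.1
  have h3 : (i : ℝ) + 1 ≤ j := by exact_mod_cast hij
  nlinarith

theorem nextPick_le_pick (hh : 0 ≤ h) {i j : ℤ} (hj : j ∈ runs X h (Finset.Ico a b) 0)
    (hij : i < j) : nextPick X h a b i ≤ pick X h j := by
  classical
  have hmem : j ∈ (runs X h (Finset.Ico a b) 0).filter (i < ·) := Finset.mem_filter.2 ⟨hj, hij⟩
  have hne : ((runs X h (Finset.Ico a b) 0).filter (i < ·)).Nonempty := ⟨j, hmem⟩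
  rw [nextPick, dif_pos hne]
  have h1 := Finset.min'_le _ _ hmem
  have h2 := Finset.min'_mem _ hne
  rcases h1.lt_or_eq with h3 | h3
  · exact (pick_lt_pick hh (Finset.mem_filter.1 h2).1 hj h3).le
  · rw [h3]

theorem nextPick_cases (X : Set ℝ) (h : ℝ) (a b i : ℤ) :
    (∃ j ∈ runs X h (Finset.Ico a b) 0, i < j ∧ nextPick X h a b i = pick X h j) ∨
      nextPick X h a b i = b * h := by
  classical
  by_cases hne : ((runs X h (Finset.Ico a b) 0).filter (i < ·)).Nonempty
  · have h2 := Finset.mem_filter.1 (Finset.min'_mem _ hne)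
    exact Or.inl ⟨_, h2.1, h2.2, by rw [nextPick, dif_pos hne]⟩
  · exact Or.inr (by rw [nextPick, dif_neg hne])

theorem pick_lt_nextPick (hh : 0 ≤ h) {i : ℤ} (hi : i ∈ runs X h (Finset.Ico a b) 0) :
    pick X h i < nextPick X h a b i := by
  rcases nextPick_cases X h a b i with ⟨j, hj, hij, e⟩ | e
  · rw [e]; exact pick_lt_pick hh hi hj hij
  · rw [e]
    have h1 := (pick_mem_of_runs hi).2.2
    have h2 : (i : ℝ) + 1 ≤ b := by exact_mod_cast (Finset.mem_Ico.1 (mem_runs.1 hi).1).2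
    nlinarith

theorem nextPick_le (hh : 0 ≤ h) (i : ℤ) : nextPick X h a b i ≤ b * h := by
  rcases nextPick_cases X h a b i with ⟨j, hj, hij, e⟩ | e
  · rw [e]
    have h1 := (pick_mem_of_runs hj).2.2
    have h2 : (j : ℝ) + 1 ≤ b := by exact_mod_cast (Finset.mem_Ico.1 (mem_runs.1 hj).1).2
    nlinarith
  · rw [e]

/-- A point in one of the next `n` cells would make that cell occupied, and its picked point would
lie within `(n + 1) * h` of `pick X h i`. The extra `h` accounts for the unknown position of that
point in cell `i`. -/
theorem isRun_of_lt_nextPick_sub_pick (hh : 0 < h) {i : ℤ} (hi : i ∈ runs X h (Finset.Ico a b) 0)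
    {n : ℕ} (hn : (n + 1) * h < nextPick X h a b i - pick X h i) :
    i ∈ runs X h (Finset.Ico a b) n := by
  refine mem_runs.2 ⟨(mem_runs.1 hi).1, (mem_runs.1 hi).2.1, ?_⟩
  rw [eq_empty_iff_forall_notMem]
  rintro p ⟨hpX, hp1, hp2⟩
  have hpi := pick_mem_of_runs hi
  set k := ⌊p / h⌋ with hk
  have hk1 : (k : ℝ) * h ≤ p := by
    have := Int.floor_le (p / h)
    rwa [le_div_iff₀ hh] at this
  have hk2 : p < (k + 1) * h := by
    have := Int.lt_floor_add_one (p / h)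
    rwa [div_lt_iff₀ hh] at this
  have hik : i < k := by
    have : ((i : ℝ) + 1) * h < (k + 1) * h := hp1.trans_lt hk2
    have := lt_of_mul_lt_mul_right this hh.le
    have : (i : ℝ) < k := by linarith
    exact_mod_cast this
  have hkn : k < i + 1 + n := by
    have : (k : ℝ) * h < (i + 1 + n) * h := hk1.trans_lt hp2
    have := lt_of_mul_lt_mul_right this hh.le
    exact_mod_cast this
  have hkb : k < b := by
    have h1 := nextPick_le (X := X) (a := a) (b := b) hh.le i
    have h2 := hpi.2.1
    have h3 : ((i : ℝ) + (n + 1)) * h < b * h := by nlinarith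
    have h4 := lt_of_mul_lt_mul_right h3 hh.le
    have h5 : i + (n + 1) < b := by exact_mod_cast h4
    linarith
  have hka : a ≤ k := (Finset.mem_Ico.1 (mem_runs.1 hi).1).1.trans hik.le
  have hkr : k ∈ runs X h (Finset.Ico a b) 0 :=
    mem_runs.2 ⟨Finset.mem_Ico.2 ⟨hka, hkb⟩, ⟨p, hpX, hk1, hk2⟩, by simp⟩
  have h1 := nextPick_le_pick hh.le hkr hik
  have h2 := (pick_mem_of_runs hkr).2.2
  have h3 := hpi.2.1
  have h4 : (k : ℝ) + 1 ≤ i + 1 + n := by exact_mod_cast hkn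
  nlinarith

/-- One point per occupied cell suffices as a gap end; the other points may lie inside these gaps.
The cell `j₀` lies to the left of the sample, and the default right end `b * h` is not in its
interior, so coverage is complete and no boundary term arises outside the sample. -/
theorem isGapFamily_picks (hh : 0 < h) {α ν : ℝ} (hν : 0 < ν) {j₀ : ℤ}
    (hj₀ : j₀ ∈ runs X h (Finset.Ico a b) 0) (hleft : (j₀ + 1) * h ≤ -(α * ν))
    (hright : (1 - α) * ν ≤ b * h) :
    IsGapFamily (rescale X α ν) (runs X h (Finset.Ico a b) 0)
      (fun i => α + pick X h i / ν) (fun i => α + nextPick X h a b i / ν) := by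
  have hscale : ∀ z, ν * (α + z / ν - α) = z := fun z => by field_simp; ring
  have hdis : ∀ i ∈ runs X h (Finset.Ico a b) 0, ∀ j ∈ runs X h (Finset.Ico a b) 0, i < j →
      α + nextPick X h a b i / ν ≤ α + pick X h j / ν := by
    intro i hi j hj hij
    have := nextPick_le_pick hh.le hj hij
    gcongr
  have hlt : ∀ i ∈ runs X h (Finset.Ico a b) 0,
      α + pick X h i / ν < α + nextPick X h a b i / ν := by
    intro i hi
    have := pick_lt_nextPick hh.le hi
    gcongr
  have hmem : ∀ i ∈ runs X h (Finset.Ico a b) 0, α + pick X h i / ν ∈ rescale X α ν := by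
    intro i hi
    rw [rescale, mem_ofPred_eq, hscale]
    exact (pick_mem_of_runs hi).1
  refine ⟨fun i hi => (hlt i hi).le, ?_, ?_, ?_, ?_, fun i hi => Or.inl (hmem i hi), ?_⟩
  · intro i hi j hj hij
    rw [disjoint_left]
    intro t hti htj
    rcases lt_or_gt_of_ne hij with h1 | h1
    · linarith [hdis i hi j hj h1, hti.2, htj.1]
    · linarith [hdis j hj i hi h1, htj.2, hti.1]
  · intro t ht
    set τ := ν * (t - α) with hτ
    have hτt : t = α + τ / ν := by rw [hτ]; field_simp; ring
    have hτ1 : -(α * ν) ≤ τ := by rw [hτ]; nlinarith [ht.1]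
    have hτ2 : τ ≤ (1 - α) * ν := by rw [hτ]; nlinarith [ht.2]
    classical
    set L := (runs X h (Finset.Ico a b) 0).filter fun i => pick X h i ≤ τ with hL
    have hne : L.Nonempty := ⟨j₀, Finset.mem_filter.2 ⟨hj₀,
      ((pick_mem_of_runs hj₀).2.2.le.trans hleft).trans hτ1⟩⟩
    have hm := Finset.mem_filter.1 (L.max'_mem hne)
    refine mem_iUnion₂.2 ⟨L.max' hne, hm.1, ?_, ?_⟩
    · rw [hτt]
      have := hm.2
      gcongr
    · rw [hτt]
      gcongr
      rcases nextPick_cases X h a b (L.max' hne) with ⟨j, hj, hij, e⟩ | e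
      · rw [e]
        by_contra hc
        exact absurd (L.le_max' j (Finset.mem_filter.2 ⟨hj, (not_le.1 hc).le⟩)) (not_le.2 hij)
      · rw [e]; linarith
  · intro i hi j hj hij
    by_contra hne
    rcases lt_or_gt_of_ne hne with h1 | h1
    · linarith [hdis i hi j hj h1, hlt i hi, hij.le, hij.ge]
    · linarith [hdis j hj i hi h1, hlt j hj, hij.le, hij.ge]
  · intro i hi j hj hij
    by_contra hne
    rcases lt_or_gt_of_ne hne with h1 | h1
    · linarith [hdis i hi j hj h1, hlt j hj, hij.le, hij.ge]
    · linarith [hdis j hj i hi h1, hlt i hi, hij.le, hij.ge]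
  · intro i hi
    rcases nextPick_cases X h a b i with ⟨j, hj, hij, e⟩ | e
    · simp only [e]; exact Or.inl (hmem j hj)
    · right
      simp only [e]
      rintro ⟨_, h2⟩
      have : (1 - α) ≤ b * h / ν := by rwa [le_div_iff₀ hν]
      linarith

end Gaps

/-! ### Matching the gaps of two configurations -/

/-- Hall's marriage theorem. In any set of indices take one with the smallest `n`: the candidates of
this index alone are as many as all indices with at least this `n`, hence as many as the set. Only
counting by length is needed. -/
theorem exists_injective_matching (u : Finset ℤ) (n : ℤ → ℕ) (R : ℕ → Finset ℤ)
    (f : ℕ → ℕ) (hcard : ∀ i ∈ u, (u.filter fun k => n i ≤ n k).card ≤ (R (f (n i))).card) :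
    ∃ φ : ℤ → ℤ, InjOn φ u ∧ ∀ i ∈ u, φ i ∈ R (f (n i)) := by
  classical
  have := (Finset.all_card_le_biUnion_card_iff_exists_injective
    (fun i : u => R (f (n i)))).1 ?_
  · obtain ⟨g, hg, hgR⟩ := this
    refine ⟨fun i => if hi : i ∈ u then g ⟨i, hi⟩ else 0, ?_, ?_⟩
    · intro i hi j hj hij
      simp only [Finset.mem_coe] at hi hj
      simp only [dif_pos hi, dif_pos hj] at hij
      simpa using hg hij
    · intro i hi
      simp only [dif_pos hi]
      exact hgR ⟨i, hi⟩
  · intro s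
    rcases s.eq_empty_or_nonempty with rfl | hs
    · simp
    obtain ⟨i, his, hmin⟩ := s.exists_min_image (fun k => n k) hs
    calc s.card = (s.map ⟨Subtype.val, Subtype.val_injective⟩).card := (Finset.card_map _).symm
      _ ≤ (u.filter fun k => n i ≤ n k).card := by
          refine Finset.card_le_card fun k hk => ?_
          obtain ⟨k', hk', rfl⟩ := Finset.mem_map.1 hk
          exact Finset.mem_filter.2 ⟨k'.2, hmin k' hk'⟩
      _ ≤ (R (f (n i))).card := hcard i i.2
      _ ≤ _ := Finset.card_le_card (Finset.subset_biUnion_of_mem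
          (fun i : u => R (f (n i))) his)

/-- This fixes the contraction factor: a gap of length up to `(n + 2) h` must fit into `n - n / n₀`
empty cells for all `n ≥ n₀`. Equality holds at `n = n₀`. -/
theorem shrink_mul_le {n₀ n : ℕ} (hn₀ : 2 ≤ n₀) (hn : n₀ ≤ n) :
    ((n₀ : ℝ) - 1) / (n₀ + 2) * (n + 2) ≤ ((n - n / n₀ : ℕ) : ℝ) := by
  have h1 : n / n₀ ≤ n := Nat.div_le_self _ _
  rw [Nat.cast_sub h1]
  have h2 : ((n / n₀ : ℕ) : ℝ) ≤ n / n₀ := Nat.cast_div_le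
  have h3 : (2 : ℝ) ≤ n₀ := by exact_mod_cast hn₀
  have h4 : (n₀ : ℝ) ≤ n := by exact_mod_cast hn
  refine le_trans ?_ (sub_le_sub_left h2 _)
  rw [div_mul_eq_mul_div, div_le_iff₀ (by positivity)]
  have h5 : ((n : ℝ) - n / n₀) * (n₀ + 2) - (n₀ - 1) * (n + 2) =
      2 * (n₀ - 1) * (n - n₀) / n₀ := by field_simp; ring
  have : 0 ≤ 2 * ((n₀ : ℝ) - 1) * (n - n₀) / n₀ :=
    div_nonneg (mul_nonneg (by linarith) (by linarith)) (by linarith)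
  linarith

/-- If the long runs of `X` are not more numerous than the slightly shorter runs of `X'`, the
energy of `X'` is not much larger than that of `X`. -/
theorem groundEnergy_rescale_le {X X' : Set ℝ} {h α ν γ w : ℝ} {a b a' b' j₀ : ℤ} {n₀ D : ℕ}
    {σ : ℝ≥0∞} (hh : 0 < h) (hν : 0 < ν) (hγ : 0 < γ) (hn₀ : 2 ≤ n₀)
    (hj₀ : j₀ ∈ runs X h (Finset.Ico a b) 0) (hleft : (j₀ + 1) * h ≤ -(α * ν))
    (hright : (1 - α) * ν ≤ b * h)
    (hleft' : -(α * ν) ≤ a' * h) (hright' : (b' + D) * h ≤ (1 - α) * ν)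
    (hcard : ∀ n, n₀ ≤ n → (runs X h (Finset.Ico a b) n).card ≤
      (runs X' h (Finset.Ico a' b') (n - n / n₀)).card)
    (hD : ∀ n, n₀ ≤ n → (runs X h (Finset.Ico a b) n).Nonempty → n ≤ D)
    (hw : (n₀ + 2) * h ≤ 2 * w * ν)
    {e : ℝ≥0} (he : e ≠ 0) {m μ : ℝ≥0∞} (hm0 : m ≠ 0) (hm : m + μ ≤ 1)
    (hσ : (1 + (e : ℝ≥0∞)⁻¹) * (8 * (ENNReal.ofReal w)⁻¹) ≤ σ)
    (hμ : 4 * ENNReal.ofReal w ^ 2 * groundEnergy (rescale X' α ν) ⊤ γ ≤ μ ∨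
      4 * ENNReal.ofReal w * (runs X h (Finset.Ico a b) 0).card *
        (groundEnergy (rescale X' α ν) ⊤ γ / ENNReal.ofReal γ) ≤ μ ^ 2) :
    groundEnergy (rescale X' α ν) ⊤ γ ≤
      (ENNReal.ofReal (((n₀ : ℝ) - 1) / (n₀ + 2)) ^ 2 * m ^ 2)⁻¹ * (1 + e) *
        groundEnergy (rescale X α ν) σ γ := by
  classical
  have hn₀' : (2 : ℝ) ≤ n₀ := by exact_mod_cast hn₀
  have hwpos : 0 < w := by
    have : 0 < 2 * w * ν := lt_of_lt_of_le (by positivity) hw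
    have := (mul_pos_iff_of_pos_right hν).1 this
    linarith
  set ρ : ℝ := ((n₀ : ℝ) - 1) / (n₀ + 2) with hρ
  have hρ0 : 0 < ρ := div_pos (by linarith) (by linarith)
  have hρ1 : ρ ≤ 1 := by rw [hρ, div_le_one (by linarith)]; linarith
  have hg := isGapFamily_picks (X := X) hh hν hj₀ hleft hright
  set u := runs X h (Finset.Ico a b) 0 with hu
  set len : ℤ → ℝ := fun i => nextPick X h a b i - pick X h i with hlen
  have hlen' : ∀ i, α + nextPick X h a b i / ν - (α + pick X h i / ν) = len i / ν := fun i => by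
    simp only [len]; ring
  -- For a kept gap this is the largest `n` with `(n + 1) * h < len i`, the condition that yields a
  -- run of `n` empty cells; it also gives `len i ≤ (N i + 2) * h`.
  set N : ℤ → ℕ := fun i => ⌈len i / h⌉₊ - 2 with hN
  set u' := u.filter fun i => 2 * w ≤ len i / ν with hu'
  have hkept : ∀ i ∈ u', n₀ ≤ N i ∧ ((N i : ℝ) + 1) * h < len i ∧ len i ≤ (N i + 2) * h := by
    intro i hi
    have h1 := (Finset.mem_filter.1 hi).2
    rw [le_div_iff₀ hν] at h1
    have h2 : (n₀ : ℝ) + 2 ≤ len i / h := by rw [le_div_iff₀ hh]; linarith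
    have h3 : n₀ + 2 ≤ ⌈len i / h⌉₊ := by
      have : ((n₀ + 2 : ℕ) : ℝ) ≤ ⌈len i / h⌉₊ := by
        push_cast
        exact h2.trans (Nat.le_ceil _)
      exact_mod_cast this
    have h4 : ((N i : ℕ) : ℝ) = ⌈len i / h⌉₊ - 2 := by
      simp only [N]
      rw [Nat.cast_sub (by omega)]
      norm_num
    refine ⟨by simp only [N]; omega, ?_, ?_⟩
    · have h5 : (⌈len i / h⌉₊ : ℝ) < len i / h + 1 := Nat.ceil_lt_add_one (by linarith)
      rw [← lt_div_iff₀ hh, h4]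
      linarith
    · rw [← div_le_iff₀ hh, h4]
      linarith [Nat.le_ceil (len i / h)]
  have hrun : ∀ i ∈ u', ∀ n ≤ N i, i ∈ runs X h (Finset.Ico a b) n := by
    intro i hi n hn
    have h1 := hkept i hi
    exact runs_anti hh.le hn
      (isRun_of_lt_nextPick_sub_pick hh (Finset.mem_filter.1 hi).1 h1.2.1)
  -- The gaps at least as long as gap `i` all start runs of `N i` cells in `X`, and `hcard` bounds
  -- their number by that of the shortened runs in `X'`.
  obtain ⟨φ, hφinj, hφ⟩ := exists_injective_matching u' N
    (fun n => runs X' h (Finset.Ico a' b') n) (fun n => n - n / n₀) (fun i hi => by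
      refine le_trans (Finset.card_le_card fun k hk => ?_) (hcard (N i) (hkept i hi).1)
      have hk' := Finset.mem_filter.1 hk
      exact hrun k hk'.1 _ hk'.2)
  set A : ℤ → ℕ := fun i => N i - N i / n₀ with hA
  set p : ℤ → ℝ := fun i => α + (φ i + 1) * h / ν with hp
  have hmemu' : ∀ i ∈ u, 2 * w ≤ α + nextPick X h a b i / ν - (α + pick X h i / ν) → i ∈ u' := by
    intro i hi h1
    rw [hlen'] at h1
    exact Finset.mem_filter.2 ⟨hi, h1⟩
  have hend : ∀ i ∈ u', p i + ρ * (len i / ν) ≤ α + (φ i + 1 + A i) * h / ν := by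
    intro i hi
    have h1 := hkept i hi
    have h2 := shrink_mul_le hn₀ h1.1
    have h3 : ρ * len i ≤ A i * h := by
      calc ρ * len i ≤ ρ * ((N i + 2) * h) := by gcongr; exact h1.2.2
        _ = ρ * (N i + 2) * h := by ring
        _ ≤ A i * h := by gcongr
    have h4 : ρ * (len i / ν) ≤ A i * h / ν := by
      rw [← mul_div_assoc]; gcongr
    have h5 : α + (φ i + 1 + A i) * h / ν = p i + A i * h / ν := by simp only [p]; ring
    rw [h5]; linarith
  have hφT : ∀ i ∈ u', a' ≤ φ i ∧ φ i < b' := fun i hi =>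
    Finset.mem_Ico.1 (mem_runs.1 (hφ i hi)).1
  have hφR : ∀ i ∈ u', IsRun X' h (A i) (φ i) := fun i hi => (mem_runs.1 (hφ i hi)).2
  have hsep : ∀ i ∈ u', ∀ j ∈ u', φ i < φ j → p i + ρ * (len i / ν) ≤ p j := by
    intro i hi j hj hij
    refine (hend i hi).trans ?_
    have h1 := (hφR i hi).le_of_lt hh.le (hφR j hj) hij
    have h2 : (φ i : ℝ) + 1 + A i ≤ φ j := by exact_mod_cast h1
    refine add_le_add_right (div_le_div_of_nonneg_right ?_ hν.le) _
    exact mul_le_mul_of_nonneg_right (by linarith) hh.le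
  refine hg.groundEnergy_le (p := p) hγ hwpos hρ0 hρ1 ?_ ?_ ?_ ?_ he hm0 hm hσ hμ
  · intro i hi hk
    have h1 : (a' : ℝ) ≤ φ i := by exact_mod_cast (hφT i (hmemu' i hi hk)).1
    have h2 : -(α * ν) ≤ (φ i + 1) * h := by nlinarith
    have h3 : -α ≤ (φ i + 1) * h / ν := by rw [le_div_iff₀ hν]; linarith
    simp only [p]; linarith
  · intro i hi hk
    have hi' := hmemu' i hi hk
    rw [hlen']
    refine (hend i hi').trans ?_
    have h1 : (φ i : ℝ) + 1 ≤ b' := by exact_mod_cast (hφT i hi').2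
    have h2 : N i ≤ D := hD _ (hkept i hi').1 ⟨i, hrun i hi' _ le_rfl⟩
    have h3 : (A i : ℝ) ≤ D := by exact_mod_cast (Nat.sub_le _ _).trans h2
    have h4 : (φ i + 1 + A i) * h / ν ≤ 1 - α := by
      rw [div_le_iff₀ hν]
      refine le_trans ?_ hright'
      gcongr
    linarith
  · intro i hi j hj hki hkj hij
    have hi' := hmemu' i hi hki
    have hj' := hmemu' j hj hkj
    rw [hlen', hlen', disjoint_left]
    intro t hti htj
    rcases lt_or_gt_of_ne (fun h1 => hij (hφinj hi' hj' h1)) with h1 | h1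
    · linarith [hsep i hi' j hj' h1, hti.2, htj.1]
    · linarith [hsep j hj' i hi' h1, htj.2, hti.1]
  · intro i hi hk
    have hi' := hmemu' i hi hk
    rw [hlen', disjoint_left]
    intro z hz hzI
    have h1 : z < α + (φ i + 1 + A i) * h / ν := hzI.2.trans_le (hend i hi')
    have h2 : α + (φ i + 1) * h / ν < z := hzI.1
    have h3 : (φ i + 1) * h < ν * (z - α) := by
      have : (φ i + 1) * h / ν < z - α := by linarith
      rw [div_lt_iff₀ hν] at this
      linarith
    have h4 : ν * (z - α) < (φ i + 1 + A i) * h := by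
      have : z - α < (φ i + 1 + A i) * h / ν := by linarith
      rw [lt_div_iff₀ hν] at this
      linarith
    have : ν * (z - α) ∈ X' ∩ Ico ((φ i + 1) * h) ((φ i + 1 + A i) * h) := ⟨hz, h3.le, h4⟩
    rw [(hφR i hi').2] at this
    exact this

/-- Without runs of `n` cells, every gap is shorter than `(n + 2) h / ν`, and functions vanishing at
the gap ends have a kinetic energy of at least the inverse square of this length. -/
theorem le_groundEnergy_rescale {X : Set ℝ} {h α ν γ : ℝ} {a b j₀ : ℤ} {n : ℕ} (hh : 0 < h)
    (hν : 0 < ν) (hj₀ : j₀ ∈ runs X h (Finset.Ico a b) 0) (hleft : (j₀ + 1) * h ≤ -(α * ν))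
    (hright : (1 - α) * ν ≤ b * h) (hn : runs X h (Finset.Ico a b) n = ∅) :
    ENNReal.ofReal ((ν / ((n + 2) * h)) ^ 2) ≤ groundEnergy (rescale X α ν) ⊤ γ := by
  have hg := isGapFamily_picks (X := X) hh hν hj₀ hleft hright
  have hw : 0 < (n + 2) * h / (2 * ν) := by positivity
  refine le_trans (le_of_eq ?_) (hg.le_groundEnergy (γ := γ) hw ?_)
  · rw [← ENNReal.ofReal_pow hw.le, ← ENNReal.ofReal_ofNat, ← ENNReal.ofReal_mul (by norm_num),
      ← ENNReal.ofReal_inv_of_pos (by positivity)]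
    congr 1
    field_simp
    norm_num
  · intro i hi
    by_contra hc
    push Not at hc
    have h1 : 2 * ((n + 2) * h / (2 * ν)) = (n + 2) * h / ν := by field_simp
    have h2 : α + nextPick X h a b i / ν - (α + pick X h i / ν) =
      (nextPick X h a b i - pick X h i) / ν := by ring
    rw [h1, h2, div_le_div_iff_of_pos_right hν] at hc
    have := isRun_of_lt_nextPick_sub_pick hh hi (n := n) (by linarith)
    rw [hn] at this
    simp at this

/-- One tent of half-width `n h / (2 ν)` is placed in the middle of each run. The `D` spare cells at
the right keep a run that starts at the last position inside the sample. -/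
theorem groundEnergy_rescale_le_runs {X : Set ℝ} {h α ν γ : ℝ} {a b : ℤ} {n D : ℕ} (hh : 0 < h)
    (hν : 0 < ν) (hleft : -(α * ν) ≤ a * h) (hright : (b + D) * h ≤ (1 - α) * ν)
    (hn : 0 < n) (hnD : n ≤ D) (hne : (runs X h (Finset.Ico a b) n).Nonempty) :
    groundEnergy (rescale X α ν) ⊤ γ ≤ ENNReal.ofReal (8 / (n * h / (2 * ν)) ^ 2) +
      ENNReal.ofReal (γ / 2) *
        ENNReal.ofReal (32 / ((runs X h (Finset.Ico a b) n).card * (n * h / (2 * ν)))) := by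
  have hn' : (0 : ℝ) < n := by exact_mod_cast hn
  have hlo : ∀ j : ℤ, α + (j + 1 + n / 2) * h / ν - n * h / (2 * ν) = α + (j + 1) * h / ν :=
    fun j => by field_simp; ring
  have hhi : ∀ j : ℤ, α + (j + 1 + n / 2) * h / ν + n * h / (2 * ν) = α + (j + 1 + n) * h / ν :=
    fun j => by field_simp; ring
  refine groundEnergy_le_tents (by positivity) _ hne
    (fun j : ℤ => α + (j + 1 + n / 2) * h / ν) ?_ ?_ ?_ ?_
  · intro j hj
    rw [hlo]
    have h1 : (a : ℝ) ≤ j := by exact_mod_cast (Finset.mem_Ico.1 (mem_runs.1 hj).1).1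
    have h2 : -(α * ν) ≤ (j + 1) * h := by nlinarith
    have h3 : -α ≤ (j + 1) * h / ν := by rw [le_div_iff₀ hν]; linarith
    linarith
  · intro j hj
    rw [hhi]
    have h1 : (j : ℝ) + 1 ≤ b := by exact_mod_cast (Finset.mem_Ico.1 (mem_runs.1 hj).1).2
    have h2 : (n : ℝ) ≤ D := by exact_mod_cast hnD
    have h4 : (j + 1 + n) * h / ν ≤ 1 - α := by
      rw [div_le_iff₀ hν]
      refine le_trans ?_ hright
      gcongr
    linarith
  · have key : ∀ i ∈ runs X h (Finset.Ico a b) n, ∀ j ∈ runs X h (Finset.Ico a b) n, i < j →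
        α + (i + 1 + n) * h / ν ≤ α + (j + 1) * h / ν := by
      intro i hi j hj hij
      have h1 := (mem_runs.1 hi).2.le_of_lt hh.le (mem_runs.1 hj).2 hij
      have h2 : (i : ℝ) + 1 + n ≤ j := by exact_mod_cast h1
      refine add_le_add_right (div_le_div_of_nonneg_right ?_ hν.le) _
      exact mul_le_mul_of_nonneg_right (by linarith) hh.le
    intro i hi j hj hij
    rw [hlo, hlo, hhi, hhi, disjoint_left]
    intro t hti htj
    rcases lt_or_gt_of_ne hij with h1 | h1
    · linarith [key i hi j hj h1, hti.2, htj.1]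
    · linarith [key j hj i hi h1, htj.2, hti.1]
  · intro j hj
    rw [hlo, hhi, disjoint_left]
    intro z hz hzI
    have h3 : (j + 1) * h < ν * (z - α) := by
      have : (j + 1) * h / ν < z - α := by linarith [hzI.1]
      rw [div_lt_iff₀ hν] at this
      linarith
    have h4 : ν * (z - α) < (j + 1 + n) * h := by
      have : z - α < (j + 1 + n) * h / ν := by linarith [hzI.2]
      rw [lt_div_iff₀ hν] at this
      linarith
    have : ν * (z - α) ∈ X ∩ Ico ((j + 1) * h) ((j + 1 + n) * h) := ⟨hz, h3.le, h4⟩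
    rw [(mem_runs.1 hj).2.2] at this
    exact this

theorem card_runs_zero_le (X : Set ℝ) {h : ℝ} (hh : 0 < h) (a b : ℤ) :
    ((runs X h (Finset.Ico a b) 0).card : ℕ∞) ≤ (X ∩ Ico (a * h) (b * h)).encard := by
  rw [← Set.encard_coe_eq_coe_finsetCard]
  refine Set.encard_le_encard_of_injOn (f := pick X h) (fun j hj => ?_) (fun i hi j hj hij => ?_)
  · have h1 := pick_mem_of_runs hj
    have h2 := Finset.mem_Ico.1 (mem_runs.1 hj).1
    have h3 : (a : ℝ) ≤ j := by exact_mod_cast h2.1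
    have h4 : (j : ℝ) + 1 ≤ b := by exact_mod_cast h2.2
    exact ⟨h1.1, by nlinarith [h1.2.1], by nlinarith [h1.2.2]⟩
  · by_contra hne
    rcases lt_or_gt_of_ne hne with h1 | h1
    · exact absurd hij (pick_lt_pick hh.le hi hj h1).ne
    · exact absurd hij (pick_lt_pick hh.le hj hi h1).ne'

/-! ### Poisson counts, exponential moments and run probabilities -/

section Poisson

variable {Ω : Type*} [MeasurableSpace Ω] {P : Measure Ω} {Z : Ω → Set ℝ}

theorem IsPoissonProcess.lintegral_count (hZ : IsPoissonProcess P Z 1) {B : Set ℝ}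
    (hB : MeasurableSet B) (hBt : volume B < ⊤) (f : ℕ∞ → ℝ≥0∞) :
    ∫⁻ ω, f ((Z ω ∩ B).encard) ∂P =
      ∑' k : ℕ, ENNReal.ofReal (Real.exp (-(volume B).toReal) * (volume B).toReal ^ k /
        (k.factorial : ℝ)) * f k := by
  have h1 : ∫⁻ ω, f ((Z ω ∩ B).encard) ∂P =
      ∫⁻ k, f k ∂(P.map fun ω => (Z ω ∩ B).encard) :=
    (lintegral_map (Measurable.of_discrete) (hZ.measurable_count B hB)).symm
  rw [h1, hZ.map_count B hB hBt, lintegral_map (Measurable.of_discrete) (Measurable.of_discrete),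
    poissonMeasure, lintegral_sum_measure]
  refine tsum_congr fun k => ?_
  rw [lintegral_smul_measure, lintegral_dirac, smul_eq_mul, one_mul]
  rfl

theorem IsPoissonProcess.measureReal_empty (hZ : IsPoissonProcess P Z 1) {B : Set ℝ}
    (hB : MeasurableSet B) (hBt : volume B < ⊤) :
    P.real {ω | Z ω ∩ B = ∅} = Real.exp (-(volume B).toReal) := by
  have hs : {ω | Z ω ∩ B = ∅} = (fun ω => (Z ω ∩ B).encard) ⁻¹' {0} := by
    ext ω; simp [encard_eq_zero]
  rw [measureReal_def, hs, ← Measure.map_apply (hZ.measurable_count B hB) (measurableSet_singleton _),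
    hZ.map_count B hB hBt, Measure.map_apply (Measurable.of_discrete) (measurableSet_singleton _)]
  have : (fun k : ℕ => (k : ℕ∞)) ⁻¹' {0} = {0} := by ext; simp
  rw [this, poissonMeasure_singleton]
  simp only [pow_zero, mul_one, Nat.factorial_zero, Nat.cast_one, div_one, one_mul]
  rw [ENNReal.toReal_ofReal (by positivity)]
  rfl

/-- The map `x ↦ c ^ x` on the extended natural numbers, infinite at infinity. -/
noncomputable def enatExp (c : ℝ≥0) (x : ℕ∞) : ℝ≥0∞ := if x = ⊤ then ⊤ else (c : ℝ≥0∞) ^ x.toNat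

theorem IsPoissonProcess.lintegral_enatExp (hZ : IsPoissonProcess P Z 1) {B : Set ℝ}
    (hB : MeasurableSet B) (hBt : volume B < ⊤) (c : ℝ≥0) :
    ∫⁻ ω, enatExp c ((Z ω ∩ B).encard) ∂P =
      ENNReal.ofReal (Real.exp ((volume B).toReal * (c - 1))) := by
  set r := (volume B).toReal with hr
  have hr0 : 0 ≤ r := ENNReal.toReal_nonneg
  rw [hZ.lintegral_count hB hBt]
  have h1 : ∀ k : ℕ, ENNReal.ofReal (Real.exp (-r) * r ^ k / (k.factorial : ℝ)) * enatExp c k =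
      ENNReal.ofReal (Real.exp (-r) * ((r * c) ^ k / (k.factorial : ℝ))) := by
    intro k
    have : enatExp c k = ENNReal.ofReal ((c : ℝ) ^ k) := by
      rw [enatExp, if_neg (ENat.natCast_ne_top k), ENat.toNat_natCast, ENNReal.ofReal_pow c.coe_nonneg,
        ENNReal.ofReal_coe_nnreal]
    rw [this, ← ENNReal.ofReal_mul (by positivity), mul_pow]
    congr 1; ring
  rw [tsum_congr h1]
  have h2 : HasSum (fun k : ℕ => Real.exp (-r) * ((r * c) ^ k / (k.factorial : ℝ)))
      (Real.exp (-r) * Real.exp (r * c)) := by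
    have := (NormedSpace.expSeries_div_hasSum_exp (r * c : ℝ)).mul_left (Real.exp (-r))
    rwa [← Real.exp_eq_exp_ℝ] at this
  rw [← ENNReal.ofReal_tsum_of_nonneg (fun k => by positivity) h2.summable, h2.tsum_eq,
    ← Real.exp_add]
  congr 2; ring

theorem enatExp_two_le {r : ℝ} {x : ℕ∞} (hx : ENNReal.ofReal r < x) :
    ENNReal.ofReal ((2 : ℝ) ^ r) ≤ enatExp 2 x := by
  rw [enatExp]
  split_ifs with h
  · exact le_top
  · lift x to ℕ using h
    rw [ENat.toENNReal_coe, ENNReal.ofReal_lt_natCast (by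
      rintro rfl; simp at hx)] at hx
    rw [ENat.toNat_natCast, show ((2 : ℝ≥0) : ℝ≥0∞) = ENNReal.ofReal 2 by simp,
      ← ENNReal.ofReal_pow (by norm_num), ← Real.rpow_natCast]
    apply ENNReal.ofReal_le_ofReal
    exact Real.rpow_le_rpow_of_exponent_le (by norm_num) hx.le

/-- Markov's inequality for `2 ^ N`, whose mean is `exp r` when `r` is the volume. Since `8 log 2 >
2`, dividing by `2 ^ (8 r)` leaves at most `exp (-r)`. -/
theorem IsPoissonProcess.measure_count_gt_le (hZ : IsPoissonProcess P Z 1) {B : Set ℝ}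
    (hB : MeasurableSet B) (hBt : volume B < ⊤) :
    P {ω | ENNReal.ofReal (8 * (volume B).toReal) < ((Z ω ∩ B).encard : ℝ≥0∞)} ≤
      ENNReal.ofReal (Real.exp (-(volume B).toReal)) := by
  set r := (volume B).toReal with hr
  have hr0 : 0 ≤ r := ENNReal.toReal_nonneg
  have h1 := mul_meas_ge_le_lintegral₀ (μ := P)
    (f := fun ω => enatExp 2 ((Z ω ∩ B).encard))
    ((Measurable.of_discrete (f := enatExp 2)).comp (hZ.measurable_count B hB)).aemeasurable
    (ENNReal.ofReal ((2 : ℝ) ^ (8 * r)))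
  rw [hZ.lintegral_enatExp hB hBt, ← hr] at h1
  have h2 : P {ω | ENNReal.ofReal (8 * r) < ((Z ω ∩ B).encard : ℝ≥0∞)} ≤
      P {ω | ENNReal.ofReal ((2 : ℝ) ^ (8 * r)) ≤ enatExp 2 ((Z ω ∩ B).encard)} :=
    measure_mono fun ω hω => enatExp_two_le hω
  refine h2.trans ?_
  have h3 : (0 : ℝ) < 2 ^ (8 * r) := by positivity
  rw [mul_comm, ← ENNReal.le_div_iff_mul_le (Or.inl (by simpa using h3))
    (Or.inl ENNReal.ofReal_ne_top), ← ENNReal.ofReal_div_of_pos h3] at h1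
  refine h1.trans (ENNReal.ofReal_le_ofReal ?_)
  rw [div_le_iff₀ h3, Real.rpow_def_of_pos two_pos, ← Real.exp_add]
  apply Real.exp_le_exp.2
  have := Real.log_two_gt_d9
  norm_num
  nlinarith

theorem measurableSet_isRun (hZ : IsPoissonProcess P Z 1) (h : ℝ) (n : ℕ) (j : ℤ) :
    MeasurableSet {ω | IsRun (Z ω) h n j} := by
  have : {ω | IsRun (Z ω) h n j} =
      ((fun ω => (Z ω ∩ Ico (j * h) ((j + 1) * h)).encard) ⁻¹' {0}ᶜ) ∩
      ((fun ω => (Z ω ∩ Ico ((j + 1) * h) ((j + 1 + n) * h)).encard) ⁻¹' {0}) := by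
    ext ω
    simp [IsRun, encard_eq_zero, nonempty_iff_ne_empty]
  rw [this]
  exact (hZ.measurable_count _ measurableSet_Ico (measurableSet_singleton _).compl).inter
    (hZ.measurable_count _ measurableSet_Ico (measurableSet_singleton _))

theorem IsPoissonProcess.measureReal_empty_Ico (hZ : IsPoissonProcess P Z 1) {a b : ℝ}
    (hab : a ≤ b) : P.real {ω | Z ω ∩ Ico a b = ∅} = Real.exp (-(b - a)) := by
  rw [hZ.measureReal_empty measurableSet_Ico (by simp), Real.volume_Ico,
    ENNReal.toReal_ofReal (by linarith)]

theorem IsPoissonProcess.measureReal_nonempty_Ico [IsProbabilityMeasure P]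
    (hZ : IsPoissonProcess P Z 1) {a b : ℝ}
    (hab : a ≤ b) : P.real {ω | (Z ω ∩ Ico a b).Nonempty} = 1 - Real.exp (-(b - a)) := by
  have h1 : MeasurableSet {ω | Z ω ∩ Ico a b = ∅} := by
    have := hZ.measurable_count _ (measurableSet_Ico (a := a) (b := b))
      (measurableSet_singleton 0)
    convert this using 1
    ext ω; simp [encard_eq_zero]
  have h2 : {ω | (Z ω ∩ Ico a b).Nonempty} = {ω | Z ω ∩ Ico a b = ∅}ᶜ := by
    ext ω; simp [nonempty_iff_ne_empty]
  rw [h2, probReal_compl_eq_one_sub h1, hZ.measureReal_empty_Ico hab]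

theorem IsPoissonProcess.measureReal_inter_eq_prod (hZ : IsPoissonProcess P Z 1) {k : ℕ}
    (l r : Fin k → ℝ) (hlr : ∀ i j, i < j → r i ≤ l j) (A : Fin k → Set ℕ∞) :
    P.real (⋂ i, {ω | (Z ω ∩ Ico (l i) (r i)).encard ∈ A i}) =
      ∏ i, P.real {ω | (Z ω ∩ Ico (l i) (r i)).encard ∈ A i} := by
  have h := (hZ.indep_count k (fun i => Ico (l i) (r i)) (fun _ => measurableSet_Ico)
    (fun i j hij => by
      refine Set.disjoint_left.2 fun x hx hx' => ?_
      rcases lt_or_gt_of_ne hij with h1 | h1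
      · linarith [hlr i j h1, hx.2, hx'.1]
      · linarith [hlr j i h1, hx'.2, hx.1])).measure_inter_preimage_eq_mul
    Finset.univ (sets := A) (fun _ _ => MeasurableSet.of_discrete)
  simp only [Finset.mem_univ, iInter_true] at h
  simp only [measureReal_def]
  rw [← ENNReal.toReal_prod]
  exact congrArg ENNReal.toReal h

theorem measureReal_isRun [IsProbabilityMeasure P] (hZ : IsPoissonProcess P Z 1) {h : ℝ}
    (hh : 0 ≤ h) (n : ℕ) (j : ℤ) :
    P.real {ω | IsRun (Z ω) h n j} = (1 - Real.exp (-h)) * Real.exp (-(n * h)) := by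
  have h1 := hZ.measureReal_inter_eq_prod ![(j : ℝ) * h, (j + 1) * h]
    ![(j + 1 : ℝ) * h, (j + 1 + n) * h] (by
      intro i k hik
      fin_cases i <;> fin_cases k <;> simp at hik ⊢) ![{0}ᶜ, {0}]
  have h2 : {ω | IsRun (Z ω) h n j} =
      ⋂ i, {ω | (Z ω ∩ Ico ((![(j : ℝ) * h, (j + 1) * h] : Fin 2 → ℝ) i)
        ((![(j + 1 : ℝ) * h, (j + 1 + n) * h] : Fin 2 → ℝ) i)).encard ∈
          (![{0}ᶜ, {0}] : Fin 2 → Set ℕ∞) i} := by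
    ext ω
    simp [IsRun, Fin.forall_fin_two, encard_eq_zero, nonempty_iff_ne_empty]
  rw [h2, h1, Fin.prod_univ_two]
  have e1 := hZ.measureReal_nonempty_Ico (a := j * h) (b := (j + 1) * h) (by nlinarith)
  have e2 := hZ.measureReal_empty_Ico (a := (j + 1) * h) (b := (j + 1 + n) * h) (by
    have : (0 : ℝ) ≤ n * h := by positivity
    nlinarith)
  rw [show ((j : ℝ) + 1) * h - j * h = h by ring] at e1
  rw [show ((j : ℝ) + 1 + n) * h - (j + 1) * h = n * h by ring] at e2
  rw [← e1, ← e2]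
  congr 1
  · simp [encard_eq_zero, nonempty_iff_ne_empty]
  · simp [encard_eq_zero]

/-- Two runs starting too close to each other exclude one another; otherwise the four intervals
involved are disjoint and independence gives equality. Hence the correlation is never positive. -/
theorem measureReal_isRun_inter_le [IsProbabilityMeasure P] (hZ : IsPoissonProcess P Z 1) {h : ℝ}
    (hh : 0 ≤ h) (n : ℕ) {j k : ℤ} (hjk : j ≠ k) :
    P.real ({ω | IsRun (Z ω) h n j} ∩ {ω | IsRun (Z ω) h n k}) ≤
      ((1 - Real.exp (-h)) * Real.exp (-(n * h))) ^ 2 := by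
  wlog hlt : j < k generalizing j k with H
  · rw [inter_comm]
    exact H hjk.symm (lt_of_le_of_ne (not_lt.1 hlt) hjk.symm)
  by_cases hn : j + 1 + n ≤ k
  swap
  · have : {ω | IsRun (Z ω) h n j} ∩ {ω | IsRun (Z ω) h n k} = ∅ := by
      rw [eq_empty_iff_forall_notMem]
      rintro ω ⟨h1, h2⟩
      exact hn (IsRun.le_of_lt hh h1 h2 hlt)
    rw [this, measureReal_empty]
    positivity
  have hn' : (j : ℝ) + 1 + n ≤ k := by exact_mod_cast hn
  have hn0 : (0 : ℝ) ≤ n := by positivity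
  set l : Fin 4 → ℝ := ![(j : ℝ) * h, (j + 1) * h, k * h, (k + 1) * h] with hl
  set r : Fin 4 → ℝ := ![(j + 1 : ℝ) * h, (j + 1 + n) * h, (k + 1) * h, (k + 1 + n) * h] with hr
  set A : Fin 4 → Set ℕ∞ := ![{0}ᶜ, {0}, {0}ᶜ, {0}] with hA
  have h1 := hZ.measureReal_inter_eq_prod l r (by
      intro i m him
      fin_cases i <;> fin_cases m <;> simp [l, r] at him ⊢ <;>
        refine mul_le_mul_of_nonneg_right (by linarith) hh) A
  have h2 : {ω | IsRun (Z ω) h n j} ∩ {ω | IsRun (Z ω) h n k} =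
      ⋂ i, {ω | (Z ω ∩ Ico (l i) (r i)).encard ∈ A i} := by
    ext ω
    simp [IsRun, Fin.forall_fin_succ, encard_eq_zero, nonempty_iff_ne_empty, l, r, A, and_assoc]
  rw [h2, h1, Fin.prod_univ_four]
  have e1 := hZ.measureReal_nonempty_Ico (a := j * h) (b := (j + 1) * h) (by nlinarith)
  have e2 := hZ.measureReal_empty_Ico (a := (j + 1) * h) (b := (j + 1 + n) * h) (by
    have : (0 : ℝ) ≤ n * h := by positivity
    nlinarith)
  have e3 := hZ.measureReal_nonempty_Ico (a := k * h) (b := (k + 1) * h) (by nlinarith)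
  have e4 := hZ.measureReal_empty_Ico (a := (k + 1) * h) (b := (k + 1 + n) * h) (by
    have : (0 : ℝ) ≤ n * h := by positivity
    nlinarith)
  rw [show ((j : ℝ) + 1) * h - j * h = h by ring] at e1
  rw [show ((j : ℝ) + 1 + n) * h - (j + 1) * h = n * h by ring] at e2
  rw [show ((k : ℝ) + 1) * h - k * h = h by ring] at e3
  rw [show ((k : ℝ) + 1 + n) * h - (k + 1) * h = n * h by ring] at e4
  have f1 : P.real {ω | (Z ω ∩ Ico (l 0) (r 0)).encard ∈ A 0} = 1 - Real.exp (-h) := by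
    rw [← e1]; simp [encard_eq_zero, nonempty_iff_ne_empty, l, r, A]
  have f2 : P.real {ω | (Z ω ∩ Ico (l 1) (r 1)).encard ∈ A 1} = Real.exp (-(n * h)) := by
    rw [← e2]; simp [encard_eq_zero, l, r, A]
  have f3 : P.real {ω | (Z ω ∩ Ico (l 2) (r 2)).encard ∈ A 2} = 1 - Real.exp (-h) := by
    rw [← e3]; simp [encard_eq_zero, nonempty_iff_ne_empty, l, r, A]
  have f4 : P.real {ω | (Z ω ∩ Ico (l 3) (r 3)).encard ∈ A 3} = Real.exp (-(n * h)) := by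
    rw [← e4]; simp [encard_eq_zero, l, r, A]
  rw [f1, f2, f3, f4]
  apply le_of_eq; ring

end Poisson

/-! ### Moment bounds for sums of indicators -/

section Chebyshev

variable {Ω : Type*} [MeasurableSpace Ω] {P : Measure Ω} [IsProbabilityMeasure P]

/-- Off-diagonal covariances are nonpositive, so the variance is at most the sum over the diagonal,
which is at most the mean. Chebyshev's inequality finishes the argument. -/
theorem measureReal_abs_sub_ge_le {ι : Type*} (T : Finset ι) (E : ι → Set Ω)
    (hE : ∀ i, MeasurableSet (E i)) {r : ℝ} (hr : ∀ i, P.real (E i) = r)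
    (hpair : ∀ i j, i ≠ j → P.real (E i ∩ E j) ≤ r ^ 2) {c : ℝ} (hc : 0 < c) :
    P.real {ω | c ≤ |(∑ i ∈ T, (E i).indicator (1 : Ω → ℝ) ω) - T.card * r|} ≤
      T.card * r / c ^ 2 := by
  classical
  set M : Ω → ℝ := fun ω => ∑ i ∈ T, (E i).indicator (1 : Ω → ℝ) ω with hM
  have hint : ∀ s : Set Ω, MeasurableSet s → Integrable (s.indicator (1 : Ω → ℝ)) P := fun s hs =>
    (integrable_const (1 : ℝ)).indicator hs
  have hMi : Integrable M P := integrable_finsetSum _ fun i _ => hint _ (hE i)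
  have hME : ∫ ω, M ω ∂P = T.card * r := by
    rw [integral_finsetSum _ fun i _ => hint _ (hE i)]
    simp [integral_indicator_one (hE _), hr]
  have hM2 : ∀ ω, M ω ^ 2 = ∑ i ∈ T, ∑ j ∈ T, (E i ∩ E j).indicator (1 : Ω → ℝ) ω := by
    intro ω
    simp only [M, sq, Finset.sum_mul_sum, inter_indicator_one, Pi.mul_apply]
  have hM2i : Integrable (fun ω => M ω ^ 2) P := by
    simp_rw [hM2]
    exact integrable_finsetSum _ fun i _ => integrable_finsetSum _ fun j _ =>
      hint _ ((hE i).inter (hE j))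
  have hM2E : ∫ ω, M ω ^ 2 ∂P ≤ T.card * r + (T.card * r) ^ 2 := by
    simp_rw [hM2]
    rw [integral_finsetSum _ fun i _ => integrable_finsetSum _ fun j _ =>
      hint _ ((hE i).inter (hE j))]
    have h1 : ∀ i ∈ T, ∫ ω, ∑ j ∈ T, (E i ∩ E j).indicator (1 : Ω → ℝ) ω ∂P ≤
        r + T.card * r ^ 2 := by
      intro i hi
      rw [integral_finsetSum _ fun j _ => hint _ ((hE i).inter (hE j))]
      simp_rw [integral_indicator_one ((hE i).inter (hE _))]
      rw [← Finset.add_sum_erase T _ hi, inter_self, hr]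
      gcongr
      calc ∑ j ∈ T.erase i, P.real (E i ∩ E j) ≤ ∑ j ∈ T.erase i, r ^ 2 :=
            Finset.sum_le_sum fun j hj => hpair i j (Finset.ne_of_mem_erase hj).symm
        _ = (T.erase i).card * r ^ 2 := by rw [Finset.sum_const, nsmul_eq_mul]
        _ ≤ T.card * r ^ 2 := by
            gcongr
            exact Finset.erase_subset _ _
    refine (Finset.sum_le_sum h1).trans (le_of_eq ?_)
    rw [Finset.sum_const, nsmul_eq_mul]; ring
  have hvar : ∫ ω, (M ω - T.card * r) ^ 2 ∂P ≤ T.card * r := by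
    have : ∀ ω, (M ω - T.card * r) ^ 2 = M ω ^ 2 - 2 * (T.card * r) * M ω + (T.card * r) ^ 2 :=
      fun ω => by ring
    simp_rw [this]
    have i2 : Integrable (fun ω => 2 * (T.card * r) * M ω) P := hMi.const_mul _
    have e1 := integral_add (f := fun ω => M ω ^ 2 - 2 * (T.card * r) * M ω)
      (g := fun _ => (T.card * r) ^ 2) (hM2i.sub i2) (integrable_const _)
    have e2 := integral_sub hM2i i2
    rw [e1, e2, integral_const_mul, hME]
    simp only [integral_const, probReal_univ, smul_eq_mul, one_mul]
    nlinarith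
  have hsqi : Integrable (fun ω => (M ω - T.card * r) ^ 2) P := by
    have : ∀ ω, (M ω - T.card * r) ^ 2 = M ω ^ 2 - 2 * (T.card * r) * M ω + (T.card * r) ^ 2 :=
      fun ω => by ring
    simp_rw [this]
    exact (hM2i.sub (hMi.const_mul _)).add (integrable_const _)
  have hmark := mul_meas_ge_le_integral_of_nonneg (μ := P)
    (f := fun ω => (M ω - T.card * r) ^ 2) (ae_of_all _ fun ω => sq_nonneg _) hsqi (c ^ 2)
  have hset : {ω | c ≤ |M ω - T.card * r|} = {ω | c ^ 2 ≤ (M ω - T.card * r) ^ 2} := by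
    ext ω
    simp only [mem_ofPred_eq]
    rw [← sq_abs (M ω - T.card * r)]
    exact (pow_le_pow_iff_left₀ hc.le (abs_nonneg _) two_ne_zero).symm
  rw [le_div_iff₀ (by positivity), mul_comm, hset]
  exact hmark.trans hvar

theorem measureReal_ge_le {ι : Type*} (T : Finset ι) (E : ι → Set Ω)
    (hE : ∀ i, MeasurableSet (E i)) {r : ℝ} (hr : ∀ i, P.real (E i) = r) {c : ℝ} (hc : 0 < c) :
    P.real {ω | c ≤ ∑ i ∈ T, (E i).indicator (1 : Ω → ℝ) ω} ≤ T.card * r / c := by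
  have hint : ∀ i, Integrable ((E i).indicator (1 : Ω → ℝ)) P := fun i =>
    (integrable_const (1 : ℝ)).indicator (hE i)
  have hME : ∫ ω, ∑ i ∈ T, (E i).indicator (1 : Ω → ℝ) ω ∂P = T.card * r := by
    rw [integral_finsetSum _ fun i _ => hint i]
    simp [integral_indicator_one (hE _), hr]
  have hmark := mul_meas_ge_le_integral_of_nonneg (μ := P)
    (f := fun ω => ∑ i ∈ T, (E i).indicator (1 : Ω → ℝ) ω)
    (ae_of_all _ fun ω => Finset.sum_nonneg fun i _ => indicator_nonneg (by simp) _)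
    (integrable_finsetSum _ fun i _ => hint i) c
  rw [le_div_iff₀ hc, mul_comm, ← hME]
  exact hmark

end Chebyshev

/-! ### Simultaneous control of the numbers of runs of all lengths -/

section Runs

theorem card_runs_eq_sum {Ω : Type*} (X : Ω → Set ℝ) (h : ℝ) (T : Finset ℤ) (n : ℕ) (ω : Ω) :
    ((runs (X ω) h T n).card : ℝ) =
      ∑ j ∈ T, ({ω | IsRun (X ω) h n j}.indicator (1 : Ω → ℝ) ω) := by
  classical
  simp [runs, indicator_apply]

variable {Ω : Type*} [MeasurableSpace Ω] {P : Measure Ω} [IsProbabilityMeasure P] {Z : Ω → Set ℝ}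

/-- The expected number of runs of at least `n` empty cells of size `h` starting at `N` given
positions. -/
noncomputable def expectedRuns (h : ℝ) (N n : ℕ) : ℝ :=
  N * ((1 - Real.exp (-h)) * Real.exp (-(n * h)))

theorem measureReal_expectedRuns_dev_le (hZ : IsPoissonProcess P Z 1) {h : ℝ} (hh : 0 ≤ h)
    (T : Finset ℤ) (n : ℕ) {c : ℝ} (hc : 0 < c) :
    P.real {ω | c ≤ |((runs (Z ω) h T n).card : ℝ) - expectedRuns h T.card n|} ≤
      expectedRuns h T.card n / c ^ 2 := by
  simp_rw [card_runs_eq_sum]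
  exact measureReal_abs_sub_ge_le T (fun j => {ω | IsRun (Z ω) h n j})
    (fun j => measurableSet_isRun hZ h n j) (fun j => measureReal_isRun hZ hh n j)
    (fun i j hij => measureReal_isRun_inter_le hZ hh n hij) hc

theorem measureReal_runs_ge_le (hZ : IsPoissonProcess P Z 1) {h : ℝ} (hh : 0 ≤ h)
    (T : Finset ℤ) (n : ℕ) {c : ℝ} (hc : 0 < c) :
    P.real {ω | c ≤ ((runs (Z ω) h T n).card : ℝ)} ≤ expectedRuns h T.card n / c := by
  simp_rw [card_runs_eq_sum]
  exact measureReal_ge_le T (fun j => {ω | IsRun (Z ω) h n j})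
    (fun j => measurableSet_isRun hZ h n j) (fun j => measureReal_isRun hZ hh n j) hc

theorem expectedRuns_pos {h : ℝ} (hh : 0 < h) {N : ℕ} (hN : 0 < N) (n : ℕ) :
    0 < expectedRuns h N n := by
  have h1 : Real.exp (-h) < 1 := Real.exp_lt_one_iff.2 (by linarith)
  have : (0 : ℝ) < N := by exact_mod_cast hN
  have : 0 < 1 - Real.exp (-h) := by linarith
  unfold expectedRuns
  positivity

theorem inv_expectedRuns {h : ℝ} (hh : 0 < h) {N : ℕ} (hN : 0 < N) (n : ℕ) :
    (expectedRuns h N n)⁻¹ =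
      Real.exp (n * h - Real.log N - Real.log (1 - Real.exp (-h))) := by
  have h1 : Real.exp (-h) < 1 := Real.exp_lt_one_iff.2 (by linarith)
  have h2 : (0 : ℝ) < N := by exact_mod_cast hN
  have h3 : 0 < 1 - Real.exp (-h) := by linarith
  rw [Real.exp_sub, Real.exp_sub, Real.exp_log h2, Real.exp_log h3, expectedRuns]
  have h4 : Real.exp (-(n * h)) * Real.exp (n * h) = 1 := by rw [← Real.exp_add]; simp
  rw [inv_eq_iff_eq_inv, inv_div, div_div_eq_mul_div, eq_div_iff (Real.exp_pos _).ne']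
  linear_combination (N * (1 - Real.exp (-h))) * h4

theorem expectedRuns_sub (h : ℝ) (N : ℕ) {n τ : ℕ} (hτ : τ ≤ n) :
    expectedRuns h N (n - τ) = expectedRuns h N n * Real.exp (h * τ) := by
  unfold expectedRuns
  rw [Nat.cast_sub hτ, mul_assoc, mul_assoc, ← Real.exp_add]
  congr 3; ring

/-- An upper bound for the failure probability of a deviation bound which interpolates between
`K / expectedRuns h N n` and `K * exp (-h * (n / n₀) / 3)`. -/
theorem le_geometric_of_le {h x K : ℝ} {n₀ N n : ℕ} (hh : 0 < h) (hn₀ : 2 ≤ n₀)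
    (hN : 0 < N) (hK : 0 ≤ K) (h1 : x ≤ K * (expectedRuns h N n)⁻¹)
    (h2 : x ≤ K * Real.exp (-(h * (n / n₀ : ℕ) / 3))) :
    x ≤ K * Real.exp (h / 6 - Real.log (1 - Real.exp (-h))) *
      (N : ℝ) ^ (-(1 / (12 * n₀) : ℝ)) * Real.exp (-(h / (12 * n₀))) ^ n := by
  have hp1 : Real.exp (-h) < 1 := Real.exp_lt_one_iff.2 (by linarith)
  have hp2 : Real.log (1 - Real.exp (-h)) ≤ 0 :=
    Real.log_nonpos (by linarith) (by linarith [Real.exp_pos (-h)])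
  have hN' : (0 : ℝ) < N := by exact_mod_cast hN
  have hn₀' : (2 : ℝ) ≤ n₀ := by exact_mod_cast hn₀
  rw [inv_expectedRuns hh hN] at h1
  rw [Real.rpow_def_of_pos hN', ← Real.exp_nat_mul, mul_assoc, mul_assoc, ← Real.exp_add,
    ← Real.exp_add]
  set A := (n : ℝ) * h - Real.log N - Real.log (1 - Real.exp (-h)) with hA
  set B := -(h * (n / n₀ : ℕ) / 3) with hB
  set θ : ℝ := 1 / (12 * n₀) with hθ
  have hθ0 : 0 ≤ θ := by positivity
  have hθ1 : θ ≤ 1 / 2 := by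
    rw [hθ, div_le_div_iff₀ (by positivity) (by norm_num)]; linarith
  have hτ : (n : ℝ) / n₀ - 1 ≤ (n / n₀ : ℕ) := by
    have := Nat.lt_div_mul_add (a := n) (b := n₀) (by omega)
    have h3 : (n : ℝ) < (n / n₀ : ℕ) * n₀ + n₀ := by exact_mod_cast this
    rw [sub_le_iff_le_add, div_le_iff₀ (by positivity)]
    linarith
  have hτ0 : (0 : ℝ) ≤ (n / n₀ : ℕ) := by positivity
  -- The minimum is below the convex combination with weight `θ = 1 / (12 n₀)`. The growth `θ n h`
  -- from `A` is outweighed by the part `-2 θ n h` from `B`, leaving geometric decay in `n` together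
  -- with the power `N ^ (-θ)`.
  have hkey : min A B ≤ h / 6 - Real.log (1 - Real.exp (-h)) +
      (Real.log N * -θ + n * -(h / (12 * n₀))) := by
    have h3 : min A B ≤ θ * A + (1 - θ) * B := by
      have := min_le_left A B
      have := min_le_right A B
      nlinarith
    refine h3.trans ?_
    have e1 : (n : ℝ) * (h / (12 * n₀)) = θ * (n * h) := by rw [hθ]; field_simp
    have e2 : (n : ℝ) / n₀ = 12 * θ * n := by rw [hθ]; field_simp
    rw [e2] at hτ
    have h4 : (1 - θ) * B ≤ h / 6 - 2 * (θ * (n * h)) := by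
      have : 1 / 2 * (h * (n / n₀ : ℕ) / 3) ≤ (1 - θ) * (h * (n / n₀ : ℕ) / 3) := by
        gcongr; linarith
      have h5 : h * (12 * θ * n - 1) ≤ h * (n / n₀ : ℕ) := by gcongr
      rw [hB]; linarith
    have h6 : -(θ * Real.log (1 - Real.exp (-h))) ≤ -Real.log (1 - Real.exp (-h)) := by
      nlinarith
    rw [hA]
    linarith [mul_neg (n : ℝ) (h / (12 * n₀))]
  refine le_trans ?_ (mul_le_mul_of_nonneg_left (Real.exp_le_exp.2 hkey) hK)
  rcases min_cases A B with ⟨e, _⟩ | ⟨e, _⟩ <;> rw [e] <;> assumption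

/-- The numbers of runs are not much larger than expected. -/
def FewRuns (X : Set ℝ) (h : ℝ) (T : Finset ℤ) (n₀ : ℕ) : Prop :=
  ∀ n, n₀ ≤ n → ((runs X h T n).card : ℝ) ≤
    expectedRuns h T.card n * Real.exp (h * (n / n₀ : ℕ) / 3)

/-- The numbers of slightly shortened runs are larger than the expected number of runs. -/
def ManyRuns (X : Set ℝ) (h : ℝ) (T : Finset ℤ) (n₀ : ℕ) : Prop :=
  ∀ n, n₀ ≤ n → 1 / 2 ≤ expectedRuns h T.card n * Real.exp (h * (n / n₀ : ℕ) / 3) →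
    expectedRuns h T.card n * Real.exp (2 * h * (n / n₀ : ℕ) / 3) ≤
      ((runs X h T (n - n / n₀)).card : ℝ)

/-- Chebyshev's inequality is effective while the expected number of runs is large, Markov's for
long runs with a small expected number. Interpolating between them gives a bound summable over `n`
with a factor decaying in the window size. -/
theorem measureReal_fewRuns_fail_le (hZ : IsPoissonProcess P Z 1) {h : ℝ} (hh : 0 < h)
    {T : Finset ℤ} (hT : T.Nonempty) {n₀ n : ℕ} (hn₀ : 2 ≤ n₀) (hn : n₀ ≤ n) :
    P.real {ω | expectedRuns h T.card n * Real.exp (h * (n / n₀ : ℕ) / 3) <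
        ((runs (Z ω) h T n).card : ℝ)} ≤
      2 / (1 - Real.exp (-(h / 3))) ^ 2 * Real.exp (h / 6 - Real.log (1 - Real.exp (-h))) *
      (T.card : ℝ) ^ (-(1 / (12 * n₀) : ℝ)) * Real.exp (-(h / (12 * n₀))) ^ n := by
  have hN := hT.card_pos
  have hr := expectedRuns_pos hh hN n
  set r := expectedRuns h T.card n with hrdef
  have hk0 : Real.exp (-(h / 3)) < 1 := Real.exp_lt_one_iff.2 (by linarith)
  have hk0' := Real.exp_pos (-(h / 3))
  set κ := 1 - Real.exp (-(h / 3)) with hκ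
  have hκ0 : 0 < κ := by linarith
  have hκ1 : κ ≤ 1 := by linarith
  have hτ : 1 ≤ n / n₀ := (Nat.one_le_div_iff (by omega)).2 hn
  have hτ' : (1 : ℝ) ≤ (n / n₀ : ℕ) := by exact_mod_cast hτ
  refine le_geometric_of_le hh hn₀ hN (by positivity) ?_ ?_
  · have hE : 1 + κ ≤ Real.exp (h * (n / n₀ : ℕ) / 3) := by
      have h1 : Real.exp (h / 3) ≤ Real.exp (h * (n / n₀ : ℕ) / 3) :=
        Real.exp_le_exp.2 (by nlinarith)
      have h2 := Real.add_one_le_exp (h / 3)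
      have h3 := Real.one_sub_le_exp_neg (h / 3)
      linarith
    calc _ ≤ P.real {ω | r * κ ≤ |((runs (Z ω) h T n).card : ℝ) - r|} := by
          refine measureReal_mono fun ω hω => ?_
          simp only [mem_ofPred_eq] at hω ⊢
          refine le_trans ?_ (le_abs_self _)
          nlinarith
      _ ≤ r / (r * κ) ^ 2 := measureReal_expectedRuns_dev_le hZ hh.le T n (by positivity)
      _ = 1 / κ ^ 2 * r⁻¹ := by field_simp
      _ ≤ 2 / κ ^ 2 * r⁻¹ := by gcongr; norm_num
  · have h1 : P.real {ω | r * Real.exp (h * (n / n₀ : ℕ) / 3) < ((runs (Z ω) h T n).card : ℝ)} ≤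
        r / (r * Real.exp (h * (n / n₀ : ℕ) / 3)) :=
      le_trans (measureReal_mono (fun ω hω => le_of_lt (mem_ofPred_eq.mp hω)) (measure_ne_top P _))
        (measureReal_runs_ge_le hZ hh.le T n (by positivity))
    refine h1.trans ?_
    rw [Real.exp_neg, ← div_div, div_self hr.ne', one_div]
    refine le_mul_of_one_le_left (by positivity) ?_
    rw [le_div_iff₀ (by positivity)]
    nlinarith

/-- With `τ = n / n₀`, the mean number of shortened runs is `exp (h τ)` times the original mean, so
the threshold is `exp (-h τ / 3)` times the new mean and Chebyshev's inequality applies. The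
assumption `hlarge` makes the new mean itself at least `exp (h τ / 3) / 2`, which gives the decay in
`n`. -/
theorem measureReal_manyRuns_fail_le (hZ : IsPoissonProcess P Z 1) {h : ℝ} (hh : 0 < h)
    {T : Finset ℤ} (hT : T.Nonempty) {n₀ n : ℕ} (hn₀ : 2 ≤ n₀) (hn : n₀ ≤ n)
    (hlarge : 1 / 2 ≤ expectedRuns h T.card n * Real.exp (h * (n / n₀ : ℕ) / 3)) :
    P.real {ω | ((runs (Z ω) h T (n - n / n₀)).card : ℝ) <
        expectedRuns h T.card n * Real.exp (2 * h * (n / n₀ : ℕ) / 3)} ≤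
      2 / (1 - Real.exp (-(h / 3))) ^ 2 * Real.exp (h / 6 - Real.log (1 - Real.exp (-h))) *
      (T.card : ℝ) ^ (-(1 / (12 * n₀) : ℝ)) * Real.exp (-(h / (12 * n₀))) ^ n := by
  have hN := hT.card_pos
  have hr := expectedRuns_pos hh hN n
  have hr' := expectedRuns_pos hh hN (n - n / n₀)
  have hrr := expectedRuns_sub h T.card (Nat.div_le_self n n₀)
  set r := expectedRuns h T.card n with hrdef
  set r' := expectedRuns h T.card (n - n / n₀) with hrdef'
  have hk0 : Real.exp (-(h / 3)) < 1 := Real.exp_lt_one_iff.2 (by linarith)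
  have hk0' := Real.exp_pos (-(h / 3))
  set κ := 1 - Real.exp (-(h / 3)) with hκ
  have hκ0 : 0 < κ := by linarith
  have hτ : 1 ≤ n / n₀ := (Nat.one_le_div_iff (by omega)).2 hn
  have hτ' : (1 : ℝ) ≤ (n / n₀ : ℕ) := by exact_mod_cast hτ
  set τ : ℝ := ((n / n₀ : ℕ) : ℝ) with hτdef
  have hsplit : r * Real.exp (2 * h * τ / 3) = r' * Real.exp (-(h * τ / 3)) := by
    rw [hrr, mul_assoc, mul_assoc, ← Real.exp_add]; congr 2; ring
  have hE : Real.exp (-(h * τ / 3)) ≤ 1 - κ := by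
    rw [hκ, sub_sub_cancel]
    exact Real.exp_le_exp.2 (by nlinarith)
  have hmain : P.real {ω | ((runs (Z ω) h T (n - n / n₀)).card : ℝ) <
      r * Real.exp (2 * h * τ / 3)} ≤ 1 / κ ^ 2 * r'⁻¹ := by
    calc _ ≤ P.real {ω | r' * κ ≤ |((runs (Z ω) h T (n - n / n₀)).card : ℝ) - r'|} := by
          refine measureReal_mono fun ω hω => ?_
          simp only [mem_ofPred_eq] at hω ⊢
          rw [hsplit] at hω
          refine le_trans ?_ (neg_le_abs _)
          nlinarith
      _ ≤ r' / (r' * κ) ^ 2 := measureReal_expectedRuns_dev_le hZ hh.le T _ (by positivity)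
      _ = _ := by field_simp
  refine le_geometric_of_le hh hn₀ hN (by positivity) (hmain.trans ?_) (hmain.trans ?_)
  · have : r ≤ r' := by
      rw [hrr]
      exact le_mul_of_one_le_right hr.le (Real.one_le_exp (by positivity))
    gcongr
    norm_num
  · have h1 : 1 / 2 * Real.exp (h * τ / 3) ≤ r' := by
      have h2 : r' = r * Real.exp (h * τ / 3) * Real.exp (2 * (h * τ / 3)) := by
        rw [hrr, mul_assoc, ← Real.exp_add]; congr 2; ring
      rw [h2]
      gcongr
      have : 0 ≤ h * τ / 3 := by positivity
      linarith
    calc 1 / κ ^ 2 * r'⁻¹ ≤ 1 / κ ^ 2 * (1 / 2 * Real.exp (h * τ / 3))⁻¹ := by gcongr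
      _ = 2 / κ ^ 2 * Real.exp (-(h * τ / 3)) := by rw [Real.exp_neg]; field_simp

/-- Union bound over all run lengths, summing the geometric series; the constant does not depend on
the window. -/
theorem exists_measure_not_runs_le (hZ : IsPoissonProcess P Z 1) {h : ℝ} (hh : 0 < h) {n₀ : ℕ}
    (hn₀ : 2 ≤ n₀) : ∃ C : ℝ, 0 < C ∧ ∀ T : Finset ℤ, T.Nonempty →
      P {ω | ¬ FewRuns (Z ω) h T n₀} ≤
        ENNReal.ofReal (C * (T.card : ℝ) ^ (-(1 / (12 * n₀) : ℝ))) ∧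
      P {ω | ¬ ManyRuns (Z ω) h T n₀} ≤
        ENNReal.ofReal (C * (T.card : ℝ) ^ (-(1 / (12 * n₀) : ℝ))) := by
  have hn₀' : (2 : ℝ) ≤ n₀ := by exact_mod_cast hn₀
  have hk0 : Real.exp (-(h / 3)) < 1 := Real.exp_lt_one_iff.2 (by linarith)
  have hκ0 : 0 < 1 - Real.exp (-(h / 3)) := by linarith
  set K := 2 / (1 - Real.exp (-(h / 3))) ^ 2 * Real.exp (h / 6 - Real.log (1 - Real.exp (-h)))
    with hK
  set ρ := Real.exp (-(h / (12 * n₀))) with hρ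
  have hK0 : 0 < K := by positivity
  have hρ0 : 0 < ρ := Real.exp_pos _
  have hρ1 : ρ < 1 := Real.exp_lt_one_iff.2 (by
    have : 0 < h / (12 * (n₀ : ℝ)) := by positivity
    linarith)
  have hsum := (hasSum_geometric_of_lt_one hρ0.le hρ1)
  have huni : ∀ (x : ℝ) (E : ℕ → Set Ω), 0 ≤ x → (∀ n, P.real (E n) ≤ K * x * ρ ^ n) →
      P (⋃ n, E n) ≤ ENNReal.ofReal (K * (1 - ρ)⁻¹ * x) := by
    intro x E hx hE
    calc P (⋃ n, E n) ≤ ∑' n, P (E n) := measure_iUnion_le E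
      _ ≤ ∑' n, ENNReal.ofReal (K * x * ρ ^ n) := by
          refine ENNReal.tsum_le_tsum fun n => ?_
          rw [← ofReal_measureReal]
          exact ENNReal.ofReal_le_ofReal (hE n)
      _ = ENNReal.ofReal (K * (1 - ρ)⁻¹ * x) := by
          rw [← ENNReal.ofReal_tsum_of_nonneg (fun n => by positivity)
            (hsum.mul_left _).summable, (hsum.mul_left _).tsum_eq]
          congr 1; ring
  have : 0 < 1 - ρ := by linarith
  refine ⟨K * (1 - ρ)⁻¹, by positivity, fun T hT => ⟨?_, ?_⟩⟩
  · refine (measure_mono ?_).trans (huni _ (fun n => if n₀ ≤ n then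
      {ω | expectedRuns h T.card n * Real.exp (h * (n / n₀ : ℕ) / 3) <
        ((runs (Z ω) h T n).card : ℝ)} else ∅) (by positivity) fun n => ?_)
    · intro ω hω
      simp only [mem_ofPred_eq, FewRuns] at hω
      push Not at hω
      obtain ⟨n, hn, hlt⟩ := hω
      refine mem_iUnion.2 ⟨n, ?_⟩
      rw [if_pos hn]
      exact hlt
    · split_ifs with hn
      · exact measureReal_fewRuns_fail_le hZ hh hT hn₀ hn
      · rw [measureReal_empty]; positivity
  · classical
    refine (measure_mono ?_).trans (huni _ (fun n => if n₀ ≤ n ∧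
        1 / 2 ≤ expectedRuns h T.card n * Real.exp (h * (n / n₀ : ℕ) / 3) then
      {ω | ((runs (Z ω) h T (n - n / n₀)).card : ℝ) <
        expectedRuns h T.card n * Real.exp (2 * h * (n / n₀ : ℕ) / 3)} else ∅)
        (by positivity) fun n => ?_)
    · intro ω hω
      simp only [mem_ofPred_eq, ManyRuns] at hω
      push Not at hω
      obtain ⟨n, hn, hl, hlt⟩ := hω
      refine mem_iUnion.2 ⟨n, ?_⟩
      rw [if_pos ⟨hn, hl⟩]
      exact hlt
    · split_ifs with hn
      · exact measureReal_manyRuns_fail_le hZ hh hT hn₀ hn.1 hn.2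
      · rw [measureReal_empty]; positivity

end Runs

/-! ### Windows adapted to a range of densities, and typical configurations -/

section Windows

/-- The number of additional cells at the ends of the windows. -/
noncomputable def margin (v : ℝ) : ℕ := ⌈v / 24⌉₊

/-- The first cell of the source window, without the margin. -/
noncomputable def sourceLeft (h α v : ℝ) : ℤ := -⌈α * ((1 + h / 24) * v) / h⌉

/-- The cells of the source window, which covers `[-αν, (1-α)ν]` for `ν ∈ [v, (1 + h/24) v]`. -/
noncomputable def sourceWindow (h α v : ℝ) : Finset ℤ :=
  Finset.Ico (sourceLeft h α v - margin v) ⌈(1 - α) * ((1 + h / 24) * v) / h⌉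

/-- The cells of the target window, which is contained in `[-αν, (1-α)ν]` for
`ν ∈ [v, (1 + h/24) v]`. -/
noncomputable def targetWindow (h α v : ℝ) : Finset ℤ :=
  Finset.Ico (-⌊α * v / h⌋) (⌊(1 - α) * v / h⌋ - margin v)

variable {h α v : ℝ}

theorem le_card_sourceWindow (hh : 0 < h) (hv : 0 ≤ v) : v / h ≤ (sourceWindow h α v).card := by
  have h1 := Int.le_ceil (α * ((1 + h / 24) * v) / h)
  have h2 := Int.le_ceil ((1 - α) * ((1 + h / 24) * v) / h)
  have h3 : ((⌈(1 - α) * ((1 + h / 24) * v) / h⌉ - (sourceLeft h α v - margin v) : ℤ) : ℝ) ≤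
      (sourceWindow h α v).card := by
    rw [sourceWindow, Int.card_Ico]
    exact_mod_cast Int.self_le_toNat _
  refine le_trans ?_ h3
  push_cast [sourceLeft]
  have h4 : α * ((1 + h / 24) * v) / h + (1 - α) * ((1 + h / 24) * v) / h = v / h + v / 24 := by
    field_simp; ring
  have h5 : (0 : ℝ) ≤ margin v := by positivity
  linarith

theorem card_sourceWindow_le (hh : 0 < h) (hv : 0 < v) :
    ((sourceWindow h α v).card : ℝ) ≤ v / h + v / 12 + 3 := by
  have h0 := le_card_sourceWindow (α := α) hh hv.le
  have hpos : (0 : ℝ) < (sourceWindow h α v).card := lt_of_lt_of_le (by positivity) h0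
  have h1 := Int.ceil_lt_add_one (α * ((1 + h / 24) * v) / h)
  have h2 := Int.ceil_lt_add_one ((1 - α) * ((1 + h / 24) * v) / h)
  have h3 : ((⌈(1 - α) * ((1 + h / 24) * v) / h⌉ - (sourceLeft h α v - margin v) : ℤ) : ℝ) =
      (sourceWindow h α v).card := by
    rw [sourceWindow, Int.card_Ico] at hpos ⊢
    have : 0 < (⌈(1 - α) * ((1 + h / 24) * v) / h⌉ - (sourceLeft h α v - margin v)).toNat := by
      exact_mod_cast hpos
    have h6 := Int.toNat_of_nonneg (Int.lt_toNat.1 this).le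
    exact_mod_cast h6.symm
  rw [← h3]
  push_cast [sourceLeft]
  have h4 : α * ((1 + h / 24) * v) / h + (1 - α) * ((1 + h / 24) * v) / h = v / h + v / 24 := by
    field_simp; ring
  have h5 : (margin v : ℝ) < v / 24 + 1 := Nat.ceil_lt_add_one (by positivity)
  linarith

theorem le_card_targetWindow (hh : 0 < h) (hv : 0 ≤ v) :
    v / h - v / 24 - 3 ≤ (targetWindow h α v).card := by
  have h1 := Int.lt_floor_add_one (α * v / h)
  have h2 := Int.lt_floor_add_one ((1 - α) * v / h)
  have h3 : ((⌊(1 - α) * v / h⌋ - margin v - -⌊α * v / h⌋ : ℤ) : ℝ) ≤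
      (targetWindow h α v).card := by
    rw [targetWindow, Int.card_Ico]
    exact_mod_cast Int.self_le_toNat _
  refine le_trans ?_ h3
  push_cast
  have h4 : α * v / h + (1 - α) * v / h = v / h := by field_simp; ring
  have h5 : (margin v : ℝ) < v / 24 + 1 := Nat.ceil_lt_add_one (by positivity)
  linarith

theorem half_le_card_targetWindow (hh : 0 < h) (hh1 : h ≤ 1) (hv : 72 ≤ v) :
    v / (2 * h) ≤ (targetWindow h α v).card := by
  refine le_trans ?_ (le_card_targetWindow hh (by linarith))
  have h1 : v / (2 * h) = v / h / 2 := by field_simp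
  have h2 : v ≤ v / h := le_div_self (by linarith) hh hh1
  linarith

theorem card_sourceWindow_le_two (hh : 0 < h) (hh1 : h ≤ 1) (hv : 72 ≤ v) :
    ((sourceWindow h α v).card : ℝ) ≤ 2 * v / h := by
  refine (card_sourceWindow_le hh (by linarith)).trans ?_
  have h1 : 2 * v / h = v / h * 2 := by field_simp
  have h2 : v ≤ v / h := le_div_self (by linarith) hh hh1
  linarith

/-- The margins and the range of `ν` change the number of cells only by a relative amount of order
`h`. The factor `exp (h / 3)` is one that shortening runs by a single cell can afford. -/
theorem card_sourceWindow_le_exp_mul (hh : 0 < h) (hh1 : h ≤ 1) (hv : 72 ≤ v) :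
    ((sourceWindow h α v).card : ℝ) ≤ Real.exp (h / 3) * (targetWindow h α v).card := by
  refine (card_sourceWindow_le hh (by linarith)).trans ?_
  have h1 := Real.add_one_le_exp (h / 3)
  have h2 := le_card_targetWindow (α := α) hh (show 0 ≤ v by linarith)
  have h0 : 0 ≤ v / h - v / 24 - 3 := by
    have h2 : v ≤ v / h := le_div_self (by linarith) hh hh1
    linarith
  refine le_trans ?_ (mul_le_mul h1 h2 h0 (Real.exp_pos _).le)
  have h3 : (h / 3 + 1) * (v / h - v / 24 - 3) =
      v / h + v / 3 - v / 24 - 3 - h * (v / 72 + 1) := by field_simp; ring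
  rw [h3]
  have : h * (v / 72 + 1) ≤ 1 * (v / 72 + 1) := by gcongr
  linarith

/-- The properties of a configuration which hold with high probability and ensure that the
ground state energies of two such configurations are close. -/
structure IsTypical (X : Set ℝ) (h α v : ℝ) (n₀ : ℕ) : Prop where
  few : FewRuns X h (sourceWindow h α v) n₀
  many : ManyRuns X h (targetWindow h α v) n₀
  left : ∃ j ∈ runs X h (sourceWindow h α v) 0, j < sourceLeft h α v
  count : ((runs X h (sourceWindow h α v) 0).card : ℝ) ≤ 16 * v

variable {Ω : Type*} [MeasurableSpace Ω] {P : Measure Ω} {Z : Ω → Set ℝ}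

/-- The left margin has length at least `v h / 24`; the event fails only if it contains no point at
all. -/
theorem measure_left_fail_le [IsProbabilityMeasure P] (hZ : IsPoissonProcess P Z 1) (hh : 0 < h)
    (hα : α ∈ Icc (0 : ℝ) 1) (hv : 0 ≤ v) :
    P {ω | ¬ ∃ j ∈ runs (Z ω) h (sourceWindow h α v) 0, j < sourceLeft h α v} ≤
      ENNReal.ofReal (Real.exp (-(v * h / 24))) := by
  have hD : (0 : ℝ) ≤ margin v := by positivity
  have hD' : v / 24 ≤ margin v := Nat.le_ceil _
  have h1 := hZ.measureReal_empty_Ico (a := (sourceLeft h α v - margin v) * h)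
    (b := sourceLeft h α v * h) (by nlinarith)
  refine (measure_mono (t := {ω | Z ω ∩ Ico ((sourceLeft h α v - margin v) * h)
    (sourceLeft h α v * h) = ∅}) fun ω hω => ?_).trans ?_
  · by_contra hne
    rw [mem_ofPred_eq, ← ne_eq, ← nonempty_iff_ne_empty] at hne
    obtain ⟨x, hxZ, hx1, hx2⟩ := hne
    apply hω
    have hj1 : (⌊x / h⌋ : ℝ) * h ≤ x := (le_div_iff₀ hh).1 (Int.floor_le (x / h))
    have hj2 : x < (⌊x / h⌋ + 1 : ℝ) * h := (div_lt_iff₀ hh).1 (Int.lt_floor_add_one (x / h))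
    have hlt : ⌊x / h⌋ < sourceLeft h α v := by
      rw [Int.floor_lt, div_lt_iff₀ hh]; exact hx2
    have hle : sourceLeft h α v - margin v ≤ ⌊x / h⌋ := by
      rw [Int.le_floor, le_div_iff₀ hh]; push_cast; exact hx1
    have hb : sourceLeft h α v ≤ ⌈(1 - α) * ((1 + h / 24) * v) / h⌉ := by
      have e1 : 0 ≤ ⌈α * ((1 + h / 24) * v) / h⌉ :=
        Int.ceil_nonneg (div_nonneg (mul_nonneg hα.1 (by positivity)) hh.le)
      have e2 : 0 ≤ ⌈(1 - α) * ((1 + h / 24) * v) / h⌉ :=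
        Int.ceil_nonneg (div_nonneg (mul_nonneg (by linarith [hα.2]) (by positivity)) hh.le)
      unfold sourceLeft; omega
    refine ⟨⌊x / h⌋, mem_runs.2 ⟨Finset.mem_Ico.2 ⟨hle, hlt.trans_le hb⟩, ⟨x, hxZ, hj1, hj2⟩, ?_⟩,
      hlt⟩
    simp
  · rw [← ofReal_measureReal, h1]
    apply ENNReal.ofReal_le_ofReal
    apply Real.exp_le_exp.2
    nlinarith

theorem measure_count_fail_le (hZ : IsPoissonProcess P Z 1) (hh : 0 < h) (hh1 : h ≤ 1)
    (hv : 72 ≤ v) :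
    P {ω | ¬ ((runs (Z ω) h (sourceWindow h α v) 0).card : ℝ) ≤ 16 * v} ≤
      ENNReal.ofReal (Real.exp (-v)) := by
  set a := sourceLeft h α v - margin v with ha
  set b := ⌈(1 - α) * ((1 + h / 24) * v) / h⌉ with hb
  have hlow := le_card_sourceWindow (α := α) hh (show 0 ≤ v by linarith)
  have hupp := card_sourceWindow_le_two (α := α) hh hh1 hv
  have hvh : 0 < v / h := by have : 0 < v := by linarith
                             positivity
  have hcard : ((sourceWindow h α v).card : ℝ) = b - a := by
    rw [sourceWindow, ← ha, ← hb, Int.card_Ico] at hlow ⊢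
    have : 0 < (b - a).toNat := by exact_mod_cast hvh.trans_le hlow
    have h6 := Int.toNat_of_nonneg (Int.lt_toNat.1 this).le
    exact_mod_cast h6
  have hvol : (volume (Ico ((a : ℝ) * h) (b * h))).toReal = (sourceWindow h α v).card * h := by
    rw [Real.volume_Ico, ENNReal.toReal_ofReal, hcard]
    · ring
    · rw [← sub_mul, ← hcard]; positivity
  have h1 := hZ.measure_count_gt_le (B := Ico ((a : ℝ) * h) (b * h)) measurableSet_Ico (by simp)
  rw [hvol] at h1
  refine (measure_mono fun ω hω => ?_).trans (h1.trans (ENNReal.ofReal_le_ofReal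
    (Real.exp_le_exp.2 ?_)))
  · simp only [mem_ofPred_eq, not_le] at hω ⊢
    have h2 := card_runs_zero_le (Z ω) hh a b
    have h3 : (((runs (Z ω) h (sourceWindow h α v) 0).card : ℕ) : ℝ≥0∞) ≤
        (((Z ω ∩ Ico ((a : ℝ) * h) (b * h)).encard : ℕ∞) : ℝ≥0∞) := by
      have := ENat.toENNReal_le.2 h2
      rwa [ENat.toENNReal_coe] at this
    refine lt_of_lt_of_le ?_ h3
    rw [← ENNReal.ofReal_natCast]
    refine (ENNReal.ofReal_lt_ofReal_iff (by linarith)).2 (lt_of_le_of_lt ?_ hω)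
    rw [le_div_iff₀ hh] at hupp
    linarith
  · rw [div_le_iff₀ hh] at hlow
    linarith

/-- The two exponential bounds are weakened to the power law of the run counts, so that a single
negative power of `v` serves both Borel-Cantelli and the estimate of the average. -/
theorem exists_measure_not_isTypical_le [IsProbabilityMeasure P] (hZ : IsPoissonProcess P Z 1)
    (hh : 0 < h) (hh1 : h ≤ 1) (hα : α ∈ Icc (0 : ℝ) 1) {n₀ : ℕ} (hn₀ : 2 ≤ n₀) :
    ∃ C : ℝ, 0 < C ∧ ∀ v : ℝ, 72 ≤ v →
      P {ω | ¬ IsTypical (Z ω) h α v n₀} ≤ ENNReal.ofReal (C * v ^ (-(1 / (12 * n₀) : ℝ))) := by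
  obtain ⟨C, hC, hruns⟩ := exists_measure_not_runs_le hZ hh hn₀
  refine ⟨C + C * 2 + 24 / h + 1, by positivity, fun v hv => ?_⟩
  have hv0 : 0 < v := by linarith
  have hn₀' : (2 : ℝ) ≤ n₀ := by exact_mod_cast hn₀
  set θ : ℝ := 1 / (12 * n₀) with hθ
  have hθ0 : 0 ≤ θ := by positivity
  have hθ1 : θ ≤ 1 := by
    rw [hθ, div_le_one (by positivity)]; linarith
  have hvv : v ≤ v / h := le_div_self hv0.le hh hh1
  have hs : v ≤ (sourceWindow h α v).card := hvv.trans (le_card_sourceWindow hh hv0.le)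
  have ht : v / 2 ≤ (targetWindow h α v).card := by
    refine le_trans ?_ (half_le_card_targetWindow hh hh1 hv)
    have : v / (2 * h) = v / h / 2 := by field_simp
    linarith
  have hs' : (sourceWindow h α v).Nonempty := by
    rw [← Finset.card_pos]; exact_mod_cast hv0.trans_le hs
  have ht' : (targetWindow h α v).Nonempty := by
    rw [← Finset.card_pos]
    have : 0 < v / 2 := by linarith
    exact_mod_cast this.trans_le ht
  have hinv : v⁻¹ ≤ v ^ (-θ) := by
    rw [← Real.rpow_neg_one]
    exact Real.rpow_le_rpow_of_exponent_le (by linarith) (by linarith)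
  have hexp : ∀ c : ℝ, 0 < c → Real.exp (-(v * c)) ≤ c⁻¹ * v ^ (-θ) := by
    intro c hc
    have h1 := Real.add_one_le_exp (v * c)
    have h2 : 0 < v * c := by positivity
    calc Real.exp (-(v * c)) = (Real.exp (v * c))⁻¹ := Real.exp_neg _
      _ ≤ (v * c)⁻¹ := by gcongr; linarith
      _ = c⁻¹ * v⁻¹ := by rw [mul_inv, mul_comm]
      _ ≤ _ := by gcongr
  have hsub : {ω | ¬ IsTypical (Z ω) h α v n₀} ⊆
      ((({ω | ¬ FewRuns (Z ω) h (sourceWindow h α v) n₀} ∪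
        {ω | ¬ ManyRuns (Z ω) h (targetWindow h α v) n₀}) ∪
        {ω | ¬ ∃ j ∈ runs (Z ω) h (sourceWindow h α v) 0, j < sourceLeft h α v}) ∪
        {ω | ¬ ((runs (Z ω) h (sourceWindow h α v) 0).card : ℝ) ≤ 16 * v}) := by
    intro ω hω
    by_contra hc
    simp only [mem_union, mem_ofPred_eq, not_or, not_not] at hc
    exact hω ⟨hc.1.1.1, hc.1.1.2, hc.1.2, hc.2⟩
  have hvθ : 0 < v ^ (-θ) := by positivity
  calc P {ω | ¬ IsTypical (Z ω) h α v n₀} ≤ _ := measure_mono hsub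
    _ ≤ ENNReal.ofReal (C * v ^ (-θ)) + ENNReal.ofReal (C * 2 * v ^ (-θ)) +
        ENNReal.ofReal (24 / h * v ^ (-θ)) + ENNReal.ofReal (1 * v ^ (-θ)) := by
      refine (measure_union_le _ _).trans (add_le_add ((measure_union_le _ _).trans
        (add_le_add ((measure_union_le _ _).trans (add_le_add ?_ ?_)) ?_)) ?_)
      · refine (hruns _ hs').1.trans (ENNReal.ofReal_le_ofReal ?_)
        refine mul_le_mul_of_nonneg_left ?_ hC.le
        exact Real.rpow_le_rpow_of_nonpos hv0 hs (by linarith)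
      · refine (hruns _ ht').2.trans (ENNReal.ofReal_le_ofReal ?_)
        rw [mul_assoc]
        refine mul_le_mul_of_nonneg_left ?_ hC.le
        refine (Real.rpow_le_rpow_of_nonpos (by positivity) ht (by linarith)).trans ?_
        rw [Real.div_rpow hv0.le (by norm_num), div_eq_inv_mul, ← Real.rpow_neg (by norm_num),
          neg_neg]
        gcongr
        calc (2 : ℝ) ^ θ ≤ 2 ^ (1 : ℝ) :=
              Real.rpow_le_rpow_of_exponent_le (by norm_num) hθ1
          _ = 2 := Real.rpow_one 2
      · refine (measure_left_fail_le hZ hh hα hv0.le).trans (ENNReal.ofReal_le_ofReal ?_)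
        have := hexp (h / 24) (by positivity)
        rw [inv_div] at this
        rwa [mul_div_assoc]
      · refine (measure_count_fail_le hZ hh hh1 hv).trans (ENNReal.ofReal_le_ofReal ?_)
        have := hexp 1 one_pos
        simpa using this
    _ = _ := by
      rw [← ENNReal.ofReal_add (by positivity) (by positivity),
        ← ENNReal.ofReal_add (by positivity) (by positivity),
        ← ENNReal.ofReal_add (by positivity) (by positivity)]
      congr 1; ring

/-- Along a geometric sequence even a small negative power of the scale is summable, so
Borel-Cantelli applies. The windows at scale `v` serve all densities up to the next scale. -/
theorem ae_eventually_isTypical [IsProbabilityMeasure P] (hZ : IsPoissonProcess P Z 1)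
    (hh : 0 < h) (hh1 : h ≤ 1) (hα : α ∈ Icc (0 : ℝ) 1) {n₀ : ℕ} (hn₀ : 2 ≤ n₀) :
    ∀ᵐ ω ∂P, ∀ᶠ k : ℕ in atTop, IsTypical (Z ω) h α ((1 + h / 24) ^ k) n₀ := by
  obtain ⟨C, hC, hP⟩ := exists_measure_not_isTypical_le hZ hh hh1 hα hn₀
  have hn₀' : (2 : ℝ) ≤ n₀ := by exact_mod_cast hn₀
  have hr : 1 < 1 + h / 24 := by have : 0 < h / 24 := by positivity
                                 linarith
  obtain ⟨k₀, hk₀⟩ := ((tendsto_pow_atTop_atTop_of_one_lt hr).eventually_ge_atTop 72).exists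
  set θ : ℝ := 1 / (12 * n₀) with hθ
  have hθ0 : 0 < θ := by positivity
  have hρ0 : 0 < (1 + h / 24) ^ (-θ) := by positivity
  have hρ1 : (1 + h / 24) ^ (-θ) < 1 := Real.rpow_lt_one_of_one_lt_of_neg hr (by linarith)
  have hsum : ∑' k : ℕ, P {ω | ¬ IsTypical (Z ω) h α ((1 + h / 24) ^ (k + k₀)) n₀} ≠ ⊤ := by
    refine ne_top_of_le_ne_top ?_ (ENNReal.tsum_le_tsum fun k => hP _ ?_)
    · have : ∀ k : ℕ, C * ((1 + h / 24) ^ (k + k₀)) ^ (-θ) =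
          C * ((1 + h / 24) ^ (-θ)) ^ k₀ * ((1 + h / 24) ^ (-θ)) ^ k := by
        intro k
        rw [← Real.rpow_natCast, ← Real.rpow_mul (by positivity), mul_comm ((k + k₀ : ℕ) : ℝ),
          Real.rpow_mul (by positivity), Real.rpow_natCast, pow_add]
        ring
      simp_rw [this]
      rw [← ENNReal.ofReal_tsum_of_nonneg (fun k => by positivity)
        ((summable_geometric_of_lt_one hρ0.le hρ1).mul_left _)]
      exact ENNReal.ofReal_ne_top
    · exact hk₀.trans (pow_le_pow_right₀ hr.le (Nat.le_add_left _ _))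
  filter_upwards [ae_eventually_notMem hsum] with ω hω
  rw [← map_add_atTop_eq_nat k₀, eventually_map]
  filter_upwards [hω] with k hk
  simpa using hk

end Windows

/-! ### Energies of typical configurations -/

section Comparison

variable {X X' : Set ℝ} {h α v ν γ : ℝ} {n₀ : ℕ}

/-- The logarithmic factor relating the length scale of the ground state to the mean spacing of
the obstacles. -/
noncomputable def logLength (γ ν : ℝ) : ℝ := 1 + Real.log (1 + ν ^ 2 / γ)

theorem one_le_logLength (hγ : 0 < γ) (ν : ℝ) : 1 ≤ logLength γ ν := by
  have : 0 ≤ Real.log (1 + ν ^ 2 / γ) := Real.log_nonneg (by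
    have : 0 ≤ ν ^ 2 / γ := by positivity
    linarith)
  unfold logLength
  linarith

theorem exp_logLength (hγ : 0 < γ) (ν : ℝ) :
    Real.exp (logLength γ ν) = Real.exp 1 * (1 + ν ^ 2 / γ) := by
  rw [logLength, Real.exp_add, Real.exp_log (by positivity)]

/-- One run already forces `1 ≤ |T| exp (-n h) exp (h (n / n₀) / 3)`. As `n₀ ≥ 2`, the last factor
costs at most one sixth of `n h`, whence `5 / 6`. -/
theorem FewRuns.le_log_of_nonempty {T : Finset ℤ} (hh : 0 < h) (hn₀ : 2 ≤ n₀)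
    (hf : FewRuns X h T n₀) {n : ℕ} (hn : n₀ ≤ n) (hne : (runs X h T n).Nonempty) :
    5 / 6 * (n * h) ≤ Real.log T.card := by
  have h1 : (1 : ℝ) ≤ (runs X h T n).card := by exact_mod_cast hne.card_pos
  have hT : (0 : ℝ) < T.card := by
    have := hne.mono (fun j hj => (mem_runs.1 hj).1)
    exact_mod_cast this.card_pos
  have h2 := h1.trans (hf n hn)
  have hτ : ((n / n₀ : ℕ) : ℝ) ≤ n / 2 := by
    have h3 : n / n₀ ≤ n / 2 := Nat.div_le_div_left hn₀ two_pos
    have h4 : ((n / 2 : ℕ) : ℝ) ≤ n / 2 := Nat.cast_div_le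
    exact le_trans (by exact_mod_cast h3) h4
  have h5 : expectedRuns h T.card n * Real.exp (h * (n / n₀ : ℕ) / 3) ≤
      T.card * Real.exp (-(5 / 6 * (n * h))) := by
    have h6 : (1 - Real.exp (-h)) * Real.exp (-(n * h)) * Real.exp (h * (n / n₀ : ℕ) / 3) ≤
        Real.exp (-(n * h)) * Real.exp (h * (n / 2) / 3) := by
      have h7 : 1 - Real.exp (-h) ≤ 1 := by linarith [Real.exp_pos (-h)]
      have h8 : Real.exp (h * (n / n₀ : ℕ) / 3) ≤ Real.exp (h * (n / 2) / 3) := by gcongr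
      refine mul_le_mul ?_ h8 (Real.exp_pos _).le (Real.exp_pos _).le
      exact mul_le_of_le_one_left (Real.exp_pos _).le h7
    rw [← Real.exp_add] at h6
    rw [expectedRuns, mul_assoc]
    gcongr
    refine h6.trans (Real.exp_le_exp.2 ?_)
    linarith
  have h6 := h2.trans h5
  rw [Real.exp_neg, ← div_eq_mul_inv, one_le_div (Real.exp_pos _)] at h6
  exact (Real.le_log_iff_exp_le hT).2 h6

theorem IsTypical.le_log_of_nonempty (hh : 0 < h) (hh1 : h ≤ 1) (hn₀ : 2 ≤ n₀) (hv : 72 ≤ v)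
    (hX : IsTypical X h α v n₀) {n : ℕ} (hn : n₀ ≤ n)
    (hne : (runs X h (sourceWindow h α v) n).Nonempty) :
    5 / 6 * (n * h) ≤ Real.log (2 * v / h) := by
  refine (hX.few.le_log_of_nonempty hh hn₀ hn hne).trans (Real.log_le_log ?_
    (card_sourceWindow_le_two hh hh1 hv))
  have := hne.mono (fun j hj => (mem_runs.1 hj).1)
  exact_mod_cast this.card_pos

/-- This is the counting condition for Hall's theorem. The gain `exp (h (n / n₀))` from shortening
is spent in thirds: on the excess of runs in `X`, on the different window sizes, and on the deficit
of runs in `X'`. If `X` has a run at all, the expected number is large enough for `ManyRuns` to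
apply, because `exp (h / 3) ≤ 2`. -/
theorem IsTypical.card_runs_le (hh : 0 < h) (hh1 : h ≤ 1) (hn₀ : 2 ≤ n₀) (hv : 72 ≤ v)
    (hX : IsTypical X h α v n₀) (hX' : IsTypical X' h α v n₀) {n : ℕ} (hn : n₀ ≤ n) :
    (runs X h (sourceWindow h α v) n).card ≤
      (runs X' h (targetWindow h α v) (n - n / n₀)).card := by
  rcases (runs X h (sourceWindow h α v) n).eq_empty_or_nonempty with he | hne
  · rw [he]; simp
  have h1 : (1 : ℝ) ≤ (runs X h (sourceWindow h α v) n).card := by exact_mod_cast hne.card_pos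
  have h2 := hX.few n hn
  have hp : 0 ≤ 1 - Real.exp (-h) := by
    have := Real.exp_le_one_iff.2 (show -h ≤ 0 by linarith)
    linarith
  have h3 : expectedRuns h (sourceWindow h α v).card n ≤
      Real.exp (h / 3) * expectedRuns h (targetWindow h α v).card n := by
    unfold expectedRuns
    rw [← mul_assoc (Real.exp (h / 3))]
    exact mul_le_mul_of_nonneg_right (card_sourceWindow_le_exp_mul hh hh1 hv) (by positivity)
  set r := expectedRuns h (sourceWindow h α v).card n
  set r' := expectedRuns h (targetWindow h α v).card n with hr'
  have hr0 : 0 ≤ r' := by rw [hr']; unfold expectedRuns; positivity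
  set τ : ℝ := ((n / n₀ : ℕ) : ℝ) with hτdef
  have hτ : 1 ≤ τ := by
    have : 1 ≤ n / n₀ := (Nat.one_le_div_iff (by omega)).2 hn
    rw [hτdef]
    exact_mod_cast this
  have h4 : r * Real.exp (h * τ / 3) ≤ Real.exp (h / 3) * r' * Real.exp (h * τ / 3) := by gcongr
  have h5 : Real.exp (h / 3) ≤ 2 := by
    have h6 : Real.exp (h / 3) ≤ Real.exp (Real.log 2) := Real.exp_le_exp.2 (by
      have := Real.log_two_gt_d9
      linarith)
    rwa [Real.exp_log two_pos] at h6
  have hr1 : 0 ≤ r' * Real.exp (h * τ / 3) := by positivity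
  have h6 := hX'.many n hn (by
    have : Real.exp (h / 3) * (r' * Real.exp (h * τ / 3)) ≤ 2 * (r' * Real.exp (h * τ / 3)) := by
      gcongr
    linarith)
  have h7 : Real.exp (h / 3) * r' * Real.exp (h * τ / 3) ≤ r' * Real.exp (2 * h * τ / 3) := by
    rw [mul_comm (Real.exp (h / 3)), mul_assoc, ← Real.exp_add]
    gcongr
    nlinarith
  exact_mod_cast (h2.trans (h4.trans (h7.trans h6)))

theorem add_one_mul_le_of_lt_sourceLeft (hh : 0 < h) (hα : 0 ≤ α) (hν : ν ≤ (1 + h / 24) * v)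
    {j : ℤ} (hj : j < sourceLeft h α v) : (j + 1) * h ≤ -(α * ν) := by
  have h1 : (j : ℝ) + 1 ≤ sourceLeft h α v := by exact_mod_cast hj
  have h2 := Int.le_ceil (α * ((1 + h / 24) * v) / h)
  rw [div_le_iff₀ hh] at h2
  have h3 : ((sourceLeft h α v : ℤ) : ℝ) * h ≤ -(α * ((1 + h / 24) * v)) := by
    rw [sourceLeft]; push_cast; linarith
  have h4 : α * ν ≤ α * ((1 + h / 24) * v) := by gcongr
  nlinarith

theorem mul_le_sourceWindow_right (hh : 0 < h) (hα : α ≤ 1) (hν : ν ≤ (1 + h / 24) * v) :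
    (1 - α) * ν ≤ (⌈(1 - α) * ((1 + h / 24) * v) / h⌉ : ℝ) * h := by
  have h2 := Int.le_ceil ((1 - α) * ((1 + h / 24) * v) / h)
  rw [div_le_iff₀ hh] at h2
  have h4 : (1 - α) * ν ≤ (1 - α) * ((1 + h / 24) * v) := by
    have : 0 ≤ 1 - α := by linarith
    gcongr
  linarith

theorem neg_mul_le_targetWindow_left (hh : 0 < h) (hα : 0 ≤ α) (hν : v ≤ ν) :
    -(α * ν) ≤ ((-⌊α * v / h⌋ : ℤ) : ℝ) * h := by
  have h2 := Int.floor_le (α * v / h)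
  rw [le_div_iff₀ hh] at h2
  have h4 : α * v ≤ α * ν := by gcongr
  push_cast
  linarith

theorem targetWindow_right_mul_le (hh : 0 < h) (hα : α ≤ 1) (hν : v ≤ ν) :
    (((⌊(1 - α) * v / h⌋ - margin v : ℤ) : ℝ) + margin v) * h ≤ (1 - α) * ν := by
  have h2 := Int.floor_le ((1 - α) * v / h)
  rw [le_div_iff₀ hh] at h2
  have h4 : (1 - α) * v ≤ (1 - α) * ν := by
    have : 0 ≤ 1 - α := by linarith
    gcongr
  push_cast
  rw [sub_add_cancel]
  linarith

theorem le_margin (v : ℝ) : v / 24 ≤ margin v := Nat.le_ceil _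

/-- The ground state energy for hard obstacles is at least of order `(ν / log ν) ^ 2`. -/
theorem IsTypical.le_groundEnergy (hh : 0 < h) (hh1 : h ≤ 1) (hα : α ∈ Icc (0 : ℝ) 1)
    (hn₀ : 2 ≤ n₀) (hn₀h : n₀ * h ≤ 1) (hv : 72 ≤ v) (hX : IsTypical X h α v n₀) (hν : v ≤ ν)
    (hν' : ν ≤ (1 + h / 24) * v) :
    ENNReal.ofReal ((ν / (2 * Real.log (2 * v / h) + 4)) ^ 2) ≤
      groundEnergy (rescale X α ν) ⊤ γ := by
  obtain ⟨j₀, hj₀, hlt⟩ := hX.left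
  have hL : 0 ≤ Real.log (2 * v / h) := Real.log_nonneg (by
    rw [le_div_iff₀ hh]; linarith)
  set L := Real.log (2 * v / h) with hLdef
  -- Runs of `n ≥ n₀` cells satisfy `5 / 6 * (n * h) ≤ L`, so none has `n₀ + k + 1` cells.
  set k := ⌊6 / 5 * L / h⌋₊ with hk
  have hk1 : (k : ℝ) * h ≤ 6 / 5 * L := by
    rw [← le_div_iff₀ hh]; exact Nat.floor_le (by positivity)
  have hk2 : 6 / 5 * L < (k + 1) * h := by
    rw [← div_lt_iff₀ hh]; exact Nat.lt_floor_add_one _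
  have hempty : runs X h (sourceWindow h α v) (n₀ + k + 1) = ∅ := by
    by_contra hne
    have := hX.le_log_of_nonempty hh hh1 hn₀ hv (n := n₀ + k + 1) (by omega)
      (Finset.nonempty_iff_ne_empty.2 hne)
    push_cast at this
    have h0 : (0 : ℝ) ≤ n₀ * h := by positivity
    rw [← hLdef] at this
    nlinarith
  refine le_trans (ENNReal.ofReal_le_ofReal ?_) (le_groundEnergy_rescale hh (by linarith) hj₀
    (add_one_mul_le_of_lt_sourceLeft hh hα.1 hν' hlt) (mul_le_sourceWindow_right hh hα.2 hν')
    hempty)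
  have hν0 : 0 ≤ ν := by linarith
  gcongr
  push_cast
  nlinarith

/-- For `γ ≥ 1` the exponential of `logLength` is at most of order `v²`, so its fourth root is well
below `v`. It follows that gaps of unscaled length `l / 4` do occur. -/
theorem exp_logLength_le (hv : 72 ≤ v) (hν : v ≤ ν) (hν' : ν ≤ 2 * v) (hγ : 1 ≤ γ) :
    Real.exp (logLength γ ν / 4) ≤ v / 2 := by
  have h1 : Real.exp (logLength γ ν) ≤ (v / 2) ^ 4 := by
    rw [exp_logLength (by linarith)]
    have h2 : ν ^ 2 / γ ≤ (2 * v) ^ 2 :=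
      (div_le_self (by positivity) hγ).trans (by
        have : 0 ≤ ν := by linarith
        gcongr)
    have h3 := Real.exp_one_lt_three
    have h4 : Real.exp 1 * (1 + ν ^ 2 / γ) ≤ 3 * (1 + (2 * v) ^ 2) := by
      have : 0 ≤ ν ^ 2 / γ := by positivity
      gcongr
    have h5 : (72 : ℝ) ^ 2 ≤ v ^ 2 := by gcongr
    nlinarith
  have h2 : Real.exp (logLength γ ν) = Real.exp (logLength γ ν / 4) ^ 4 := by
    rw [← Real.exp_nat_mul]; congr 1; push_cast; ring
  rw [h2] at h1
  exact (pow_le_pow_iff_left₀ (Real.exp_pos _).le (by linarith) (by norm_num)).1 h1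

/-- Here `γ exp l` is of order `ν²`, so `γ exp (l / 4)` is of order `ν² exp (-3 l / 4)`, and this
exponential is smaller than `1 / l`. The interaction term is thus no larger in order than the
kinetic one. -/
theorem add_energy_le_of_le_sq (hν : 0 < ν) (hγ : 0 < γ) (hγν : γ ≤ ν ^ 2) :
    8192 * ν ^ 2 / logLength γ ν ^ 2 +
      4096 * γ * Real.exp (logLength γ ν / 4) / logLength γ ν ≤
      50000 * ν ^ 2 / logLength γ ν ^ 2 := by
  have h1 := one_le_logLength hγ ν
  have h2 := exp_logLength hγ ν
  set l := logLength γ ν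
  have h3 : Real.exp l * γ ≤ 2 * Real.exp 1 * ν ^ 2 := by
    rw [h2]
    have : Real.exp 1 * (1 + ν ^ 2 / γ) * γ = Real.exp 1 * (γ + ν ^ 2) := by field_simp
    rw [this]
    nlinarith [Real.exp_pos 1]
  have h4 : 3 / 4 * l + 1 ≤ Real.exp (3 / 4 * l) := Real.add_one_le_exp _
  have h5 : Real.exp l = Real.exp (l / 4) * Real.exp (3 / 4 * l) := by
    rw [← Real.exp_add]; congr 1; ring
  have h6 := Real.exp_one_lt_d9
  have h7 : γ * Real.exp (l / 4) * l ≤ 8 * ν ^ 2 := by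
    have h8 : γ * Real.exp (l / 4) * (3 / 4 * l) ≤ γ * Real.exp (l / 4) * Real.exp (3 / 4 * l) := by
      gcongr; linarith
    have h9 : γ * Real.exp (l / 4) * Real.exp (3 / 4 * l) = Real.exp l * γ := by rw [h5]; ring
    rw [h9] at h8
    nlinarith [sq_nonneg ν]
  have h8 : 4096 * γ * Real.exp (l / 4) / l = 4096 * (γ * Real.exp (l / 4) * l) / l ^ 2 := by
    field_simp
  rw [h8, ← add_div]
  gcongr
  linarith [sq_nonneg ν]

theorem add_energy_le_of_sq_le (hγ : 0 < γ) (hγν : ν ^ 2 ≤ γ) :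
    8192 * ν ^ 2 / logLength γ ν ^ 2 +
      4096 * γ * Real.exp (logLength γ ν / 4) / logLength γ ν ≤ 50000 * γ := by
  have h1 := one_le_logLength hγ ν
  have h2 := exp_logLength hγ ν
  set l := logLength γ ν
  have h3 : Real.exp (l / 4) ≤ 6 := by
    have h4 : ν ^ 2 / γ ≤ 1 := (div_le_one hγ).2 hγν
    have h5 := Real.exp_one_lt_three
    have h6 : Real.exp (l / 4) ≤ Real.exp l := Real.exp_le_exp.2 (by linarith)
    have h7 : 0 ≤ ν ^ 2 / γ := by positivity
    rw [h2] at h6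
    nlinarith
  have h4 : 8192 * ν ^ 2 / l ^ 2 ≤ 8192 * γ := by
    refine (div_le_self (by positivity) (one_le_pow₀ h1)).trans ?_
    gcongr
  have h5 : 4096 * γ * Real.exp (l / 4) / l ≤ 4096 * γ * 6 := by
    refine (div_le_self (by positivity) h1).trans ?_
    gcongr
  linarith

/-- Tents are placed in the gaps of unscaled length of order `l`, at most `l / 4`. There are at
least `ν exp (-l / 4) / 8` of them by `ManyRuns`; the length gives the kinetic term and the number
gives the interaction term. -/
theorem IsTypical.groundEnergy_le_add (hh : 0 < h) (hh1 : h ≤ 1) (hα : α ∈ Icc (0 : ℝ) 1)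
    (hn₀ : 2 ≤ n₀) (hn₀h : 4 * (n₀ * h) ≤ 1) (hv : 72 ≤ v)
    (hlog : 2 * Real.log (2 * v / h) ≤ h * (v / 24))
    (hX : IsTypical X h α v n₀) (hν : v ≤ ν) (hν' : ν ≤ (1 + h / 24) * v) (hγ : 1 ≤ γ) :
    groundEnergy (rescale X α ν) ⊤ γ ≤ ENNReal.ofReal (8192 * ν ^ 2 / logLength γ ν ^ 2 +
      4096 * γ * Real.exp (logLength γ ν / 4) / logLength γ ν) := by
  have hν2 : ν ≤ 2 * v := by nlinarith
  have hv0 : 0 < v := by linarith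
  have hν0 : 0 < ν := by linarith
  have hγ0 : 0 < γ := by linarith
  have hexp := exp_logLength_le hv hν hν2 hγ
  have hl1 := one_le_logLength hγ0 ν
  set l := logLength γ ν
  -- Rounding down and then shortening by `n / n₀` each lose at most a factor two, so the runs used
  -- have length at least `l / 16`.
  set n := ⌊l / (4 * h)⌋₊ with hndef
  have hn₀n : n₀ ≤ n := by
    refine Nat.le_floor ?_
    rw [le_div_iff₀ (by positivity)]
    linarith
  have hn1 : n * h ≤ l / 4 := by
    have : (n : ℝ) ≤ l / (4 * h) := Nat.floor_le (by positivity)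
    rw [le_div_iff₀ (by positivity)] at this
    linarith
  have hn2 : l / 8 ≤ n * h := by
    have h1 : l / (4 * h) < n + 1 := Nat.lt_floor_add_one _
    rw [div_lt_iff₀ (by positivity)] at h1
    have h2 : (1 : ℝ) ≤ n := by exact_mod_cast (show 1 ≤ n by omega)
    nlinarith
  have hτ : n / n₀ ≤ n / 2 := Nat.div_le_div_left hn₀ two_pos
  have ha : n ≤ 2 * (n - n / n₀) := by omega
  have ha' : l / 16 ≤ ((n - n / n₀ : ℕ) : ℝ) * h := by
    have : (n : ℝ) ≤ 2 * ((n - n / n₀ : ℕ) : ℝ) := by exact_mod_cast ha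
    nlinarith
  have hexpn : Real.exp (-(l / 4)) ≤ Real.exp (-(n * h)) := Real.exp_le_exp.2 (by linarith)
  have hp : h / 2 ≤ 1 - Real.exp (-h) := by
    have h1 : Real.exp (-h) * (1 + h) ≤ 1 := by
      have h2 := Real.add_one_le_exp h
      have h3 : Real.exp (-h) * Real.exp h = 1 := by rw [← Real.exp_add]; simp
      nlinarith [Real.exp_pos (-h)]
    nlinarith [Real.exp_pos (-h)]
  have hr : v / 4 * Real.exp (-(l / 4)) ≤ expectedRuns h (targetWindow h α v).card n := by
    have h1 := half_le_card_targetWindow (α := α) hh hh1 hv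
    have h2 : v / 4 = v / (2 * h) * (h / 2) := by field_simp; ring
    have hp0 : 0 ≤ 1 - Real.exp (-h) := by linarith
    rw [expectedRuns, h2, mul_assoc]
    gcongr
  set r := expectedRuns h (targetWindow h α v).card n with hrdef
  have hhalf : 1 / 2 ≤ v / 4 * Real.exp (-(l / 4)) := by
    rw [Real.exp_neg, ← div_eq_mul_inv, le_div_iff₀ (Real.exp_pos _)]
    linarith
  have hr0 : 0 < r := by linarith
  have hτ0 : (0 : ℝ) ≤ (n / n₀ : ℕ) := by positivity
  have hM := hX.many n hn₀n (by
    have := le_mul_of_one_le_right hr0.le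
      (Real.one_le_exp (show 0 ≤ h * (n / n₀ : ℕ) / 3 by positivity))
    linarith)
  have hM' : ν / 8 * Real.exp (-(l / 4)) ≤
      ((runs X h (targetWindow h α v) (n - n / n₀)).card : ℝ) := by
    have := le_mul_of_one_le_right hr0.le
      (Real.one_le_exp (show 0 ≤ 2 * h * (n / n₀ : ℕ) / 3 by positivity))
    have h3 : ν / 8 * Real.exp (-(l / 4)) ≤ v / 4 * Real.exp (-(l / 4)) := by
      gcongr ?_ * _
      linarith
    linarith
  have hne : (runs X h (targetWindow h α v) (n - n / n₀)).Nonempty := by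
    rw [← Finset.card_pos]
    have : (0 : ℝ) < ((runs X h (targetWindow h α v) (n - n / n₀)).card : ℝ) :=
      lt_of_lt_of_le (by positivity) hM'
    exact_mod_cast this
  have hnD : n - n / n₀ ≤ margin v := by
    have h1 : l / 4 ≤ Real.log (v / 2) := (Real.le_log_iff_exp_le (by linarith)).2 hexp
    have h2 : Real.log (v / 2) ≤ Real.log (2 * v / h) := by
      refine Real.log_le_log (by linarith) ?_
      rw [le_div_iff₀ hh]; nlinarith
    have h3 : (n : ℝ) * h ≤ h * (v / 24) := by linarith
    have h4 : (n : ℝ) ≤ v / 24 := by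
      rw [mul_comm h] at h3
      exact le_of_mul_le_mul_right h3 hh
    have h5 : n ≤ margin v := by exact_mod_cast h4.trans (le_margin v)
    exact (Nat.sub_le _ _).trans h5
  have hU := groundEnergy_rescale_le_runs (γ := γ) hh hν0
    (neg_mul_le_targetWindow_left hh hα.1 hν) (targetWindow_right_mul_le hh hα.2 hν)
    (show 0 < n - n / n₀ by omega) hnD hne
  refine hU.trans ?_
  set a : ℝ := ((n - n / n₀ : ℕ) : ℝ) with hadef
  set M : ℝ := ((runs X h (targetWindow h α v) (n - n / n₀)).card : ℝ) with hMdef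
  rw [← targetWindow, ← hMdef, ← ENNReal.ofReal_mul (by positivity),
    ← ENNReal.ofReal_add (by positivity) (by positivity)]
  apply ENNReal.ofReal_le_ofReal
  have hl0 : 0 < l := by linarith
  have hah : 0 < a * h := lt_of_lt_of_le (by positivity) ha'
  have hM0 : 0 < M := lt_of_lt_of_le (by positivity) hM'
  refine add_le_add ?_ ?_
  · have h1 : 8 / (a * h / (2 * ν)) ^ 2 = 32 * ν ^ 2 / (a * h) ^ 2 := by field_simp; norm_num
    have h2 : 8192 * ν ^ 2 / l ^ 2 = 32 * ν ^ 2 / (l / 16) ^ 2 := by field_simp; norm_num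
    rw [h1, h2]
    gcongr
  · have h1 : γ / 2 * (32 / (M * (a * h / (2 * ν)))) = 32 * γ * ν / (M * (a * h)) := by
      field_simp
    have h2 : 4096 * γ * Real.exp (l / 4) / l =
        32 * γ * ν / (ν / 8 * Real.exp (-(l / 4)) * (l / 16)) := by
      rw [Real.exp_neg]; field_simp; norm_num
    rw [h1, h2]
    gcongr

/-- The ground state energy for hard obstacles of a typical configuration is almost bounded by
the one of any other typical configuration with sufficiently strong obstacles. -/
theorem IsTypical.groundEnergy_le (hh : 0 < h) (hh1 : h ≤ 1) (hα : α ∈ Icc (0 : ℝ) 1)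
    (hn₀ : 2 ≤ n₀) {δ : ℝ} (hδ : 0 < δ) (hδ1 : δ ≤ 1 / 2) (hn₀δ : 3 ≤ δ * (n₀ + 2))
    (hn₀h : (n₀ + 2) * h ≤ δ ^ 2 / 3200000) (hv : 72 ≤ v)
    (hlog : 2 * Real.log (2 * v / h) ≤ h * (v / 24))
    (hX : IsTypical X h α v n₀) (hX' : IsTypical X' h α v n₀)
    (hν : v ≤ ν) (hν' : ν ≤ (1 + h / 24) * v) (hγ : 1 ≤ γ) {σ : ℝ≥0∞}
    (hσ : ENNReal.ofReal ((1 + δ⁻¹) * (8 / (δ ^ 2 / 6400000)) * (ν / logLength γ ν)) ≤ σ) :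
    groundEnergy (rescale X' α ν) ⊤ γ ≤
      ENNReal.ofReal (((1 - δ) ^ 5)⁻¹) * groundEnergy (rescale X α ν) σ γ := by
  have hν2 : ν ≤ 2 * v := by nlinarith
  have hv0 : 0 < v := by linarith
  have hν0 : 0 < ν := by linarith
  have hγ0 : 0 < γ := by linarith
  have hδ2 : δ ^ 2 ≤ 1 := by nlinarith
  have hn₀h' : 4 * (n₀ * h) ≤ 1 := by nlinarith
  have hU := hX'.groundEnergy_le_add hh hh1 hα hn₀ hn₀h' hv hlog hν hν' hγ
  have hl1 := one_le_logLength hγ0 ν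
  have hU1 := add_energy_le_of_le_sq hν0 hγ0
  have hU2 := add_energy_le_of_sq_le (ν := ν) hγ0
  have hlarge : ν ^ 2 ≤ γ → logLength γ ν ≤ 2 := by
    intro hle
    have h1 : ν ^ 2 / γ ≤ 1 := (div_le_one hγ0).2 hle
    have h2 : Real.log (1 + ν ^ 2 / γ) ≤ 1 + ν ^ 2 / γ - 1 :=
      Real.log_le_sub_one_of_pos (by positivity)
    unfold logLength
    linarith
  set l := logLength γ ν
  -- The cut-off width is `w = η l / ν`. The constant makes the lost mass at most `δ` in both
  -- regimes below, and `hn₀h` says `(n₀ + 2) * h ≤ 2 * η`, so gaps longer than `2 * w` contain at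
  -- least `n₀` empty cells.
  set η := δ ^ 2 / 6400000 with hη
  have hη0 : 0 < η := by positivity
  have hl0 : 0 < l := by linarith
  set w := η * l / ν with hw
  have hw0 : 0 < w := by positivity
  obtain ⟨j₀, hj₀, hlt⟩ := hX.left
  have hδn : ENNReal.ofReal δ = ((δ.toNNReal : ℝ≥0) : ℝ≥0∞) := rfl
  have hmain := groundEnergy_rescale_le (X := X) (X' := X') (σ := σ) (γ := γ) (w := w)
    (e := δ.toNNReal) (m := ENNReal.ofReal (1 - δ)) (μ := ENNReal.ofReal δ)
    hh hν0 hγ0 hn₀ hj₀ (add_one_mul_le_of_lt_sourceLeft hh hα.1 hν' hlt)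
    (mul_le_sourceWindow_right hh hα.2 hν') (neg_mul_le_targetWindow_left hh hα.1 hν)
    (targetWindow_right_mul_le hh hα.2 hν)
    (fun n hn => hX.card_runs_le hh hh1 hn₀ hv hX' hn)
    (fun n hn hne => by
      have h1 := hX.le_log_of_nonempty hh hh1 hn₀ hv hn hne
      have h0 : (0 : ℝ) ≤ n * h := by positivity
      have h3 : (n : ℝ) * h ≤ v / 24 * h := by linarith
      exact_mod_cast (le_of_mul_le_mul_right h3 hh).trans (le_margin v))
    (by
      have : 2 * w * ν = 2 * η * l := by rw [hw]; field_simp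
      rw [this, hη]
      nlinarith)
    (by simpa using hδ) (by simp; linarith)
    (by
      rw [← ENNReal.ofReal_add (by linarith) hδ.le]
      simp)
    (by
      refine le_trans (le_of_eq ?_) hσ
      rw [← hδn, ← ENNReal.ofReal_inv_of_pos hδ, ← ENNReal.ofReal_inv_of_pos hw0,
        ← ENNReal.ofReal_one, ← ENNReal.ofReal_add (by norm_num) (by positivity),
        ← ENNReal.ofReal_ofNat, ← ENNReal.ofReal_mul (by norm_num),
        ← ENNReal.ofReal_mul (by positivity)]
      congr 1
      rw [hw]
      field_simp)
    (by
      -- For `γ ≤ ν²` the energy is of order `ν² / l²` and the kinetic criterion gives lost mass of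
      -- order `η²`. For `γ ≥ ν²` the energy is of order `γ`, `l ≤ 2` and there are at most `16 ν`
      -- gaps, so the interaction criterion applies.
      rcases le_total γ (ν ^ 2) with hle | hle
      · left
        calc 4 * ENNReal.ofReal w ^ 2 * groundEnergy (rescale X' α ν) ⊤ γ ≤
            4 * ENNReal.ofReal w ^ 2 * ENNReal.ofReal (50000 * ν ^ 2 / l ^ 2) := by
              gcongr
              exact hU.trans (ENNReal.ofReal_le_ofReal (hU1 hle))
          _ = ENNReal.ofReal (4 * w ^ 2 * (50000 * ν ^ 2 / l ^ 2)) := by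
              rw [ENNReal.ofReal_mul (by positivity), ENNReal.ofReal_mul (by norm_num),
                ENNReal.ofReal_pow hw0.le, ENNReal.ofReal_ofNat]
          _ ≤ _ := by
              apply ENNReal.ofReal_le_ofReal
              have : 4 * w ^ 2 * (50000 * ν ^ 2 / l ^ 2) = 200000 * η ^ 2 := by
                rw [hw]; field_simp; norm_num
              rw [this, hη]
              have : (δ ^ 2 / 6400000) ^ 2 = δ * δ ^ 3 / 6400000 ^ 2 := by ring
              have h3 : δ ^ 3 ≤ 1 := pow_le_one₀ hδ.le (by linarith)
              rw [this]
              nlinarith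
      · right
        have hcount : (((runs X h (sourceWindow h α v) 0).card : ℕ) : ℝ≥0∞) ≤
            ENNReal.ofReal (16 * ν) := by
          rw [← ENNReal.ofReal_natCast]
          apply ENNReal.ofReal_le_ofReal
          linarith [hX.count]
        calc 4 * ENNReal.ofReal w * ((runs X h (sourceWindow h α v) 0).card : ℝ≥0∞) *
            (groundEnergy (rescale X' α ν) ⊤ γ / ENNReal.ofReal γ) ≤
            4 * ENNReal.ofReal w * ENNReal.ofReal (16 * ν) *
              (ENNReal.ofReal (50000 * γ) / ENNReal.ofReal γ) := by
              gcongr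
              exact hU.trans (ENNReal.ofReal_le_ofReal (hU2 hle))
          _ = ENNReal.ofReal (4 * w * (16 * ν) * (50000 * γ / γ)) := by
              have h16 : 0 ≤ 4 * w * (16 * ν) := by positivity
              rw [← ENNReal.ofReal_div_of_pos hγ0, ← ENNReal.ofReal_ofNat 4,
                ← ENNReal.ofReal_mul (by norm_num), ← ENNReal.ofReal_mul (by positivity),
                ← ENNReal.ofReal_mul h16]
          _ ≤ ENNReal.ofReal (δ ^ 2) := by
              apply ENNReal.ofReal_le_ofReal
              have : 4 * w * (16 * ν) * (50000 * γ / γ) = 3200000 * η * l := by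
                rw [hw]; field_simp; norm_num
              rw [this]
              have := hlarge hle
              calc 3200000 * η * l ≤ 3200000 * η * 2 := by gcongr
                _ = δ ^ 2 := by rw [hη]; ring
          _ = _ := ENNReal.ofReal_pow hδ.le 2)
  refine hmain.trans ?_
  gcongr
  -- The five factors are two from the contraction, two from the retained mass, and one from `1 + δ
  -- ≤ (1 - δ)⁻¹`.
  have hq : 1 - δ ≤ ((n₀ : ℝ) - 1) / (n₀ + 2) := by
    rw [le_div_iff₀ (by positivity)]; linarith
  have h1δ : 0 < 1 - δ := by linarith
  have h1 : ENNReal.ofReal ((1 - δ) ^ 4) ≤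
      ENNReal.ofReal (((n₀ : ℝ) - 1) / (n₀ + 2)) ^ 2 * ENNReal.ofReal (1 - δ) ^ 2 := by
    rw [← ENNReal.ofReal_pow (h1δ.le.trans hq), ← ENNReal.ofReal_pow h1δ.le,
      ← ENNReal.ofReal_mul (by positivity)]
    apply ENNReal.ofReal_le_ofReal
    calc (1 - δ) ^ 4 = (1 - δ) ^ 2 * (1 - δ) ^ 2 := by ring
      _ ≤ _ := by gcongr
  calc (ENNReal.ofReal (((n₀ : ℝ) - 1) / (n₀ + 2)) ^ 2 * ENNReal.ofReal (1 - δ) ^ 2)⁻¹ *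
        (1 + (δ.toNNReal : ℝ≥0∞)) ≤
      (ENNReal.ofReal ((1 - δ) ^ 4))⁻¹ * ENNReal.ofReal (1 + δ) := by
        gcongr
        rw [ENNReal.ofReal_add one_pos.le hδ.le, ENNReal.ofReal_one, hδn]
    _ = ENNReal.ofReal (((1 - δ) ^ 4)⁻¹ * (1 + δ)) := by
        rw [← ENNReal.ofReal_inv_of_pos (by positivity), ← ENNReal.ofReal_mul (by positivity)]
    _ ≤ _ := by
        apply ENNReal.ofReal_le_ofReal
        rw [pow_succ (1 - δ) 4, mul_inv]
        gcongr
        rw [le_inv_comm₀ (by linarith) h1δ, ← one_div, le_div_iff₀ (by linarith)]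
        nlinarith

end Comparison

/-! ### The averaged energy and the contribution of atypical configurations -/

section Averaging

variable {Ω : Type*} [MeasurableSpace Ω] {P : Measure Ω} {Z : Ω → Set ℝ} {α : ℝ}

theorem encard_rescale_le (X : Set ℝ) (α : ℝ) {ν : ℝ} (hν : 0 < ν) :
    (rescale X α ν ∩ Icc 0 1).encard ≤ (X ∩ Icc (-(α * ν)) ((1 - α) * ν)).encard := by
  refine Set.encard_le_encard_of_injOn (f := fun z => ν * (z - α)) (fun z hz => ?_)
    (fun a _ b _ hab => ?_)
  · refine ⟨hz.1, ?_, ?_⟩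
    · nlinarith [hz.2.1]
    · nlinarith [hz.2.2]
  · simpa [hν.ne'] using hab

theorem sq_succ_le_four_mul_two_pow (k : ℕ) : (k + 1) ^ 2 ≤ 4 * 2 ^ k := by
  induction k using Nat.twoStepInduction with
  | zero => norm_num
  | one => norm_num
  | more k _ h2 =>
    rcases Nat.eq_zero_or_pos k with rfl | hk
    · norm_num
    · rw [pow_succ 2 (k + 1)]
      nlinarith

/-- Counts up to `r` go into the first term. Beyond `r` one has `(N + 1)² ≤ 4 · 2 ^ N ≤ 4 · 2 ^ (-r)
· 4 ^ N`, whose Poisson mean is explicit. The form suits integration over a small event. -/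
theorem add_one_sq_le_enatExp {r : ℝ} (hr : 0 ≤ r) (N : ℕ∞) :
    ((N : ℝ≥0∞) + 1) ^ 2 ≤ ENNReal.ofReal ((r + 1) ^ 2) +
      ENNReal.ofReal (4 * 2 ^ (-r)) * enatExp 4 N := by
  have h2 : (0 : ℝ) < 2 ^ (-r) := by positivity
  rcases eq_or_ne N ⊤ with rfl | hN
  · rw [enatExp, if_pos rfl, ENNReal.mul_top (by simpa using h2)]
    simp
  · lift N to ℕ using hN
    have h4 : enatExp 4 (N : ℕ∞) = ENNReal.ofReal (4 ^ N) := by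
      rw [enatExp, if_neg (ENat.natCast_ne_top N), ENat.toNat_natCast,
        ENNReal.ofReal_pow (by norm_num)]
      simp
    have hl : (((N : ℕ∞) : ℝ≥0∞) + 1) ^ 2 = ENNReal.ofReal (((N : ℝ) + 1) ^ 2) := by
      rw [ENNReal.ofReal_pow (by positivity), ENNReal.ofReal_add (by positivity) one_pos.le]
      simp
    rw [h4, hl, ← ENNReal.ofReal_mul (by positivity),
      ← ENNReal.ofReal_add (by positivity) (by positivity)]
    apply ENNReal.ofReal_le_ofReal
    rcases le_total (N : ℝ) r with hle | hle
    · have : ((N : ℝ) + 1) ^ 2 ≤ (r + 1) ^ 2 := by gcongr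
      have : (0 : ℝ) ≤ 4 * 2 ^ (-r) * 4 ^ N := by positivity
      linarith
    · have h5 : ((N : ℝ) + 1) ^ 2 ≤ 4 * 2 ^ N := by exact_mod_cast sq_succ_le_four_mul_two_pow N
      have h6 : (1 : ℝ) ≤ 2 ^ (-r) * 2 ^ N := by
        rw [← Real.rpow_natCast, ← Real.rpow_add two_pos]
        exact Real.one_le_rpow (by norm_num) (by linarith)
      have h7 : (4 : ℝ) ^ N = 2 ^ N * 2 ^ N := by rw [← mul_pow]; norm_num
      have h8 : (0 : ℝ) < 2 ^ N := by positivity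
      rw [h7]
      have h9 : 2 ^ N * 1 ≤ 2 ^ N * ((2 : ℝ) ^ (-r) * 2 ^ N) := by gcongr
      have h10 : 0 ≤ (r + 1) ^ 2 := by positivity
      nlinarith

/-- The contribution of an event to the averaged energy. -/
theorem setLIntegral_randomEnergy_le [IsProbabilityMeasure P] (hZ : IsPoissonProcess P Z 1)
    (α : ℝ) {γ ν : ℝ} (hγ : 0 ≤ γ) (hν : 0 < ν) (B : Set Ω) :
    ∫⁻ ω in B, randomEnergy Z α γ ⊤ ν ω ∂P ≤
      128 * (ENNReal.ofReal ((8 * ν + 1) ^ 2) * P B + 4) + ENNReal.ofReal (64 * γ) * P B := by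
  set W : Set ℝ := Icc (-(α * ν)) ((1 - α) * ν) with hW
  set N : Ω → ℕ∞ := fun ω => (Z ω ∩ W).encard with hN
  have hWv : (volume W).toReal = ν := by
    rw [hW, Real.volume_Icc, ENNReal.toReal_ofReal] <;> linarith
  have hE : ∫⁻ ω, enatExp 4 (N ω) ∂P = ENNReal.ofReal (Real.exp (ν * 3)) := by
    rw [hZ.lintegral_enatExp measurableSet_Icc (by simp), hWv]
    congr 3
    norm_num
  have hmeas : Measurable fun ω => enatExp 4 (N ω) :=
    (Measurable.of_discrete (f := enatExp 4)).comp (hZ.measurable_count W measurableSet_Icc)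
  have hpt : ∀ ω, randomEnergy Z α γ ⊤ ν ω ≤
      128 * (ENNReal.ofReal ((8 * ν + 1) ^ 2) +
        ENNReal.ofReal (4 * 2 ^ (-(8 * ν))) * enatExp 4 (N ω)) + ENNReal.ofReal (64 * γ) := by
    intro ω
    refine (groundEnergy_le_card _ hγ).trans ?_
    gcongr
    refine le_trans ?_ (add_one_sq_le_enatExp (by positivity) (N ω))
    gcongr
    exact encard_rescale_le (Z ω) α hν
  -- The threshold `8 * ν` makes the tail bounded, since `8 log 2 > 3`; the first term then carries
  -- the factor `P B`.
  have hsmall : ENNReal.ofReal (4 * 2 ^ (-(8 * ν))) * ENNReal.ofReal (Real.exp (ν * 3)) ≤ 4 := by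
    rw [← ENNReal.ofReal_mul (by positivity), ← ENNReal.ofReal_ofNat]
    apply ENNReal.ofReal_le_ofReal
    have : (2 : ℝ) ^ (-(8 * ν)) * Real.exp (ν * 3) ≤ 1 := by
      rw [Real.rpow_def_of_pos two_pos, ← Real.exp_add, Real.exp_le_one_iff]
      have := Real.log_two_gt_d9
      nlinarith
    linarith
  calc ∫⁻ ω in B, randomEnergy Z α γ ⊤ ν ω ∂P ≤ ∫⁻ ω in B,
      (128 * (ENNReal.ofReal ((8 * ν + 1) ^ 2) +
        ENNReal.ofReal (4 * 2 ^ (-(8 * ν))) * enatExp 4 (N ω)) + ENNReal.ofReal (64 * γ)) ∂P :=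
        lintegral_mono hpt
    _ = 128 * (ENNReal.ofReal ((8 * ν + 1) ^ 2) * P B + ENNReal.ofReal (4 * 2 ^ (-(8 * ν))) *
        ∫⁻ ω in B, enatExp 4 (N ω) ∂P) + ENNReal.ofReal (64 * γ) * P B := by
        rw [lintegral_add_right _ measurable_const, lintegral_const_mul' _ _ (by simp),
          lintegral_add_left measurable_const, lintegral_const_mul _ hmeas]
        simp
    _ ≤ _ := by
        gcongr
        refine le_trans ?_ hsmall
        rw [← hE]
        gcongr
        exact Measure.restrict_le_self

theorem averagedEnergy_lt_top [IsProbabilityMeasure P] (hZ : IsPoissonProcess P Z 1)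
    (α : ℝ) {γ ν : ℝ} (hγ : 0 ≤ γ) (hν : 0 < ν) : averagedEnergy P Z α γ ν < ⊤ := by
  have h := setLIntegral_randomEnergy_le hZ α hγ hν univ
  rw [Measure.restrict_univ] at h
  refine lt_of_le_of_lt h ?_
  simp only [measure_univ, mul_one]
  exact ENNReal.add_lt_top.2 ⟨ENNReal.mul_lt_top (by simp)
    (ENNReal.add_lt_top.2 ⟨by simp, by simp⟩), ENNReal.ofReal_lt_top⟩

theorem ofReal_half_le_averagedEnergy [IsProbabilityMeasure P] (Z : Ω → Set ℝ) (α γ ν : ℝ) :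
    ENNReal.ofReal (γ / 2) ≤ averagedEnergy P Z α γ ν := by
  calc ENNReal.ofReal (γ / 2) = ∫⁻ _, ENNReal.ofReal (γ / 2) ∂P := by simp
    _ ≤ _ := lintegral_mono fun ω => ofReal_half_le_groundEnergy _ _ _

/-- These are the conditions for a scale to be large enough. The last one holds because the power `v
^ (-θ)` of the failure probability beats the squared logarithm lost in the lower bound on the
typical energy. -/
theorem eventually_scale {h C θ δ : ℝ} (hh : 0 < h) (hC : 0 < C) (hθ : 0 < θ) (hθ1 : θ ≤ 1)
    (hδ : 0 < δ) : ∀ᶠ v : ℝ in atTop, 72 ≤ v ∧ 2 * Real.log (2 * v / h) ≤ h * (v / 24) ∧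
      C * v ^ (-θ) ≤ δ / 256 ∧
      128 * ((16 * v + 1) ^ 2 * (C * v ^ (-θ)) + 4) * (2 * Real.log (2 * v / h) + 4) ^ 2 ≤
        δ / 2 * v ^ 2 := by
  have hlin : Tendsto (fun v : ℝ => 2 * v / h) atTop atTop :=
    (tendsto_id.const_mul_atTop two_pos).atTop_div_const hh
  have h1 : ∀ᶠ v : ℝ in atTop, 2 * Real.log (2 * v / h) ≤ h * (v / 24) := by
    have := hlin.eventually (Real.isLittleO_log_id_atTop.bound
      (show 0 < h ^ 2 / 96 by positivity))
    filter_upwards [this, eventually_gt_atTop 0] with v hv hv0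
    simp only [id, Real.norm_eq_abs] at hv
    rw [abs_of_pos (show 0 < 2 * v / h by positivity)] at hv
    have e : h ^ 2 / 96 * (2 * v / h) = h * (v / 24) / 2 := by field_simp; norm_num
    rw [e] at hv
    linarith [le_abs_self (Real.log (2 * v / h))]
  have h2 : Tendsto (fun v : ℝ => C * v ^ (-θ)) atTop (𝓝 0) := by
    simpa using (tendsto_rpow_neg_atTop hθ).const_mul C
  have h3 : Tendsto (fun v : ℝ => v ^ (-(θ / 2)) * (2 * Real.log (2 * v / h) + 4)) atTop
      (𝓝 0) := by
    have e1 : Tendsto (fun v : ℝ => Real.log v / v ^ (θ / 2)) atTop (𝓝 0) :=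
      (isLittleO_log_rpow_atTop (by positivity)).tendsto_div_nhds_zero
    have e2 := tendsto_rpow_neg_atTop (show 0 < θ / 2 by positivity)
    have e3 := (e1.const_mul 2).add (e2.mul_const (2 * Real.log (2 / h) + 4))
    simp only [mul_zero, zero_mul, add_zero] at e3
    refine e3.congr' ?_
    filter_upwards [eventually_gt_atTop 0] with v hv
    rw [show 2 * v / h = v * (2 / h) by ring, Real.log_mul hv.ne' (by positivity),
      Real.rpow_neg hv.le]
    ring
  have h4 : Tendsto (fun v : ℝ => 128 * (289 * C + 4) *
      (v ^ (-(θ / 2)) * (2 * Real.log (2 * v / h) + 4)) ^ 2) atTop (𝓝 0) := by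
    simpa using (h3.pow 2).const_mul (128 * (289 * C + 4))
  filter_upwards [eventually_ge_atTop 72, h1,
    h2.eventually (eventually_le_nhds (show 0 < δ / 256 by positivity)),
    h4.eventually (eventually_le_nhds (show 0 < δ / 2 by positivity))] with v hv hv1 hv2 hv3
  refine ⟨hv, hv1, hv2, ?_⟩
  have hv0 : 0 < v := by linarith
  set L := 2 * Real.log (2 * v / h) + 4
  have e1 : (v ^ (-(θ / 2)) * L) ^ 2 = v ^ (-θ) * L ^ 2 := by
    rw [mul_pow, ← Real.rpow_natCast (v ^ (-(θ / 2))), ← Real.rpow_mul hv0.le]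
    congr 2; push_cast; ring
  rw [e1] at hv3
  have e2 : v⁻¹ ≤ v ^ (-θ) := by
    rw [← Real.rpow_neg_one]
    exact Real.rpow_le_rpow_of_exponent_le (by linarith) (by linarith)
  have e3 : 4 ≤ 4 * v ^ 2 * v ^ (-θ) := by
    calc (4 : ℝ) ≤ 4 * v := by linarith
      _ = 4 * v ^ 2 * v⁻¹ := by field_simp
      _ ≤ _ := by gcongr
  have e4 : (16 * v + 1) ^ 2 ≤ 289 * v ^ 2 := by nlinarith
  calc 128 * ((16 * v + 1) ^ 2 * (C * v ^ (-θ)) + 4) * L ^ 2 ≤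
      128 * (289 * v ^ 2 * (C * v ^ (-θ)) + 4 * v ^ 2 * v ^ (-θ)) * L ^ 2 := by gcongr
    _ = 128 * (289 * C + 4) * (v ^ (-θ) * L ^ 2) * v ^ 2 := by ring
    _ ≤ _ := by gcongr

/-- Almost surely, the random ground state energy and the averaged one agree up to a given relative
error, if the density of obstacles is large and the obstacles are sufficiently strong. -/
theorem ae_randomEnergy_close [IsProbabilityMeasure P] (hZ : IsPoissonProcess P Z 1)
    (hα : α ∈ Icc (0 : ℝ) 1) {δ : ℝ} (hδ : 0 < δ) (hδ1 : δ ≤ 1 / 2) :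
    ∀ᵐ ω ∂P, ∃ Λ ν₀ : ℝ, 0 < Λ ∧ ∀ (γ ν : ℝ) (σ : ℝ≥0∞), 1 ≤ γ → ν₀ ≤ ν →
      ENNReal.ofReal (Λ * (ν / logLength γ ν)) ≤ σ →
      ENNReal.ofReal ((1 - δ) ^ 6) * randomEnergy Z α γ σ ν ω ≤ averagedEnergy P Z α γ ν ∧
      ENNReal.ofReal ((1 - δ) ^ 6) * averagedEnergy P Z α γ ν ≤ randomEnergy Z α γ σ ν ω := by
  obtain ⟨n₀, hn₀, hn₀δ⟩ : ∃ n₀ : ℕ, 2 ≤ n₀ ∧ 3 ≤ δ * (n₀ + 2) := by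
    refine ⟨max 2 ⌈3 / δ⌉₊, le_max_left _ _, ?_⟩
    have h1 : 3 / δ ≤ (max 2 ⌈3 / δ⌉₊ : ℕ) :=
      (Nat.le_ceil _).trans (by exact_mod_cast le_max_right _ _)
    rw [div_le_iff₀ hδ] at h1
    linarith
  obtain ⟨h, hh, hh1, hn₀h⟩ : ∃ h : ℝ, 0 < h ∧ h ≤ 1 ∧ (n₀ + 2) * h ≤ δ ^ 2 / 3200000 := by
    refine ⟨min 1 (δ ^ 2 / 3200000 / (n₀ + 2)), by positivity, min_le_left _ _, ?_⟩
    calc ((n₀ : ℝ) + 2) * min 1 (δ ^ 2 / 3200000 / (n₀ + 2)) ≤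
        (n₀ + 2) * (δ ^ 2 / 3200000 / (n₀ + 2)) := by gcongr; exact min_le_right _ _
      _ = _ := by field_simp
  have hn₀h1 : n₀ * h ≤ 1 := by nlinarith
  obtain ⟨C, hC, hP⟩ := exists_measure_not_isTypical_le hZ hh hh1 hα hn₀
  have hn₀' : (2 : ℝ) ≤ n₀ := by exact_mod_cast hn₀
  have hθ1 : (1 / (12 * n₀) : ℝ) ≤ 1 := by rw [div_le_one (by positivity)]; linarith
  have hr : 1 < 1 + h / 24 := by
    have : 0 < h / 24 := by positivity
    linarith
  have hev := (tendsto_pow_atTop_atTop_of_one_lt hr).eventually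
    (eventually_scale hh hC (show 0 < (1 / (12 * n₀) : ℝ) by positivity) hθ1 hδ)
  filter_upwards [ae_eventually_isTypical hZ hh hh1 hα hn₀] with ω hω
  obtain ⟨k₀, hk₀⟩ := eventually_atTop.1 (hω.and hev)
  refine ⟨(1 + δ⁻¹) * (8 / (δ ^ 2 / 6400000)), (1 + h / 24) ^ k₀, by positivity, ?_⟩
  intro γ ν σ hγ hν hσ
  -- The density `ν` lies between two consecutive scales, and typicality at the lower one is used
  -- for it.
  obtain ⟨k, hk1, hk2⟩ := exists_nat_pow_near ((one_le_pow₀ hr.le).trans hν) hr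
  have hk : k₀ ≤ k := by
    have := (pow_lt_pow_iff_right₀ hr).1 (hν.trans_lt hk2)
    omega
  obtain ⟨htyp, hv, hlog, hsmall, hscale⟩ := hk₀ k hk
  rw [pow_succ, mul_comm] at hk2
  have hPv := hP _ hv
  set v := (1 + h / 24) ^ k with hvdef
  have hv0 : 0 < v := by linarith
  have hν0 : 0 < ν := by linarith
  have hν2 : ν ≤ 2 * v := by nlinarith
  have hγ0 : 0 < γ := by linarith
  have h1δ : 0 < 1 - δ := by linarith
  set θ : ℝ := 1 / (12 * n₀)
  -- Passing to a measurable hull allows the expectation to be split without measurability of the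
  -- typical event or of the energy; outside `B` every configuration is still typical.
  set B := toMeasurable P {ω | ¬ IsTypical (Z ω) h α v n₀} with hB
  have hBm : MeasurableSet B := measurableSet_toMeasurable _ _
  have hPB : P B ≤ ENNReal.ofReal (C * v ^ (-θ)) := by rw [hB, measure_toMeasurable]; exact hPv
  have hBc : ∀ ω' ∈ Bᶜ, IsTypical (Z ω') h α v n₀ := by
    intro ω' hω'
    by_contra hc
    exact hω' (subset_toMeasurable _ _ hc)
  set c := ENNReal.ofReal (((1 - δ) ^ 5)⁻¹) with hc
  have hlow : ∀ ω' ∈ Bᶜ, randomEnergy Z α γ ⊤ ν ω ≤ c * randomEnergy Z α γ ⊤ ν ω' :=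
    fun ω' hω' => (hBc ω' hω').groundEnergy_le hh hh1 hα hn₀ hδ hδ1 hn₀δ hn₀h hv hlog htyp hk1
      hk2.le hγ le_top
  have hupp : ∀ ω' ∈ Bᶜ, randomEnergy Z α γ ⊤ ν ω' ≤ c * randomEnergy Z α γ σ ν ω :=
    fun ω' hω' => htyp.groundEnergy_le hh hh1 hα hn₀ hδ hδ1 hn₀δ hn₀h hv hlog (hBc ω' hω') hk1
      hk2.le hγ hσ
  have hself : randomEnergy Z α γ ⊤ ν ω ≤ c * randomEnergy Z α γ σ ν ω :=
    htyp.groundEnergy_le hh hh1 hα hn₀ hδ hδ1 hn₀δ hn₀h hv hlog htyp hk1 hk2.le hγ hσ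
  have hc1 : ENNReal.ofReal ((1 - δ) ^ 5) * c = 1 := by
    rw [hc, ← ENNReal.ofReal_mul (by positivity), mul_inv_cancel₀ (by positivity),
      ENNReal.ofReal_one]
  have h6 : ENNReal.ofReal ((1 - δ) ^ 6) =
      ENNReal.ofReal (1 - δ) * ENNReal.ofReal ((1 - δ) ^ 5) := by
    rw [← ENNReal.ofReal_mul h1δ.le]; congr 1; ring
  have hsplit := lintegral_add_compl (μ := P) (fun ω' => randomEnergy Z α γ ⊤ ν ω') hBm
  constructor
  · have hPBc : ENNReal.ofReal (1 - δ) ≤ P Bᶜ := by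
      rw [prob_compl_eq_one_sub hBm, ENNReal.ofReal_sub _ hδ.le, ENNReal.ofReal_one]
      refine tsub_le_tsub_left (hPB.trans (ENNReal.ofReal_le_ofReal ?_)) _
      linarith
    -- The comparison is integrated over the typical `ω'` with `ω` fixed; the sixth factor `1 - δ`
    -- is the lower bound on `P Bᶜ`.
    have h1 : randomEnergy Z α γ ⊤ ν ω * P Bᶜ ≤ c * averagedEnergy P Z α γ ν := by
      calc randomEnergy Z α γ ⊤ ν ω * P Bᶜ = ∫⁻ _ in Bᶜ, randomEnergy Z α γ ⊤ ν ω ∂P := by simp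
        _ ≤ ∫⁻ ω' in Bᶜ, c * randomEnergy Z α γ ⊤ ν ω' ∂P :=
            setLIntegral_mono' hBm.compl hlow
        _ = c * ∫⁻ ω' in Bᶜ, randomEnergy Z α γ ⊤ ν ω' ∂P :=
            lintegral_const_mul' _ _ ENNReal.ofReal_ne_top
        _ ≤ _ := by
            gcongr
            exact setLIntegral_le_lintegral _ _
    calc ENNReal.ofReal ((1 - δ) ^ 6) * randomEnergy Z α γ σ ν ω ≤
        ENNReal.ofReal ((1 - δ) ^ 5) * (randomEnergy Z α γ ⊤ ν ω * P Bᶜ) := by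
          rw [h6, mul_comm (ENNReal.ofReal (1 - δ)), mul_assoc, mul_comm (ENNReal.ofReal (1 - δ))]
          gcongr
          exact groundEnergy_mono _ _ le_top
      _ ≤ ENNReal.ofReal ((1 - δ) ^ 5) * (c * averagedEnergy P Z α γ ν) := by gcongr
      _ = _ := by rw [← mul_assoc, hc1, one_mul]
  -- Atypical configurations are measured against the typical energy of `ω`: the obstacle count
  -- against `(ν / L)²`, the interaction against `γ / 2`, each taking half of `δ`.
  · have hbad : ∫⁻ ω' in B, randomEnergy Z α γ ⊤ ν ω' ∂P ≤
        ENNReal.ofReal δ * randomEnergy Z α γ ⊤ ν ω := by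
      have hlog0 : 0 ≤ Real.log (2 * v / h) := Real.log_nonneg (by
        rw [le_div_iff₀ hh]; linarith)
      have h1 := htyp.le_groundEnergy (γ := γ) hh hh1 hα hn₀ hn₀h1 hv hk1 hk2.le
      set L := 2 * Real.log (2 * v / h) + 4 with hL
      have hL0 : 0 < L := by linarith
      have hx0 : 0 ≤ C * v ^ (-θ) := by positivity
      set x := C * v ^ (-θ)
      clear_value x
      have h2 : ENNReal.ofReal (γ / 2) ≤ randomEnergy Z α γ ⊤ ν ω :=
        ofReal_half_le_groundEnergy _ _ _
      calc ∫⁻ ω' in B, randomEnergy Z α γ ⊤ ν ω' ∂P ≤ _ :=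
            setLIntegral_randomEnergy_le hZ α hγ0.le hν0 B
        _ ≤ 128 * (ENNReal.ofReal ((8 * ν + 1) ^ 2) * ENNReal.ofReal x + 4) +
            ENNReal.ofReal (64 * γ) * ENNReal.ofReal x := by gcongr
        _ = ENNReal.ofReal (128 * ((8 * ν + 1) ^ 2 * x + 4)) +
            ENNReal.ofReal (64 * γ * x) := by
            rw [ENNReal.ofReal_mul (p := 128) (by norm_num),
              ENNReal.ofReal_add (by positivity) (by norm_num),
              ENNReal.ofReal_mul (p := (8 * ν + 1) ^ 2) (by positivity),
              ENNReal.ofReal_mul (p := 64 * γ) (by positivity),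
              ENNReal.ofReal_ofNat, ENNReal.ofReal_ofNat]
        _ ≤ ENNReal.ofReal (δ / 2 * (ν / L) ^ 2) + ENNReal.ofReal (δ / 2 * (γ / 2)) := by
            refine add_le_add (ENNReal.ofReal_le_ofReal ?_) (ENNReal.ofReal_le_ofReal ?_)
            · rw [div_pow, mul_div_assoc', le_div_iff₀ (by positivity)]
              calc 128 * ((8 * ν + 1) ^ 2 * x + 4) * L ^ 2 ≤
                  128 * ((16 * v + 1) ^ 2 * x + 4) * L ^ 2 := by
                    have : 8 * ν + 1 ≤ 16 * v + 1 := by linarith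
                    gcongr
                _ ≤ δ / 2 * v ^ 2 := hscale
                _ ≤ _ := by gcongr
            · calc 64 * γ * x ≤ 64 * γ * (δ / 256) := by gcongr
                _ = _ := by ring
        _ ≤ ENNReal.ofReal (δ / 2) * randomEnergy Z α γ ⊤ ν ω +
            ENNReal.ofReal (δ / 2) * randomEnergy Z α γ ⊤ ν ω := by
            rw [ENNReal.ofReal_mul (by positivity), ENNReal.ofReal_mul (by positivity)]
            gcongr
            exact h1
        _ = _ := by
            rw [← add_mul, ← ENNReal.ofReal_add (by positivity) (by positivity), add_halves]
    have havg : averagedEnergy P Z α γ ν ≤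
        ENNReal.ofReal (1 + δ) * (c * randomEnergy Z α γ σ ν ω) := by
      calc averagedEnergy P Z α γ ν = _ := hsplit.symm
        _ ≤ ENNReal.ofReal δ * (c * randomEnergy Z α γ σ ν ω) +
            c * randomEnergy Z α γ σ ν ω := by
            refine add_le_add (hbad.trans (by gcongr)) ?_
            calc ∫⁻ ω' in Bᶜ, randomEnergy Z α γ ⊤ ν ω' ∂P ≤
                ∫⁻ _ in Bᶜ, c * randomEnergy Z α γ σ ν ω ∂P := setLIntegral_mono' hBm.compl hupp
              _ = c * randomEnergy Z α γ σ ν ω * P Bᶜ := by simp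
              _ ≤ _ := mul_le_of_le_one_right' prob_le_one
        _ = _ := by
            rw [ENNReal.ofReal_add one_pos.le hδ.le, ENNReal.ofReal_one]; ring
    calc ENNReal.ofReal ((1 - δ) ^ 6) * averagedEnergy P Z α γ ν ≤
        ENNReal.ofReal ((1 - δ) ^ 6) *
          (ENNReal.ofReal (1 + δ) * (c * randomEnergy Z α γ σ ν ω)) := by gcongr
      _ = ENNReal.ofReal ((1 - δ) * (1 + δ)) *
          (ENNReal.ofReal ((1 - δ) ^ 5) * c) * randomEnergy Z α γ σ ν ω := by
          rw [h6, ENNReal.ofReal_mul h1δ.le]; ring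
      _ ≤ _ := by
          rw [hc1, mul_one]
          refine mul_le_of_le_one_left' ?_
          rw [← ENNReal.ofReal_one]
          exact ENNReal.ofReal_le_ofReal (by nlinarith)

end Averaging

end DisorderedGP

/-! ### Convergence of the energy ratio -/

theorem mainTheorem2 {Ω : Type*} [MeasurableSpace Ω] (P : Measure Ω) [IsProbabilityMeasure P]
    (Z : Ω → Set ℝ) (hZ : DisorderedGP.IsPoissonProcess P Z 1)
    (α : ℝ) (hα : α ∈ Icc (0 : ℝ) 1) :
    ∀ᵐ ω ∂P, ∀ γ σ ν : ℕ → ℝ,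
      Tendsto γ atTop atTop → Tendsto σ atTop atTop → Tendsto ν atTop atTop →
      (fun n => ν n / (Real.log (ν n)) ^ 2) =o[atTop] γ →
      (fun n => ν n / (1 + Real.log (1 + (ν n) ^ 2 / γ n))) =o[atTop] σ →
      Tendsto (fun n => DisorderedGP.randomEnergy Z α (γ n) (ENNReal.ofReal (σ n)) (ν n) ω /
        DisorderedGP.averagedEnergy P Z α (γ n) (ν n)) atTop (𝓝 1) := by
  -- Countably many tolerances tending to zero suffice, so a single null set serves all of them and
  -- all parameter sequences at once.
  have hδ : ∀ m : ℕ, 0 < 1 / ((m : ℝ) + 2) ∧ 1 / ((m : ℝ) + 2) ≤ 1 / 2 := fun m =>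
    ⟨by positivity, by gcongr; linarith [m.cast_nonneg (α := ℝ)]⟩
  filter_upwards [ae_all_iff.2 fun m : ℕ =>
    DisorderedGP.ae_randomEnergy_close hZ hα (hδ m).1 (hδ m).2] with ω hω γ σ ν hγ hσ hν _ hσν
  have hq : Tendsto (fun m : ℕ => ENNReal.ofReal ((1 - 1 / ((m : ℝ) + 2)) ^ 6)) atTop (𝓝 1) := by
    have h1 : Tendsto (fun m : ℕ => 1 / ((m : ℝ) + 2)) atTop (𝓝 0) :=
      tendsto_const_nhds.div_atTop
        (tendsto_atTop_add_const_right _ _ tendsto_natCast_atTop_atTop)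
    have h2 := ENNReal.tendsto_ofReal ((h1.const_sub 1).pow 6)
    simpa using h2
  have hclose : ∀ m : ℕ, ∀ᶠ n in atTop,
      ENNReal.ofReal ((1 - 1 / ((m : ℝ) + 2)) ^ 6) ≤
        DisorderedGP.randomEnergy Z α (γ n) (ENNReal.ofReal (σ n)) (ν n) ω /
          DisorderedGP.averagedEnergy P Z α (γ n) (ν n) ∧
      DisorderedGP.randomEnergy Z α (γ n) (ENNReal.ofReal (σ n)) (ν n) ω /
          DisorderedGP.averagedEnergy P Z α (γ n) (ν n) ≤
        (ENNReal.ofReal ((1 - 1 / ((m : ℝ) + 2)) ^ 6))⁻¹ := by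
    intro m
    obtain ⟨Λ, ν₀, hΛ, hcmp⟩ := hω m
    filter_upwards [hγ.eventually_ge_atTop 1, hσ.eventually_gt_atTop 0,
      hν.eventually_ge_atTop ν₀, hν.eventually_gt_atTop 0,
      hσν.bound (inv_pos.2 hΛ)] with n hγn hσn hνn hνn0 hbound
    -- The little-o condition on `σ` is used with the constant `Λ⁻¹`; this is the obstacle strength
    -- required at tolerance `m`.
    have hσ' : ENNReal.ofReal (Λ * (ν n / DisorderedGP.logLength (γ n) (ν n))) ≤
        ENNReal.ofReal (σ n) := by
      apply ENNReal.ofReal_le_ofReal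
      rw [Real.norm_eq_abs, Real.norm_eq_abs, abs_of_pos hσn] at hbound
      have h1 := (le_abs_self _).trans hbound
      rw [inv_mul_eq_div, le_div_iff₀ hΛ, mul_comm] at h1
      exact h1
    obtain ⟨h1, h2⟩ := hcmp (γ n) (ν n) _ hγn hνn hσ'
    have hA0 : DisorderedGP.averagedEnergy P Z α (γ n) (ν n) ≠ 0 := by
      refine (lt_of_lt_of_le ?_ (DisorderedGP.ofReal_half_le_averagedEnergy Z α _ _)).ne'
      rw [ENNReal.ofReal_pos]
      linarith
    have hAt := (DisorderedGP.averagedEnergy_lt_top hZ α (by linarith : 0 ≤ γ n) hνn0).ne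
    have hq0 : ENNReal.ofReal ((1 - 1 / ((m : ℝ) + 2)) ^ 6) ≠ 0 := by
      have : 0 < 1 - 1 / ((m : ℝ) + 2) := by linarith [(hδ m).2]
      simp only [ne_eq, ENNReal.ofReal_eq_zero, not_le]
      positivity
    refine ⟨(ENNReal.le_div_iff_mul_le (Or.inl hA0) (Or.inl hAt)).2 h2, ?_⟩
    rw [ENNReal.div_le_iff hA0 hAt, ← ENNReal.div_eq_inv_mul,
      ENNReal.le_div_iff_mul_le (Or.inl hq0) (Or.inl ENNReal.ofReal_ne_top), mul_comm]
    exact h1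
  refine tendsto_order.2 ⟨fun a ha => ?_, fun b hb => ?_⟩
  · obtain ⟨m, hm⟩ := (hq.eventually (lt_mem_nhds ha)).exists
    exact (hclose m).mono fun n hn => hm.trans_le hn.1
  · have hq' := hq.inv
    rw [inv_one] at hq'
    obtain ⟨m, hm⟩ := (hq'.eventually (gt_mem_nhds hb)).exists
    exact (hclose m).mono fun n hn => hn.2.trans_lt hm
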